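/- Let $T>0$, $L>0$, let $0=a_0<a_1<\dots<a_N=L$, put $\Gamma=\{a_1,\dots,a_{N-1}\}$, $I_k=(a_k,a_{k+1})$, and let $p$ be piecewise constant, $p=p_k>0$ on $[a_k,a_{k+1})$ for $0\le k\le N-1$. All functions are real valued. For integers $m\ge 0$ let $$H^m_\Gamma(0,L)=\{u\in L^2(0,L)\;:\;u|_{I_k}\in H^m(I_k),\ 0\le k\le N-1\},\qquad \|u\|_{H^m_\Gamma}^2=\sum_{k=0}^{N-1}\|u|_{I_k}\|_{H^m(I_k)}^2 ,$$ and let $\mathcal H^3_\Gamma(0,L)$ be the space of $u\in H^3_\Gamma(0,L)$ with $u(0)=u(L)=u'(L)=0$ and, for $1\le k\le N-1$, $$u(a_k^-)=u(a_k^+),\qquad \sqrt{p_{k-1}}\,u'(a_k^-)=\sqrt{p_k}\,u'(a_k^+),\qquad p_{k-1}u''(a_k^-)=p_ku''(a_k^+).\tag{TC}$$ Consider the Korteweg–de Vries problem $$y_t+p(x)y_{xxx}+y_x+yy_x=0\ \text{ in }(0,T)\times(0,L),\qquad y(t,0)=y(t,L)=y_x(t,L)=0,\qquad y(0,\cdot)=y_0,$$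 coupled with the transmission conditions (TC) for $y(t,\cdot)$. A solution is a function $y\in \mathcal X^0_T:=C([0,T];L^2(0,L))\cap L^2(0,T;H^1(0,L))$ that satisfies Duhamel's formula $$y(t)=e^{t\widetilde{\mathcal A}}y_0+\int_0^t e^{(t-s)\widetilde{\mathcal A}}(-yy_x)(s)\,ds\qquad\text{for all }t\in[0,T],$$ where $(e^{t\widetilde{\mathcal A}})_{t\ge0}$ is the strongly continuous semigroup of contractions on $L^2(0,L)$ generated by $\widetilde{\mathcal A}=-p\,\partial_x^3-\partial_x$ with domain $\mathcal H^3_\Gamma(0,L)$ (the existence of this semigroup is part of the assertion). Equip $\mathcal X^0_T$ with the norm $\|y\|_{C([0,T];L^2)}+\|y\|_{L^2(0,T;H^1)}$, and $\mathcal X^3_{\Gamma,T}:=C([0,T];\mathcal H^3_\Gamma(0,L))\cap L^2(0,T;\mathcal H^3_\Gamma(0,L)\cap H^4_\Gamma(0,L))$ with the norm $\|y\|_{C([0,T];H^3_\Gamma)}+\|y\|_{L^2(0,T;H^4_\Gamma)}$. Then for every $y_0\in L^2(0,L)$ the problem has a unique solution $y\in\mathcal X^0_T$, and $$\|y\|_{\mathcal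 X^0_T}\le C\,\|y_0\|_{L^2(0,L)},$$ with a constant $C>0$ that depends only on $T$, $L$, $p$ (including the partition) and $\|y_0\|_{L^2(0,L)}$. If, in addition, $y_0\in\mathcal H^3_\Gamma(0,L)$, then $y\in\mathcal X^3_{\Gamma,T}$ and $$\|y\|_{\mathcal X^3_{\Gamma,T}}\le C\,\|y_0\|_{H^3_\Gamma(0,L)},$$ with $C$ depending on the same quantities only. -/

import Mathlib

open MeasureTheory Set Filter Topology
open scoped ContDiff

noncomputable section

namespace KdV

/-- The real Hilbert space `L²(0, L)`. -/
abbrev L2 (L : ℝ) : Type := Lp ℝ 2 (volume.restrict (Ioo (0 : ℝ) L))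

/-- `v` is the weak derivative of `u` on the open set `J ⊆ (0, L)`. Test functions are
supported in `J`, so that integrating over `(0, L)` is the same as integrating over `J`. -/
def IsWeakDeriv {L : ℝ} (J : Set ℝ) (u v : L2 L) : Prop :=
  ∀ φ : ℝ → ℝ, ContDiff ℝ ∞ φ → HasCompactSupport φ → tsupport φ ⊆ J →
    ∫ x in Ioo 0 L, u x * deriv φ x = -∫ x in Ioo 0 L, v x * φ x

theorem integrable_mul_test {L : ℝ} (u : L2 L) {φ : ℝ → ℝ} (hφ : Continuous φ)
    (hs : HasCompactSupport φ) : Integrable (fun x => u x * φ x) (volume.restrict (Ioo 0 L)) :=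
  (Lp.memLp u).integrable_mul
    (((hφ.memLp_of_hasCompactSupport hs : MemLp φ 2 volume)).restrict (Ioo 0 L))

theorem isWeakDeriv_zero {L : ℝ} (J : Set ℝ) : IsWeakDeriv J (0 : L2 L) 0 := by
  intro φ _ _ _
  have h0 := Lp.coeFn_zero ℝ 2 (volume.restrict (Ioo (0 : ℝ) L))
  have h : ∀ ψ : ℝ → ℝ, ∫ x in Ioo 0 L, (0 : L2 L) x * ψ x = 0 := by
    intro ψ
    rw [integral_congr_ae (g := fun _ => (0 : ℝ)), integral_zero]
    filter_upwards [h0] with x hx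
    rw [hx, Pi.zero_apply, zero_mul]
  rw [h, h, neg_zero]

theorem integral_add_mul_test {L : ℝ} (u u' : L2 L) {φ : ℝ → ℝ} (hφ : Continuous φ)
    (hs : HasCompactSupport φ) :
    ∫ x in Ioo 0 L, (u + u') x * φ x
      = (∫ x in Ioo 0 L, u x * φ x) + ∫ x in Ioo 0 L, u' x * φ x := by
  rw [← integral_add (integrable_mul_test u hφ hs) (integrable_mul_test u' hφ hs)]
  refine integral_congr_ae ?_
  filter_upwards [Lp.coeFn_add u u'] with x hx
  rw [hx, Pi.add_apply, add_mul]

theorem integral_smul_mul {L : ℝ} (c : ℝ) (u : L2 L) (φ : ℝ → ℝ) :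
    ∫ x in Ioo 0 L, (c • u) x * φ x = c * ∫ x in Ioo 0 L, u x * φ x := by
  rw [← integral_const_mul]
  refine integral_congr_ae ?_
  filter_upwards [Lp.coeFn_smul c u] with x hx
  rw [hx, Pi.smul_apply, smul_eq_mul, mul_assoc]

theorem IsWeakDeriv.add {L : ℝ} {J : Set ℝ} {u u' v v' : L2 L} (h : IsWeakDeriv J u v)
    (h' : IsWeakDeriv J u' v') : IsWeakDeriv J (u + u') (v + v') := by
  intro φ h1 h2 h3
  rw [integral_add_mul_test u u' (h1.continuous_deriv (by simp)) h2.deriv,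
    integral_add_mul_test v v' h1.continuous h2, h φ h1 h2 h3, h' φ h1 h2 h3, neg_add]

theorem IsWeakDeriv.smul {L : ℝ} {J : Set ℝ} {u v : L2 L} (c : ℝ) (h : IsWeakDeriv J u v) :
    IsWeakDeriv J (c • u) (c • v) := by
  intro φ h1 h2 h3
  rw [integral_smul_mul, integral_smul_mul, h φ h1 h2 h3, mul_neg]

/-- The functions `u ∈ L²(0, L)` with `u ∈ H^m(J i)` for every piece `J i`, represented by the
tuple `(u, u', …, u^(m))` of their piecewise weak derivatives. The norm is the one of the ambient
Hilbert sum, `‖u‖² = ∑_{j ≤ m} ‖u^(j)‖²_{L²}`. -/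
def sobolev (L : ℝ) {ι : Type} (J : ι → Set ℝ) (m : ℕ) :
    Submodule ℝ (PiLp 2 (fun _ : Fin (m + 1) => L2 L)) where
  carrier := {U | ∀ (j : Fin m) (i : ι), IsWeakDeriv (J i) (U j.castSucc) (U j.succ)}
  zero_mem' := fun _ i => isWeakDeriv_zero (J i)
  add_mem' := fun hU hV j i => (hU j i).add (hV j i)
  smul_mem' := fun c _ hU j i => (hU j i).smul c

/-- The usual Sobolev space `H¹(0, L)`. -/
abbrev H1 (L : ℝ) : Submodule ℝ (PiLp 2 (fun _ : Fin (1 + 1) => L2 L)) :=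
  sobolev L (fun _ : Unit => Ioo 0 L) 1

/-- A positive piecewise constant coefficient on `[0, L]`: a partition
`0 = a_0 < a_1 < ⋯ < a_N = L` and the value `p_k > 0` on the `k`-th piece, `0 ≤ k < N`. -/
structure Coeff (L : ℝ) where
  N : ℕ
  a : Fin (N + 1) → ℝ
  strictMono_a : StrictMono a
  a_zero : a 0 = 0
  a_last : a (Fin.last N) = L
  p : Fin N → ℝ
  p_pos : ∀ k, 0 < p k

/-- The open interval `I_k = (a_k, a_{k+1})`. -/
def Coeff.piece {L : ℝ} (D : Coeff L) (k : Fin D.N) : Set ℝ := Ioo (D.a k.castSucc) (D.a k.succ)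

/-- The space `H^m_Γ(0, L)`. -/
abbrev HGamma {L : ℝ} (D : Coeff L) (m : ℕ) :
    Submodule ℝ (PiLp 2 (fun _ : Fin (m + 1) => L2 L)) :=
  sobolev L D.piece m

/-- `g k j` is the continuous representative on `[a_k, a_{k+1}]` of the function `u j`. Its values
at the two end points are the one-sided traces `u_j(a_k^+)` and `u_j(a_{k+1}^-)`. -/
def IsRep {L : ℝ} (D : Coeff L) (u : Fin 3 → L2 L) (g : Fin D.N → Fin 3 → ℝ → ℝ) : Prop :=
  ∀ k j, ContinuousOn (g k j) (Icc (D.a k.castSucc) (D.a k.succ)) ∧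
    ∀ᵐ x ∂(volume.restrict (D.piece k)), u j x = g k j x

/-- The boundary conditions `u(0) = u(L) = u'(L) = 0` and the transmission conditions at the
interface points, for the continuous representatives `g k j` of `u^(j)` on the `k`-th piece.
Consecutive pieces `k`, `l` meet at the point `a_{k+1} = a_l`. -/
structure BoundaryTransmission {L : ℝ} (D : Coeff L) (g : Fin D.N → Fin 3 → ℝ → ℝ) : Prop where
  left : ∀ k : Fin D.N, (k : ℕ) = 0 → g k 0 (D.a k.castSucc) = 0
  right : ∀ k : Fin D.N, (k : ℕ) + 1 = D.N → g k 0 (D.a k.succ) = 0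
  right' : ∀ k : Fin D.N, (k : ℕ) + 1 = D.N → g k 1 (D.a k.succ) = 0
  jump0 : ∀ k l : Fin D.N, (k : ℕ) + 1 = l → g k 0 (D.a k.succ) = g l 0 (D.a l.castSucc)
  jump1 : ∀ k l : Fin D.N, (k : ℕ) + 1 = l →
    √(D.p k) * g k 1 (D.a k.succ) = √(D.p l) * g l 1 (D.a l.castSucc)
  jump2 : ∀ k l : Fin D.N, (k : ℕ) + 1 = l →
    D.p k * g k 2 (D.a k.succ) = D.p l * g l 2 (D.a l.castSucc)

theorem piece_subset {L : ℝ} (D : Coeff L) (k : Fin D.N) : D.piece k ⊆ Ioo 0 L := by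
  refine Ioo_subset_Ioo ?_ ?_
  · rw [← D.a_zero]
    exact D.strictMono_a.monotone (Fin.zero_le _)
  · conv_rhs => rw [← D.a_last]
    exact D.strictMono_a.monotone (Fin.le_last _)

theorem ae_piece {L : ℝ} (D : Coeff L) (k : Fin D.N) {P : ℝ → Prop}
    (h : ∀ᵐ x ∂(volume.restrict (Ioo 0 L)), P x) : ∀ᵐ x ∂(volume.restrict (D.piece k)), P x :=
  ae_restrict_of_ae_restrict_of_subset (piece_subset D k) h

/-- The elements of `H^{n+3}_Γ(0, L)` that satisfy the boundary and transmission conditions.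
For `n = 0` this is `𝓗³_Γ(0, L)`, and for `n = 1` it is `𝓗³_Γ(0, L) ∩ H⁴_Γ(0, L)`; the norm is
the one of `H^{n+3}_Γ(0, L)`. -/
def HCal {L : ℝ} (D : Coeff L) (n : ℕ) :
    Submodule ℝ (PiLp 2 (fun _ : Fin (n + 3 + 1) => L2 L)) where
  carrier := {U | U ∈ HGamma D (n + 3) ∧
    ∃ g, IsRep D ![U 0, U 1, U 2] g ∧ BoundaryTransmission D g}
  zero_mem' := by
    refine ⟨Submodule.zero_mem _, fun _ _ _ => 0, fun k j => ⟨continuousOn_const, ?_⟩, ?_⟩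
    · filter_upwards [ae_piece D k (Lp.coeFn_zero ℝ 2 (volume.restrict (Ioo (0 : ℝ) L)))] with x hx
      fin_cases j <;> simpa using hx
    · constructor <;> simp
  add_mem' := by
    rintro U V ⟨hU, g, hg, bg⟩ ⟨hV, h, hh, bh⟩
    refine ⟨Submodule.add_mem _ hU hV, fun k j x => g k j x + h k j x,
      fun k j => ⟨(hg k j).1.add (hh k j).1, ?_⟩, ?_⟩
    · have e := ae_piece D k (Lp.coeFn_add (![U 0, U 1, U 2] j) (![V 0, V 1, V 2] j))
      filter_upwards [(hg k j).2, (hh k j).2, e] with x h1 h2 h3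
      rw [← h1, ← h2, ← Pi.add_apply, ← h3]
      fin_cases j <;> rfl
    · constructor
      · intro k hk; simp [bg.left k hk, bh.left k hk]
      · intro k hk; simp [bg.right k hk, bh.right k hk]
      · intro k hk; simp [bg.right' k hk, bh.right' k hk]
      · intro k l hk; simp [bg.jump0 k l hk, bh.jump0 k l hk]
      · intro k l hk; simp [mul_add, bg.jump1 k l hk, bh.jump1 k l hk]
      · intro k l hk; simp [mul_add, bg.jump2 k l hk, bh.jump2 k l hk]
  smul_mem' := by
    rintro c U ⟨hU, g, hg, bg⟩
    refine ⟨Submodule.smul_mem _ c hU, fun k j x => c * g k j x,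
      fun k j => ⟨continuousOn_const.mul (hg k j).1, ?_⟩, ?_⟩
    · have e := ae_piece D k (Lp.coeFn_smul c (![U 0, U 1, U 2] j))
      filter_upwards [(hg k j).2, e] with x h1 h3
      rw [← h1, ← smul_eq_mul, ← Pi.smul_apply, ← h3]
      fin_cases j <;> rfl
    · constructor
      · intro k hk; simp [bg.left k hk]
      · intro k hk; simp [bg.right k hk]
      · intro k hk; simp [bg.right' k hk]
      · intro k l hk; simp [bg.jump0 k l hk]
      · intro k l hk; simp only [mul_left_comm _ c, bg.jump1 k l hk]
      · intro k l hk; simp only [mul_left_comm _ c, bg.jump2 k l hk]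

/-- `v = -p u''' - u'` for `u ∈ 𝓗³_Γ(0, L)`, that is, `(u, v)` is in the graph of the operator
`-p ∂ₓ³ - ∂ₓ` with domain `𝓗³_Γ(0, L)` on `L²(0, L)`. -/
def IsOperatorValue {L : ℝ} (D : Coeff L) (u v : L2 L) : Prop :=
  ∃ U : HCal D 0, U.1 0 = u ∧
    ∀ k, ∀ᵐ x ∂(volume.restrict (D.piece k)), v x = -(D.p k * U.1 3 x) - U.1 1 x

/-- Strongly continuous semigroups of contractions `(S t)_{t ≥ 0}`; the values at negative times
are irrelevant. -/
structure IsContractionSemigroup {E : Type} [NormedAddCommGroup E] [NormedSpace ℝ E]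
    (S : ℝ → E →L[ℝ] E) : Prop where
  map_zero : S 0 = ContinuousLinearMap.id ℝ E
  map_add : ∀ s t, 0 ≤ s → 0 ≤ t → S (s + t) = (S s).comp (S t)
  contraction : ∀ t, 0 ≤ t → ‖S t‖ ≤ 1
  continuousOn : ∀ u, ContinuousOn (fun t => S t u) (Ici 0)

/-- `S` is the strongly continuous semigroup of contractions on `L²(0, L)` whose infinitesimal
generator is the operator `-p ∂ₓ³ - ∂ₓ` with domain `𝓗³_Γ(0, L)`. -/
def IsKdVSemigroup {L : ℝ} (D : Coeff L) (S : ℝ → L2 L →L[ℝ] L2 L) : Prop :=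
  IsContractionSemigroup S ∧ ∀ u v : L2 L,
    Tendsto (fun h : ℝ => h⁻¹ • (S h u - u)) (𝓝[>] 0) (𝓝 v) ↔ IsOperatorValue D u v

/-- The space `C([0, T]; E) ∩ L²(0, T; F)`, where `E` and `F` are both embedded in a common space
`G` through `κ` and `ι`: a continuous function `cont` and a class `sq` of square integrable
functions that agree at almost every time. -/
structure InterSpace (T : ℝ) {E F G : Type} [NormedAddCommGroup E] [NormedAddCommGroup F]
    (κ : E → G) (ι : F → G) where
  cont : C(Icc (0 : ℝ) T, E)
  sq : Lp F 2 (volume.restrict (Ioo (0 : ℝ) T))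
  agree : ∀ᵐ t ∂(volume.restrict (Ioo (0 : ℝ) T)), ∀ ht : t ∈ Icc 0 T,
    ι (sq t) = κ (cont ⟨t, ht⟩)

/-- The natural norm `‖y‖_{C([0, T]; E)} + ‖y‖_{L²(0, T; F)}`. -/
def InterSpace.norm {T : ℝ} {E F G : Type} [NormedAddCommGroup E] [NormedAddCommGroup F]
    {κ : E → G} {ι : F → G} (y : InterSpace T κ ι) : ℝ := ‖y.cont‖ + ‖y.sq‖

/-- The function `u ∈ L²(0, L)` underlying a tuple `(u, u', …, u^(m))`. -/
def toL2 {L : ℝ} {m : ℕ} (V : Submodule ℝ (PiLp 2 (fun _ : Fin (m + 1) => L2 L))) :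
    V → L2 L :=
  fun U => U.1 0

/-- `C([0, T]; L²(0, L)) ∩ L²(0, T; H¹(0, L))`. -/
abbrev X0 (L T : ℝ) := InterSpace T (id : L2 L → L2 L) (toL2 (H1 L))

/-- `C([0, T]; 𝓗³_Γ(0, L)) ∩ L²(0, T; 𝓗³_Γ(0, L) ∩ H⁴_Γ(0, L))`. -/
abbrev X3 {L : ℝ} (D : Coeff L) (T : ℝ) := InterSpace T (toL2 (HCal D 0)) (toL2 (HCal D 1))

/-- `y ∈ C([0, T]; L²) ∩ L²(0, T; H¹)` is a solution with initial datum `y₀`, in the sense of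
Duhamel's formula
`y(t) = e^{tA} y₀ + ∫₀ᵗ e^{(t-s)A} (-y yₓ)(s) ds` for all `t ∈ [0, T]`, with
`A = -p ∂ₓ³ - ∂ₓ` on the domain `𝓗³_Γ(0, L)`. The source `F = -y yₓ` is in `L¹(0, T; L²(0, L))`. -/
def IsSolution {L : ℝ} (D : Coeff L) (T : ℝ) (y₀ : L2 L) (y : X0 L T) : Prop :=
  ∃ S : ℝ → L2 L →L[ℝ] L2 L, IsKdVSemigroup D S ∧
  ∃ F : ℝ → L2 L, Integrable F (volume.restrict (Ioo 0 T)) ∧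
    (∀ᵐ t ∂(volume.restrict (Ioo 0 T)), ∀ᵐ x ∂(volume.restrict (Ioo 0 L)),
      F t x = -((y.sq t).1 0 x * (y.sq t).1 1 x)) ∧
    ∀ t : Icc (0 : ℝ) T,
      y.cont t = S t y₀ + ∫ s in (0 : ℝ)..t, S (t - s) (F s)

end KdV

end

open MeasureTheory Set Filter Topology
open scoped ContDiff

noncomputable section

namespace KdV

/-! ### Calculus of primitives of integrable functions; Gronwall's inequality -/

section Calculus

/-! Put `w0 = u`, `w1 = p^(1/2) u'`, `w2 = p u''`. The transmission conditions say exactly that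
these three functions are continuous across the interfaces, and they satisfy `w0' = p^(-1/2) w1`,
`w1' = p^(-1/2) w2`, `w2' = p u'''`. In these variables every integration by parts is global, and
the domain of `A = -p ∂ₓ³ - ∂ₓ` is parametrised by `(w1(0), w2(0), p u''')` subject to two linear
end conditions (`exists_data`, `isOperatorValue_iff`).

Three facts then carry the analysis. First, `⟪u, A u⟫ = -w1(0)² / 2` (`inner_w0_opValue`), so `A` is
dissipative; the equation `l u - A u = f` is a Volterra equation followed by a two-dimensional
shooting problem (`exists_resOp_eq`), and Yosida approximation produces the semigroup. Second,
Kato's multiplier `q(x) = ∫₀ˣ p^(-1/2)`, suitably scaled to an operator `Q`, gives `‖u'‖² + ⟪Q u, A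
u⟫ ≤ K ‖u‖²` (`kato_smoothing`), which is the gain of one derivative in `L²` in time. Third, the
convection term satisfies `⟪u, u u'⟫ = 0`, and its product with `Q u` is at most `K ‖u'‖ ‖u‖²`
(`convection`). The evolution problem uses only these facts, in the abstract form `Frame` and
`Convection`, where `V` stands for `H¹₀(0, L)` and `B(u, u)` for `u u'`.

Energy inequalities for integrated solutions, obtained by regularising with the operators `J_n`
(`Frame.energy_le`), give a priori bounds in terms of the `L²` norm of the datum, Lipschitz
dependence on the datum and hence uniqueness (`IsNLSol.norm_le`, `IsNLSol.integral_le`,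
`IsNLSol.sub_le`). For existence, the bound `‖B(U, U)‖ ≤ ‖B‖ ‖U‖²` in `L²(0, τ; V)` carries no small
power of `τ`. For data in the domain one therefore solves for the time derivative `z = y_t`, which
satisfies `z' + 2 B(y, z) = A z` with `y = Y₀ + ∫ z`: now `y` is continuous with values in `V`, and
the fixed point map contracts on short intervals (`Frame.exists_local_regSol`). An a priori bound
makes the solution global (`Frame.exists_regSol`), and Lipschitz dependence extends existence to all
of `L²` (`Frame.exists_nlSol`).

For regular data, `A y = z + y yₓ` with `z` in `C([0, T]; L²) ∩ L²(0, T; H¹₀)`. The closed range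
theorem bounds the `H³_Γ` norm by the graph norm, and one differentiation in `x` gives the fourth
derivative (`exists_X3`). The estimate is linear in the datum because the quadratic quantity `‖u'‖²`
is at most `K ‖u‖² + ‖Q‖ ‖u‖ ‖A u‖`, where one factor is controlled by the `L²` norm alone
(`Frame.exists_regular_bound`). -/

theorem _root_.IntervalIntegrable.mono_Icc {E : Type*} [NormedAddCommGroup E] {a b t : ℝ} {f : ℝ → E}
    (hf : IntervalIntegrable f volume a b) (ht : t ∈ Icc a b) : IntervalIntegrable f volume a t :=
  hf.mono_set (by rw [uIcc_of_le ht.1, uIcc_of_le (ht.1.trans ht.2)]; exact Icc_subset_Icc_right ht.2)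

variable {E F G : Type*} [NormedAddCommGroup E] [NormedSpace ℝ E]
  [NormedAddCommGroup F] [NormedSpace ℝ F] [NormedAddCommGroup G] [NormedSpace ℝ G]

/-- Fubini's theorem on a triangle. -/
theorem integral_triangle_swap {a b : ℝ} (hab : a ≤ b) {h : ℝ → ℝ → E}
    (hh : Integrable (Function.uncurry h)
      ((volume.restrict (Ioc a b)).prod (volume.restrict (Ioc a b)))) :
    ∫ s in a..b, ∫ r in a..s, h s r = ∫ r in a..b, ∫ s in r..b, h s r := by
  set μ := volume.restrict (Ioc a b)
  have hms : MeasurableSet {p : ℝ × ℝ | p.2 ≤ p.1} := measurableSet_le measurable_snd measurable_fst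
  have hi : Integrable (Function.uncurry fun s r => {p : ℝ × ℝ | p.2 ≤ p.1}.indicator
      (Function.uncurry h) (s, r)) (μ.prod μ) := by
    simpa using! hh.indicator hms
  have key := integral_integral_swap hi
  rw [intervalIntegral.integral_of_le hab, intervalIntegral.integral_of_le hab]
  refine Eq.trans ?_ (key.trans ?_)
  · refine setIntegral_congr_fun measurableSet_Ioc fun s hs => ?_
    rw [intervalIntegral.integral_of_le hs.1.le]
    have : ∀ r, {p : ℝ × ℝ | p.2 ≤ p.1}.indicator (Function.uncurry h) (s, r)
        = (Iic s).indicator (h s) r := by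
      intro r; by_cases hr : r ≤ s <;> simp [indicator, hr]
    simp_rw [this]
    rw [integral_indicator measurableSet_Iic, Measure.restrict_restrict measurableSet_Iic,
      inter_comm, Ioc_inter_Iic, min_eq_right hs.2]
  · refine setIntegral_congr_fun measurableSet_Ioc fun r hr => ?_
    rw [intervalIntegral.integral_of_le hr.2]
    have : ∀ s, {p : ℝ × ℝ | p.2 ≤ p.1}.indicator (Function.uncurry h) (s, r)
        = (Ici r).indicator (fun s => h s r) s := by
      intro s; by_cases hs : r ≤ s <;> simp [indicator, hs]
    simp_rw [this]
    rw [integral_indicator measurableSet_Ici, Measure.restrict_restrict measurableSet_Ici,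
      ← integral_Icc_eq_integral_Ioc]
    congr 2
    ext s
    have := hr.1
    simp only [mem_inter_iff, mem_Ici, mem_Ioc, mem_Icc]
    grind

theorem intervalIntegrable_triangle {a b : ℝ} (hab : a ≤ b) {h : ℝ → ℝ → E}
    (hh : Integrable (Function.uncurry h)
      ((volume.restrict (Ioc a b)).prod (volume.restrict (Ioc a b)))) :
    IntervalIntegrable (fun r => ∫ s in r..b, h s r) volume a b := by
  set μ := volume.restrict (Ioc a b)
  have hms : MeasurableSet {p : ℝ × ℝ | p.2 ≤ p.1} := measurableSet_le measurable_snd measurable_fst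
  have hi : Integrable ({p : ℝ × ℝ | p.2 ≤ p.1}.indicator (Function.uncurry h)) (μ.prod μ) :=
    hh.indicator hms
  rw [intervalIntegrable_iff_integrableOn_Ioc_of_le hab]
  refine hi.integral_prod_right.congr ?_
  filter_upwards [ae_restrict_mem measurableSet_Ioc] with r hr
  rw [intervalIntegral.integral_of_le hr.2]
  have : ∀ s, {p : ℝ × ℝ | p.2 ≤ p.1}.indicator (Function.uncurry h) (s, r)
      = (Ici r).indicator (fun s => h s r) s := by
    intro s; by_cases hs : r ≤ s <;> simp [indicator, hs]
  simp_rw [this]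
  rw [integral_indicator measurableSet_Ici, Measure.restrict_restrict measurableSet_Ici,
    ← integral_Icc_eq_integral_Ioc]
  congr 2
  ext s
  have := hr.1
  simp only [mem_inter_iff, mem_Ici, mem_Ioc, mem_Icc]
  grind

theorem _root_.IntervalIntegrable.bilin_left (B : E →L[ℝ] F →L[ℝ] G) {a b : ℝ} {u : ℝ → E}
    {g : ℝ → F} (hu : ContinuousOn u (uIcc a b)) (hg : IntervalIntegrable g volume a b) :
    IntervalIntegrable (fun s => B (u s) (g s)) volume a b := by
  rw [intervalIntegrable_iff] at hg ⊢
  obtain ⟨C, hC⟩ := isCompact_uIcc.exists_bound_of_continuousOn hu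
  have hm : AEStronglyMeasurable u (volume.restrict (uIoc a b)) :=
    (hu.mono uIoc_subset_uIcc).aestronglyMeasurable measurableSet_uIoc
  refine Integrable.mono' (hg.norm.const_mul (‖B‖ * C))
    (B.aestronglyMeasurable_comp₂ hm hg.aestronglyMeasurable) ?_
  filter_upwards [ae_restrict_mem measurableSet_uIoc] with s hs
  refine (B.le_opNorm₂ _ _).trans ?_
  gcongr
  exact hC s (uIoc_subset_uIcc hs)

theorem _root_.IntervalIntegrable.bilin_right (B : E →L[ℝ] F →L[ℝ] G) {a b : ℝ} {u : ℝ → E}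
    {g : ℝ → F} (hu : IntervalIntegrable u volume a b) (hg : ContinuousOn g (uIcc a b)) :
    IntervalIntegrable (fun s => B (u s) (g s)) volume a b := by
  simpa using IntervalIntegrable.bilin_left B.flip hg hu

theorem continuousOn_integral {a b : ℝ} {f : ℝ → E} (hab : a ≤ b)
    (hf : IntervalIntegrable f volume a b) : ContinuousOn (fun t => ∫ s in a..t, f s) (Icc a b) := by
  rw [← uIcc_of_le hab]
  exact intervalIntegral.continuousOn_primitive_interval (by simpa [uIcc_of_le hab] using! (intervalIntegrable_iff_integrableOn_Icc_of_le hab).1 hf)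

variable [CompleteSpace E] [CompleteSpace F] [CompleteSpace G]

/-- The left side is an integral over a square. The diagonal cuts it into two triangles, and
exchanging the order on one of them gives the two terms. Primitives of merely integrable functions
thus obey the product rule without any differentiation. -/
theorem bilin_integral_integral (B : E →L[ℝ] F →L[ℝ] G) {a b : ℝ} (hab : a ≤ b) {f : ℝ → E}
    {g : ℝ → F} (hf : IntervalIntegrable f volume a b) (hg : IntervalIntegrable g volume a b) :
    B (∫ s in a..b, f s) (∫ s in a..b, g s)
      = ∫ s in a..b, (B (f s) (∫ r in a..s, g r) + B (∫ r in a..s, f r) (g s)) := by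
  have hf' := (intervalIntegrable_iff_integrableOn_Ioc_of_le hab).1 hf
  have hg' := (intervalIntegrable_iff_integrableOn_Ioc_of_le hab).1 hg
  have hB : Integrable (Function.uncurry fun s r => B (f s) (g r))
      ((volume.restrict (Ioc a b)).prod (volume.restrict (Ioc a b))) :=
    hf'.op_fst_snd (op := fun x y => B x y) (by fun_prop) ⟨‖B‖, B.le_opNorm₂⟩ hg'
  have hF := continuousOn_integral hab hf
  have hG := continuousOn_integral hab hg
  rw [← uIcc_of_le hab] at hF hG
  have e1 : ∫ s in a..b, B (f s) (∫ r in a..s, g r) = ∫ s in a..b, ∫ r in a..s, B (f s) (g r) := by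
    refine intervalIntegral.integral_congr fun s hs => ?_
    rw [uIcc_of_le hab] at hs
    exact ((B (f s)).intervalIntegral_comp_comm (hg.mono_Icc hs)).symm
  have e2 : ∫ s in a..b, B (∫ r in a..s, f r) (g s) = ∫ r in a..b, ∫ s in a..r, B (f s) (g r) := by
    refine intervalIntegral.integral_congr fun s hs => ?_
    rw [uIcc_of_le hab] at hs
    exact ((B.flip (g s)).intervalIntegral_comp_comm (hf.mono_Icc hs)).symm
  rw [intervalIntegral.integral_add (hf.bilin_right B hG) (hg.bilin_left B hF), e1, e2,
    integral_triangle_swap hab hB]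
  rw [← intervalIntegral.integral_add]
  · have : ∀ r ∈ Icc a b, (∫ s in r..b, B (f s) (g r)) + ∫ s in a..r, B (f s) (g r)
        = B (∫ s in a..b, f s) (g r) := by
      intro r hr
      have h1 := hf.mono_Icc hr
      have h2 : IntervalIntegrable f volume r b := h1.symm.trans hf
      rw [add_comm, intervalIntegral.integral_add_adjacent_intervals]
      · exact (B.flip (g r)).intervalIntegral_comp_comm hf
      · exact ⟨(B.flip (g r)).integrable_comp h1.1, (B.flip (g r)).integrable_comp h1.2⟩
      · exact ⟨(B.flip (g r)).integrable_comp h2.1, (B.flip (g r)).integrable_comp h2.2⟩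
    rw [intervalIntegral.integral_congr (g := fun r => B (∫ s in a..b, f s) (g r))]
    · exact ((B _).intervalIntegral_comp_comm hg).symm
    · intro r hr
      rw [uIcc_of_le hab] at hr
      exact this r hr
  · have hc : ContinuousOn (fun r => ∫ s in r..b, f s) (uIcc a b) := by
      have : ContinuousOn (fun r => (∫ s in a..b, f s) - ∫ s in a..r, f s) (uIcc a b) :=
        continuousOn_const.sub hF
      refine this.congr fun r hr => ?_
      rw [uIcc_of_le hab] at hr
      exact (intervalIntegral.integral_interval_sub_left hf (hf.mono_Icc hr)).symm
    refine (hg.bilin_left B hc).congr fun r hr => ?_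
    rw [uIoc_of_le hab] at hr
    have h1 := hf.mono_Icc (Ioc_subset_Icc_self hr)
    exact ((B.flip (g r)).intervalIntegral_comp_comm (h1.symm.trans hf)).symm
  · refine (hg.bilin_left B hF).congr fun r hr => ?_
    rw [uIoc_of_le hab] at hr
    have h1 := hf.mono_Icc (Ioc_subset_Icc_self hr)
    exact ((B.flip (g r)).intervalIntegral_comp_comm h1).symm

/-- The product rule for primitives of integrable functions. -/
theorem bilin_primitive (B : E →L[ℝ] F →L[ℝ] G) {a b : ℝ} (hab : a ≤ b) {f u : ℝ → E}
    {g w : ℝ → F} (hf : IntervalIntegrable f volume a b) (hg : IntervalIntegrable g volume a b)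
    (hu : ∀ t ∈ Icc a b, u t = u a + ∫ s in a..t, f s)
    (hw : ∀ t ∈ Icc a b, w t = w a + ∫ s in a..t, g s) :
    B (u b) (w b) = B (u a) (w a) + ∫ s in a..b, (B (f s) (w s) + B (u s) (g s)) := by
  have hF := continuousOn_integral hab hf
  have hG := continuousOn_integral hab hg
  rw [← uIcc_of_le hab] at hF hG
  have hb : b ∈ Icc a b := right_mem_Icc.2 hab
  have i1 : IntervalIntegrable (fun s => B (f s) (w a)) volume a b :=
    hf.bilin_right B continuousOn_const
  have i2 : IntervalIntegrable (fun s => B (u a) (g s)) volume a b :=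
    hg.bilin_left B continuousOn_const
  have e : ∫ s in a..b, (B (f s) (w s) + B (u s) (g s))
      = ∫ s in a..b, ((B (f s) (w a) + B (u a) (g s)) +
        (B (f s) (∫ r in a..s, g r) + B (∫ r in a..s, f r) (g s))) := by
    refine intervalIntegral.integral_congr fun s hs => ?_
    rw [uIcc_of_le hab] at hs
    rw [hu s hs, hw s hs]
    simp only [map_add, add_apply]
    abel
  rw [e, intervalIntegral.integral_add (i1.add i2) ((hf.bilin_right B hG).add (hg.bilin_left B hF)),
    ← bilin_integral_integral B hab hf hg, intervalIntegral.integral_add i1 i2,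
    (B (u a)).intervalIntegral_comp_comm hg]
  have := (B.flip (w a)).intervalIntegral_comp_comm hf
  simp only [ContinuousLinearMap.flip_apply] at this
  rw [this, hu b hb, hw b hb]
  simp only [map_add, add_apply]
  abel

end Calculus

/-- The product rule for real valued primitives. -/
theorem mul_primitive {a b : ℝ} (hab : a ≤ b) {f u g w : ℝ → ℝ}
    (hf : IntervalIntegrable f volume a b) (hg : IntervalIntegrable g volume a b)
    (hu : ∀ t ∈ Icc a b, u t = u a + ∫ s in a..t, f s)
    (hw : ∀ t ∈ Icc a b, w t = w a + ∫ s in a..t, g s) :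
    u b * w b = u a * w a + ∫ s in a..b, (f s * w s + u s * g s) :=
  bilin_primitive (ContinuousLinearMap.mul ℝ ℝ) hab hf hg hu hw

/-- Induction on `n` by the product rule. It integrates the Taylor terms that arise when Gronwall's
hypothesis is iterated. -/
theorem pow_primitive {T : ℝ} {κ : ℝ → ℝ} (hT : 0 ≤ T) (hκ : IntervalIntegrable κ volume 0 T)
    (n : ℕ) : (∫ s in (0 : ℝ)..T, κ s) ^ (n + 1)
      = (n + 1) * ∫ s in (0 : ℝ)..T, κ s * (∫ r in (0 : ℝ)..s, κ r) ^ n := by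
  induction n generalizing T with
  | zero => simp
  | succ n ih =>
    have hc := continuousOn_integral hT hκ
    have hi : IntervalIntegrable (fun s => κ s * (∫ r in (0 : ℝ)..s, κ r) ^ n) volume 0 T :=
      hκ.mul_continuousOn (by rw [uIcc_of_le hT]; exact hc.pow n)
    have := mul_primitive (u := fun t => ∫ s in (0 : ℝ)..t, κ s)
      (w := fun t => (∫ s in (0 : ℝ)..t, κ s) ^ (n + 1)) hT hκ (hi.const_mul ((n : ℝ) + 1))
      (by simp) (fun t ht => by
        rw [ih ht.1 (hκ.mono_Icc ht)]
        simp)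
    simp only [intervalIntegral.integral_same, zero_mul, zero_add] at this
    rw [pow_succ' _ (n + 1), this, ← intervalIntegral.integral_const_mul]
    refine intervalIntegral.integral_congr fun s _ => ?_
    push_cast
    ring

/-- Gronwall's inequality with an integrable coefficient. -/
theorem gronwall_integral {T a : ℝ} {φ κ : ℝ → ℝ} (hκ : IntervalIntegrable κ volume 0 T)
    (hκ0 : ∀ t ∈ Icc 0 T, 0 ≤ κ t) (hφ : ContinuousOn φ (Icc 0 T))
    (h : ∀ t ∈ Icc 0 T, φ t ≤ a + ∫ s in (0 : ℝ)..t, κ s * φ s) {t : ℝ} (ht : t ∈ Icc 0 T) :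
    φ t ≤ a * Real.exp (∫ s in (0 : ℝ)..t, κ s) := by
  have hT : 0 ≤ T := ht.1.trans ht.2
  obtain ⟨M, hM⟩ := isCompact_Icc.exists_bound_of_continuousOn hφ
  have hc := continuousOn_integral hT hκ
  -- The hypothesis inserted `n` times into itself: a Taylor polynomial of the exponential, plus a
  -- remainder from the crude bound `M` on `φ`, which disappears as `n → ∞`.
  have key : ∀ n : ℕ, ∀ t ∈ Icc 0 T, φ t ≤ a * (∑ i ∈ Finset.range n,
      (∫ s in (0 : ℝ)..t, κ s) ^ i / i.factorial) + M * ((∫ s in (0 : ℝ)..t, κ s) ^ n / n.factorial) := by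
    intro n
    induction n with
    | zero => intro t ht; simpa using (le_abs_self _).trans (hM t ht)
    | succ n ih =>
      intro t ht
      have hκt := hκ.mono_Icc ht
      have hsub : Icc 0 t ⊆ Icc 0 T := Icc_subset_Icc_right ht.2
      have hci : ∀ i : ℕ, IntervalIntegrable (fun s => κ s * (∫ r in (0 : ℝ)..s, κ r) ^ i) volume 0 t :=
        fun i => hκt.mul_continuousOn (by rw [uIcc_of_le ht.1]; exact (hc.mono hsub).pow i)
      have hpi : ∀ i : ℕ, ∫ s in (0 : ℝ)..t, κ s * (∫ r in (0 : ℝ)..s, κ r) ^ i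
          = (∫ s in (0 : ℝ)..t, κ s) ^ (i + 1) / (i + 1) := by
        intro i
        rw [pow_primitive ht.1 hκt i]
        field_simp
      have e : ∀ s, κ s * (a * (∑ i ∈ Finset.range n, (∫ r in (0 : ℝ)..s, κ r) ^ i / i.factorial)
          + M * ((∫ r in (0 : ℝ)..s, κ r) ^ n / n.factorial))
          = (∑ i ∈ Finset.range n, a / i.factorial * (κ s * (∫ r in (0 : ℝ)..s, κ r) ^ i))
          + M / n.factorial * (κ s * (∫ r in (0 : ℝ)..s, κ r) ^ n) := by
        intro s
        rw [mul_add, Finset.mul_sum, Finset.mul_sum]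
        congr 1
        · exact Finset.sum_congr rfl fun i _ => by ring
        · ring
      have hsum : IntervalIntegrable (fun s => ∑ i ∈ Finset.range n,
          a / i.factorial * (κ s * (∫ r in (0 : ℝ)..s, κ r) ^ i)) volume 0 t := by
        have := IntervalIntegrable.sum (Finset.range n) (μ := volume) (a := 0) (b := t)
          (f := fun i s => a / i.factorial * (κ s * (∫ r in (0 : ℝ)..s, κ r) ^ i))
          (fun i _ => (hci i).const_mul _)
        exact this.congr fun s _ => by simp
      refine (h t ht).trans ?_
      have hle : ∫ s in (0 : ℝ)..t, κ s * φ s ≤ ∫ s in (0 : ℝ)..t, ((∑ i ∈ Finset.range n,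
          a / i.factorial * (κ s * (∫ r in (0 : ℝ)..s, κ r) ^ i))
          + M / n.factorial * (κ s * (∫ r in (0 : ℝ)..s, κ r) ^ n)) := by
        refine intervalIntegral.integral_mono_on ht.1 ?_ (hsum.add ((hci n).const_mul _)) ?_
        · exact hκt.mul_continuousOn (by rw [uIcc_of_le ht.1]; exact hφ.mono hsub)
        · intro s hs
          rw [← e]
          exact mul_le_mul_of_nonneg_left (ih s (hsub hs)) (hκ0 s (hsub hs))
      refine (add_le_add le_rfl hle).trans (le_of_eq ?_)
      rw [intervalIntegral.integral_add hsum ((hci n).const_mul _),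
        intervalIntegral.integral_finsetSum fun i _ => (hci i).const_mul _,
        Finset.sum_range_succ']
      simp only [intervalIntegral.integral_const_mul, hpi]
      rw [mul_add, Finset.mul_sum]
      simp only [Nat.factorial_succ, pow_zero, Nat.factorial_zero, Nat.cast_one, div_one, mul_one]
      have : ∀ i : ℕ, a / (i.factorial : ℝ) * ((∫ s in (0 : ℝ)..t, κ s) ^ (i + 1) / (i + 1))
          = a * ((∫ s in (0 : ℝ)..t, κ s) ^ (i + 1) / ((i + 1) * i.factorial : ℕ)) := by
        intro i; push_cast; field_simp
      simp_rw [this]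
      push_cast
      field_simp
      ring
  refine ge_of_tendsto' (x := atTop) (f := fun n : ℕ => a * (∑ i ∈ Finset.range n,
      (∫ s in (0 : ℝ)..t, κ s) ^ i / i.factorial) + M * ((∫ s in (0 : ℝ)..t, κ s) ^ n / n.factorial))
      ?_ fun n => key n t ht
  have h1 := (NormedSpace.expSeries_div_hasSum_exp (∫ s in (0 : ℝ)..t, κ s)).tendsto_sum_nat
  have h2 := FloorSemiring.tendsto_pow_div_factorial_atTop (∫ s in (0 : ℝ)..t, κ s)
  rw [← Real.exp_eq_exp_ℝ] at h1
  simpa using (h1.const_mul a).add (h2.const_mul M)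

end KdV

/-! ### Maximal dissipative operators and the Hille–Yosida theorem -/

namespace KdV

set_option linter.unusedSectionVars false

variable {H : Type} [NormedAddCommGroup H] [InnerProductSpace ℝ H]

/-- `G` is the graph of a maximal dissipative operator. -/
structure MaxDissipative (G : Submodule ℝ (H × H)) : Prop where
  dissip : ∀ u v, (u, v) ∈ G → inner ℝ u v ≤ 0
  eq_zero : ∀ v, ((0 : H), v) ∈ G → v = 0
  range : ∀ l : ℝ, 0 < l → ∀ f, ∃ u v, (u, v) ∈ G ∧ l • u - v = f

namespace MaxDissipative

variable {G : Submodule ℝ (H × H)} (hG : MaxDissipative G)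

/-- Pair `l u - v` with `u`. The inequality gives injectivity of `l - A` and the bound `1 / l` for
its inverse. -/
theorem norm_le {G : Submodule ℝ (H × H)} (hG : MaxDissipative G) {u v : H} (h : (u, v) ∈ G) (l : ℝ) : l * ‖u‖ ≤ ‖l • u - v‖ := by
  have h1 := hG.dissip u v h
  have h2 : l * ‖u‖ * ‖u‖ ≤ ‖u‖ * ‖l • u - v‖ := by
    refine le_trans ?_ (real_inner_le_norm u (l • u - v))
    rw [inner_sub_right, inner_smul_right, real_inner_self_eq_norm_sq]
    nlinarith
  rcases (norm_nonneg u).eq_or_lt with h0 | h0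
  · rw [← h0]; simp
  · nlinarith

theorem eq_of_smul_sub_eq {G : Submodule ℝ (H × H)} (hG : MaxDissipative G) {u v u' v' : H} (h : (u, v) ∈ G) (h' : (u', v') ∈ G) {l : ℝ} (hl : 0 < l)
    (e : l • u - v = l • u' - v') : u = u' := by
  have h1 := hG.norm_le (G.sub_mem h h') l
  have : l • (u - u') - (v - v') = 0 := by
    rw [smul_sub, sub_sub_sub_comm, e, sub_self]
  simp only at h1
  rw [this, norm_zero] at h1
  have : ‖u - u'‖ ≤ 0 := by
    by_contra! hc
    nlinarith
  exact sub_eq_zero.1 (norm_le_zero_iff.1 this)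

/-- The resolvent `(n + 1 - A)⁻¹`. -/
def res (n : ℕ) : H →L[ℝ] H :=
  have hl : (0 : ℝ) < n + 1 := by positivity
  have hm := fun f => (hG.range (n + 1) hl f).choose_spec.choose_spec
  LinearMap.mkContinuous
    { toFun := fun f => (hG.range (n + 1) hl f).choose
      map_add' := fun f g => by
        refine hG.eq_of_smul_sub_eq (hm (f + g)).1 (G.add_mem (hm f).1 (hm g).1) hl ?_
        rw [(hm (f + g)).2, smul_add, add_sub_add_comm, (hm f).2, (hm g).2]
      map_smul' := fun c f => by
        refine hG.eq_of_smul_sub_eq (hm (c • f)).1 (G.smul_mem c (hm f).1) hl ?_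
        rw [(hm (c • f)).2, RingHom.id_apply, smul_comm, ← smul_sub, (hm f).2] }
    ((n + 1 : ℝ)⁻¹) fun f => by
      have h1 := hG.norm_le (hm f).1 (n + 1)
      rw [(hm f).2] at h1
      rw [inv_mul_eq_div, le_div_iff₀ hl, mul_comm]
      exact h1

theorem res_mem (n : ℕ) (f : H) : (hG.res n f, ((n : ℝ) + 1) • hG.res n f - f) ∈ G := by
  have h := (hG.range (n + 1) (by positivity) f).choose_spec.choose_spec
  have : ((n : ℝ) + 1) • hG.res n f - f = (hG.range (n + 1) (by positivity) f).choose_spec.choose := by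
    rw [sub_eq_iff_eq_add', ← sub_eq_iff_eq_add]
    exact h.2
  rw [this]
  exact h.1

theorem res_eq (n : ℕ) {u v : H} (h : (u, v) ∈ G) : hG.res n (((n : ℝ) + 1) • u - v) = u :=
  hG.eq_of_smul_sub_eq (hG.res_mem n _) h (l := n + 1) (by positivity) (by abel)

/-- The graph becomes the solution set of an equation between bounded operators, so it is closed and
stable under integration. -/
theorem mem_iff {u v : H} : (u, v) ∈ G ↔ hG.res 0 (u - v) = u := by
  constructor
  · intro h
    simpa using hG.res_eq 0 h
  · intro h
    have := hG.res_mem 0 (u - v)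
    rw [h] at this
    simpa using this

/-- The operators `J_n = (n + 1) (n + 1 - A)⁻¹`. -/
def J (n : ℕ) : H →L[ℝ] H := ((n : ℝ) + 1) • hG.res n

/-- The Yosida approximations of the operator. -/
def yosida (n : ℕ) : H →L[ℝ] H := ((n : ℝ) + 1) • (hG.J n - 1)

theorem J_apply (n : ℕ) (x : H) : hG.J n x = ((n : ℝ) + 1) • hG.res n x := rfl

theorem yosida_apply (n : ℕ) (x : H) : hG.yosida n x = ((n : ℝ) + 1) • (hG.J n x - x) := rfl

theorem J_mem (n : ℕ) (x : H) : (hG.J n x, hG.yosida n x) ∈ G := by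
  have := G.smul_mem ((n : ℝ) + 1) (hG.res_mem n x)
  simpa [yosida_apply, J_apply, smul_sub] using this

theorem norm_J_le (n : ℕ) (x : H) : ‖hG.J n x‖ ≤ ‖x‖ := by
  have h := hG.norm_le (hG.res_mem n x) (n + 1)
  rw [sub_sub_cancel] at h
  rw [J_apply, norm_smul, Real.norm_of_nonneg (by positivity)]
  exact h

/-- On the domain `A_n = J_n A`, so convergence of the Yosida approximations reduces to `J_n → 1`.
-/
theorem yosida_eq (n : ℕ) {u v : H} (h : (u, v) ∈ G) : hG.yosida n u = hG.J n v := by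
  have h1 := hG.res_eq n h
  rw [map_sub, map_smul] at h1
  rw [yosida_apply, J_apply, J_apply, sub_eq_iff_eq_add.1 h1, add_sub_cancel_left]

theorem J_map_mem (n : ℕ) {u v : H} (h : (u, v) ∈ G) : (hG.J n u, hG.J n v) ∈ G := by
  rw [← hG.yosida_eq n h]
  exact hG.J_mem n u

theorem J_res_comm (n m : ℕ) (x : H) : hG.J m (hG.res n x) = hG.res n (hG.J m x) := by
  have h := hG.res_eq n (hG.J_map_mem m (hG.res_mem n x))
  rw [← map_smul, ← map_sub, sub_sub_cancel] at h
  exact h.symm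

theorem yosida_commute (n m : ℕ) : Commute (hG.yosida n) (hG.yosida m) := by
  have h : Commute (hG.J n) (hG.J m) := by
    ext x
    show hG.J n (hG.J m x) = hG.J m (hG.J n x)
    rw [hG.J_apply n, hG.J_apply n x, map_smul, J_res_comm]
  have h2 : Commute (hG.J n - 1) (hG.J m - 1) :=
    (h.sub_left (Commute.one_left _)).sub_right ((Commute.one_right _))
  exact (h2.smul_left _).smul_right _

theorem inner_yosida_nonpos (n : ℕ) (x : H) : inner ℝ x (hG.yosida n x) ≤ 0 := by
  rw [yosida_apply, inner_smul_right, inner_sub_right, real_inner_self_eq_norm_sq]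
  have h1 := real_inner_le_norm x (hG.J n x)
  have h2 := hG.norm_J_le n x
  have : inner ℝ x (hG.J n x) - ‖x‖ ^ 2 ≤ 0 := by nlinarith [norm_nonneg x]
  exact mul_nonpos_of_nonneg_of_nonpos (by positivity) this

variable [CompleteSpace H]

/-- If `f` is orthogonal to the domain, dissipativity at `(1 - A)⁻¹ f` forces this vector to vanish.
Then `(0, -f)` is in the graph, and `eq_zero` gives `f = 0`. -/
theorem dense_domain {G : Submodule ℝ (H × H)} (hG : MaxDissipative G) : Dense {u : H | ∃ v, (u, v) ∈ G} := by
  have h : (G.map (LinearMap.fst ℝ H H)).topologicalClosure = ⊤ := by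
    rw [Submodule.topologicalClosure_eq_top_iff, Submodule.eq_bot_iff]
    intro f hf
    have hm := hG.res_mem 0 f
    have h0 := hG.dissip _ _ hm
    have h1 : inner ℝ (hG.res 0 f) f = 0 :=
      (Submodule.mem_orthogonal _ _).1 hf _ ⟨_, hm, rfl⟩
    rw [inner_sub_right, inner_smul_right, h1, real_inner_self_eq_norm_sq] at h0
    simp only [Nat.cast_zero, zero_add, one_mul, sub_zero] at h0
    have h2 : hG.res 0 f = 0 := by
      rw [← norm_le_zero_iff]
      by_contra! hc
      nlinarith
    rw [h2, smul_zero, zero_sub] at hm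
    exact neg_eq_zero.1 (hG.eq_zero _ hm)
  intro x
  have hx : x ∈ (G.map (LinearMap.fst ℝ H H)).topologicalClosure := by rw [h]; trivial
  refine closure_mono ?_ hx
  rintro _ ⟨⟨u, v⟩, huv, rfl⟩
  exact ⟨v, huv⟩

/-- On the domain `‖J_n u - u‖ ≤ ‖A u‖ / (n + 1)`; density and the contraction property of `J_n` do
the rest. -/
theorem tendsto_J (x : H) : Tendsto (fun n => hG.J n x) atTop (𝓝 x) := by
  have hD : ∀ u v, (u, v) ∈ G → ∀ n : ℕ, ‖hG.J n u - u‖ ≤ ‖v‖ * (1 / ((n : ℝ) + 1)) := by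
    intro u v h n
    have h1 : ‖hG.yosida n u‖ ≤ ‖v‖ := by rw [hG.yosida_eq n h]; exact hG.norm_J_le n v
    rw [yosida_apply, norm_smul, Real.norm_of_nonneg (by positivity)] at h1
    rw [mul_one_div, le_div_iff₀ (by positivity), mul_comm]
    exact h1
  rw [Metric.tendsto_atTop]
  intro ε hε
  obtain ⟨u, ⟨v, huv⟩, hu⟩ := Metric.mem_closure_iff.1 (hG.dense_domain x) (ε / 3) (by positivity)
  have ht : Tendsto (fun n : ℕ => ‖v‖ * (1 / ((n : ℝ) + 1))) atTop (𝓝 (‖v‖ * 0)) :=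
    tendsto_one_div_add_atTop_nhds_zero_nat.const_mul _
  rw [mul_zero] at ht
  obtain ⟨N, hN⟩ := (ht.eventually (gt_mem_nhds (show 0 < ε / 3 by positivity))).exists_forall_of_atTop
  refine ⟨N, fun n hn => ?_⟩
  rw [dist_eq_norm] at hu ⊢
  have e : hG.J n x - x = hG.J n (x - u) + (hG.J n u - u) - (x - u) := by rw [map_sub]; abel
  rw [e]
  have h1 := hG.norm_J_le n (x - u)
  have h2 := (hD u v huv n).trans_lt (hN n hn)
  have h3 := norm_sub_le (hG.J n (x - u) + (hG.J n u - u)) (x - u)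
  have h4 := norm_add_le (hG.J n (x - u)) (hG.J n u - u)
  linarith

theorem tendsto_yosida {u v : H} (h : (u, v) ∈ G) :
    Tendsto (fun n => hG.yosida n u) atTop (𝓝 v) := by
  simp_rw [hG.yosida_eq _ h]
  exact hG.tendsto_J v

/-- The approximating semigroups. -/
def expYosida (n : ℕ) (t : ℝ) : H →L[ℝ] H := NormedSpace.exp (t • hG.yosida n)

theorem hasDerivAt_expYosida (n : ℕ) (t : ℝ) (x : H) :
    HasDerivAt (fun s => hG.expYosida n s x) (hG.expYosida n t (hG.yosida n x)) t :=
  (hasDerivAt_exp_smul_const (𝕂 := ℝ) (hG.yosida n) t).clm_apply (hasDerivAt_const t x) |>.congr_deriv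
    (by simp [expYosida])

theorem expYosida_commute (n m : ℕ) (s : ℝ) :
    Commute (hG.expYosida n s) (hG.yosida m) := by
  refine Commute.exp_left ?_
  exact (hG.yosida_commute n m).smul_left s

theorem expYosida_comm_apply (n m : ℕ) (s : ℝ) (x : H) :
    hG.expYosida n s (hG.yosida m x) = hG.yosida m (hG.expYosida n s x) :=
  congrArg (fun f : H →L[ℝ] H => f x) (hG.expYosida_commute n m s).eq

theorem expYosida_zero (n : ℕ) (x : H) : hG.expYosida n 0 x = x := by
  simp [expYosida]

theorem expYosida_add (n : ℕ) (s t : ℝ) (x : H) :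
    hG.expYosida n (s + t) x = hG.expYosida n s (hG.expYosida n t x) := by
  have : hG.expYosida n (s + t) = hG.expYosida n s * hG.expYosida n t := by
    let _ : NormedAlgebra ℚ (H →L[ℝ] H) := NormedAlgebra.restrictScalars ℚ ℝ _
    rw [expYosida, add_smul, NormedSpace.exp_add_of_commute]
    · rfl
    · exact ((Commute.refl _).smul_left s).smul_right t
  rw [this]
  rfl

theorem norm_expYosida_le (n : ℕ) {t : ℝ} (ht : 0 ≤ t) (x : H) : ‖hG.expYosida n t x‖ ≤ ‖x‖ := by
  have hd : ∀ t, HasDerivAt (fun s => ‖hG.expYosida n s x‖ ^ 2)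
      (2 * inner ℝ (hG.expYosida n t x) (hG.expYosida n t (hG.yosida n x))) t :=
    fun t => (hG.hasDerivAt_expYosida n t x).norm_sq
  have ha : Antitone (fun s => ‖hG.expYosida n s x‖ ^ 2) := by
    refine antitone_of_deriv_nonpos (fun t => (hd t).differentiableAt) fun t => ?_
    rw [(hd t).deriv, expYosida_comm_apply]
    have := hG.inner_yosida_nonpos n (hG.expYosida n t x)
    linarith
  have := ha ht
  simp only [expYosida_zero] at this
  exact le_of_sq_le_sq this (norm_nonneg _)

/-- Differentiate the interpolation `s ↦ exp((t - s) A_m) exp(s A_n) x`. Since `A_n` and `A_m`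
commute, the derivative is a product of two contractions applied to `A_n x - A_m x`. -/
theorem norm_expYosida_sub_le (n m : ℕ) {t : ℝ} (ht : 0 ≤ t) (x : H) :
    ‖hG.expYosida n t x - hG.expYosida m t x‖ ≤ ‖hG.yosida n x - hG.yosida m x‖ * t := by
  have hd : ∀ s, HasDerivAt (fun s => hG.expYosida m (t - s) (hG.expYosida n s x))
      (hG.expYosida m (t - s) (hG.expYosida n s (hG.yosida n x - hG.yosida m x))) s := by
    intro s
    have h1 : HasDerivAt (fun s => hG.expYosida m (t - s)) (-(hG.expYosida m (t - s) * hG.yosida m)) s := by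
      have := (hasDerivAt_exp_smul_const (𝕂 := ℝ) (hG.yosida m) (t - s)).scomp s
        ((hasDerivAt_id s).const_sub t)
      simpa [expYosida] using! this
    refine (h1.clm_apply (hG.hasDerivAt_expYosida n s x)).congr_deriv ?_
    rw [map_sub, map_sub, hG.expYosida_comm_apply n m]
    simp only [neg_apply, mul_apply_eq_comp]
    abel
  have := norm_image_sub_le_of_norm_deriv_le_segment' (a := 0) (b := t)
    (C := ‖hG.yosida n x - hG.yosida m x‖) (fun s _ => (hd s).hasDerivWithinAt) (fun s hs => by
      refine (hG.norm_expYosida_le m (by linarith [hs.2]) _).trans ?_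
      exact hG.norm_expYosida_le n hs.1 _) t (right_mem_Icc.2 ht)
  simpa [expYosida_zero] using this

theorem cauchySeq_expYosida {t : ℝ} (ht : 0 ≤ t) (x : H) :
    CauchySeq (fun n => hG.expYosida n t x) := by
  rw [Metric.cauchySeq_iff]
  intro ε hε
  obtain ⟨u, ⟨v, huv⟩, hu⟩ := Metric.mem_closure_iff.1 (hG.dense_domain x) (ε / 3) (by positivity)
  have hc := (hG.tendsto_yosida huv).cauchySeq
  obtain ⟨N, hN⟩ := Metric.cauchySeq_iff.1 hc (ε / 3 / (t + 1)) (by positivity)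
  refine ⟨N, fun n hn m hm => ?_⟩
  have h0 := hN n hn m hm
  rw [dist_eq_norm] at h0 hu ⊢
  have h1 := hG.norm_expYosida_sub_le n m ht u
  have h2 : ‖hG.expYosida n t u - hG.expYosida m t u‖ < ε / 3 := by
    refine h1.trans_lt ?_
    calc _ ≤ ‖hG.yosida n u - hG.yosida m u‖ * (t + 1) := by gcongr; linarith
      _ < ε / 3 / (t + 1) * (t + 1) := by gcongr
      _ = ε / 3 := by field_simp
  have e : hG.expYosida n t x - hG.expYosida m t x = hG.expYosida n t (x - u)
      + (hG.expYosida n t u - hG.expYosida m t u) - hG.expYosida m t (x - u) := by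
    rw [map_sub, map_sub]; abel
  rw [e]
  have h3 := norm_sub_le (hG.expYosida n t (x - u) + (hG.expYosida n t u - hG.expYosida m t u))
    (hG.expYosida m t (x - u))
  have h4 := norm_add_le (hG.expYosida n t (x - u)) (hG.expYosida n t u - hG.expYosida m t u)
  have h5 := hG.norm_expYosida_le n ht (x - u)
  have h6 := hG.norm_expYosida_le m ht (x - u)
  linarith

/-- The semigroup generated by a maximal dissipative operator. -/
def semigroup (t : ℝ) : H →L[ℝ] H :=
  -- The absolute value makes the limit exist for every real `t`; only `t ≥ 0` matters.
  continuousLinearMapOfTendsto (fun n => hG.expYosida n |t|)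
    (f := fun x => limUnder atTop fun n => hG.expYosida n |t| x)
    (tendsto_pi_nhds.2 fun x => (hG.cauchySeq_expYosida (abs_nonneg t) x).tendsto_limUnder)

theorem tendsto_semigroup {t : ℝ} (ht : 0 ≤ t) (x : H) :
    Tendsto (fun n => hG.expYosida n t x) atTop (𝓝 (hG.semigroup t x)) := by
  have : Tendsto (fun n => hG.expYosida n |t| x) atTop (𝓝 (hG.semigroup t x)) :=
    (hG.cauchySeq_expYosida (abs_nonneg t) x).tendsto_limUnder
  rwa [abs_of_nonneg ht] at this

theorem norm_semigroup_le {t : ℝ} (ht : 0 ≤ t) (x : H) : ‖hG.semigroup t x‖ ≤ ‖x‖ :=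
  le_of_tendsto' (hG.tendsto_semigroup ht x).norm fun n => hG.norm_expYosida_le n ht x

theorem tendsto_expYosida_apply {t : ℝ} (ht : 0 ≤ t) {y : ℕ → H} {x : H}
    (hy : Tendsto y atTop (𝓝 x)) :
    Tendsto (fun n => hG.expYosida n t (y n)) atTop (𝓝 (hG.semigroup t x)) := by
  have h0 : Tendsto (fun n => hG.expYosida n t (y n - x)) atTop (𝓝 0) := by
    refine squeeze_zero_norm (fun n => hG.norm_expYosida_le n ht _) ?_
    have := (hy.sub_const x).norm
    simpa using this
  simpa using (hG.tendsto_semigroup ht x).add h0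

theorem semigroup_zero (x : H) : hG.semigroup 0 x = x :=
  tendsto_nhds_unique (hG.tendsto_semigroup le_rfl x) (by simp [expYosida_zero])

theorem semigroup_add {s t : ℝ} (hs : 0 ≤ s) (ht : 0 ≤ t) (x : H) :
    hG.semigroup (s + t) x = hG.semigroup s (hG.semigroup t x) := by
  refine tendsto_nhds_unique (hG.tendsto_semigroup (add_nonneg hs ht) x) ?_
  simp_rw [expYosida_add]
  exact hG.tendsto_expYosida_apply hs (hG.tendsto_semigroup ht x)

theorem norm_expYosida_sub_self_le (n : ℕ) {s : ℝ} (hs : 0 ≤ s) (x : H) :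
    ‖hG.expYosida n s x - x‖ ≤ ‖hG.yosida n x‖ * s := by
  have := norm_image_sub_le_of_norm_deriv_le_segment' (a := 0) (b := s) (C := ‖hG.yosida n x‖)
    (fun r _ => (hG.hasDerivAt_expYosida n r x).hasDerivWithinAt)
    (fun r hr => hG.norm_expYosida_le n hr.1 _) s (right_mem_Icc.2 hs)
  simpa [expYosida_zero] using this

theorem norm_semigroup_sub_self_le {u v : H} (h : (u, v) ∈ G) {s : ℝ} (hs : 0 ≤ s) :
    ‖hG.semigroup s u - u‖ ≤ ‖v‖ * s := by
  refine le_of_tendsto_of_tendsto' ((hG.tendsto_semigroup hs u).sub_const u).norm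
    ((hG.tendsto_yosida h).norm.mul_const s) fun n => hG.norm_expYosida_sub_self_le n hs u

/-- The derivative of `exp(r A_n) u - r A_n u` is `(exp(r A_n) - 1) A_n u`. Its limit involves `v =
A u`, which need not lie in the domain; the element `w` of the domain replaces it, at the cost of `2
‖v - w‖`. -/
theorem norm_semigroup_sub_sub_le {u v w z : H} (h : (u, v) ∈ G) (hw : (w, z) ∈ G) {t : ℝ}
    (ht : 0 ≤ t) : ‖hG.semigroup t u - u - t • v‖ ≤ (2 * ‖v - w‖ + ‖z‖ * t) * t := by
  refine le_of_tendsto_of_tendsto' (((hG.tendsto_semigroup ht u).sub_const u).sub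
    ((hG.tendsto_yosida h).const_smul t)).norm
    (((((hG.tendsto_yosida h).sub_const w).norm.const_mul 2).add
    ((hG.tendsto_yosida hw).norm.mul_const t)).mul_const t) fun n => ?_
  have hd : ∀ r, HasDerivAt (fun r => hG.expYosida n r u - r • hG.yosida n u)
      (hG.expYosida n r (hG.yosida n u) - hG.yosida n u) r := by
    intro r
    have h2 := (hG.hasDerivAt_expYosida n r u).sub ((hasDerivAt_id r).smul_const (hG.yosida n u))
    simpa using! h2
  have := norm_image_sub_le_of_norm_deriv_le_segment' (a := 0) (b := t)
    (C := 2 * ‖hG.yosida n u - w‖ + ‖hG.yosida n w‖ * t)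
    (fun r _ => (hd r).hasDerivWithinAt) (fun r hr => by
      set x := hG.yosida n u
      have e : hG.expYosida n r x - x
          = hG.expYosida n r (x - w) + (hG.expYosida n r w - w) - (x - w) := by rw [map_sub]; abel
      rw [e]
      have h3 := norm_sub_le (hG.expYosida n r (x - w) + (hG.expYosida n r w - w)) (x - w)
      have h4 := norm_add_le (hG.expYosida n r (x - w)) (hG.expYosida n r w - w)
      have h5 := hG.norm_expYosida_le n hr.1 (x - w)
      have h6 := hG.norm_expYosida_sub_self_le n hr.1 w
      have h7 : ‖hG.yosida n w‖ * r ≤ ‖hG.yosida n w‖ * t := by gcongr; exact hr.2.le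
      linarith) t (right_mem_Icc.2 ht)
  rw [sub_right_comm]
  simpa [expYosida_zero] using this

theorem tendsto_semigroup_slope {u v : H} (h : (u, v) ∈ G) :
    Tendsto (fun t : ℝ => t⁻¹ • (hG.semigroup t u - u)) (𝓝[>] 0) (𝓝 v) := by
  rw [Metric.tendsto_nhdsWithin_nhds]
  intro ε hε
  obtain ⟨w, ⟨z, hwz⟩, hw⟩ := Metric.mem_closure_iff.1 (hG.dense_domain v) (ε / 4) (by positivity)
  rw [dist_eq_norm] at hw
  refine ⟨ε / 4 / (‖z‖ + 1), by positivity, fun t ht htd => ?_⟩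
  have ht0 : 0 < t := ht
  rw [dist_zero_right, Real.norm_of_nonneg ht0.le, lt_div_iff₀ (by positivity)] at htd
  have h1 := hG.norm_semigroup_sub_sub_le h hwz ht0.le
  have e : t⁻¹ • (hG.semigroup t u - u) - v = t⁻¹ • (hG.semigroup t u - u - t • v) := by
    rw [smul_sub _ _ (t • v), inv_smul_smul₀ ht0.ne']
  rw [dist_eq_norm, e, norm_smul, norm_inv, Real.norm_of_nonneg ht0.le, inv_mul_eq_div,
    div_lt_iff₀ ht0]
  refine h1.trans_lt ?_
  gcongr
  nlinarith [norm_nonneg z]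

theorem isContractionSemigroup : IsContractionSemigroup hG.semigroup where
  map_zero := by ext x; exact hG.semigroup_zero x
  map_add s t hs ht := by ext x; exact hG.semigroup_add hs ht x
  contraction t ht := ContinuousLinearMap.opNorm_le_bound _ zero_le_one fun x => by
    rw [one_mul]; exact hG.norm_semigroup_le ht x
  continuousOn x := by
    have hle : ∀ u v, (u, v) ∈ G → ∀ s t, 0 ≤ s → s ≤ t →
        ‖hG.semigroup t x - hG.semigroup s x‖ ≤ 2 * ‖x - u‖ + ‖v‖ * (t - s) := by
      intro u v huv s t hs hst
      have e : hG.semigroup t x - hG.semigroup s x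
          = hG.semigroup s (hG.semigroup (t - s) x - x) := by
        rw [map_sub, ← hG.semigroup_add hs (by linarith)]
        congr 3
        ring
      rw [e]
      refine (hG.norm_semigroup_le hs _).trans ?_
      have e : hG.semigroup (t - s) x - x = hG.semigroup (t - s) (x - u)
          + (hG.semigroup (t - s) u - u) - (x - u) := by rw [map_sub]; abel
      rw [e]
      have h3 := norm_sub_le (hG.semigroup (t - s) (x - u) + (hG.semigroup (t - s) u - u)) (x - u)
      have h4 := norm_add_le (hG.semigroup (t - s) (x - u)) (hG.semigroup (t - s) u - u)
      have h5 := hG.norm_semigroup_le (sub_nonneg.2 hst) (x - u)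
      have h6 := hG.norm_semigroup_sub_self_le huv (sub_nonneg.2 hst)
      linarith
    rw [Metric.continuousOn_iff]
    intro s hs ε hε
    obtain ⟨u, ⟨v, huv⟩, hu⟩ := Metric.mem_closure_iff.1 (hG.dense_domain x) (ε / 4) (by positivity)
    rw [dist_eq_norm] at hu
    refine ⟨ε / 4 / (‖v‖ + 1), by positivity, fun t ht htd => ?_⟩
    rw [lt_div_iff₀ (by positivity), Real.dist_eq] at htd
    rw [dist_eq_norm]
    rcases le_total s t with hst | hst
    · have := hle u v huv s t hs hst
      rw [abs_of_nonneg (by linarith)] at htd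
      nlinarith [norm_nonneg v]
    · have := hle u v huv t s ht hst
      rw [norm_sub_rev] at this
      rw [abs_of_nonpos (by linarith)] at htd
      nlinarith [norm_nonneg v]

/-- For the converse, take `w` in the domain with `w - A w = u - v`. The difference quotients at `u
- w` then converge to `u - w` itself, while a contraction semigroup makes their inner product with
`u - w` nonpositive. Hence `‖u - w‖² ≤ 0`. -/
theorem semigroup_generator (u v : H) :
    Tendsto (fun t : ℝ => t⁻¹ • (hG.semigroup t u - u)) (𝓝[>] 0) (𝓝 v) ↔ (u, v) ∈ G := by
  refine ⟨fun h => ?_, hG.tendsto_semigroup_slope⟩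
  obtain ⟨w, hw⟩ : ∃ w, (w, w - (u - v)) ∈ G :=
    ⟨hG.res 0 (u - v), by simpa only [Nat.cast_zero, zero_add, one_smul] using hG.res_mem 0 (u - v)⟩
  have h1 := h.sub (hG.tendsto_semigroup_slope hw)
  have h2 : Tendsto (fun t : ℝ => inner ℝ (u - w) (t⁻¹ • (hG.semigroup t (u - w) - (u - w))))
      (𝓝[>] 0) (𝓝 (inner ℝ (u - w) (u - w))) := by
    refine Tendsto.inner tendsto_const_nhds (h1.congr' ?_ |>.trans (le_of_eq ?_))
    · filter_upwards with t
      rw [map_sub, ← smul_sub]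
      congr 1; abel
    · congr 1; abel
  have h3 : inner ℝ (u - w) (u - w) ≤ 0 := by
    refine le_of_tendsto h2 ?_
    filter_upwards [self_mem_nhdsWithin] with t ht
    have ht0 : 0 < t := ht
    rw [inner_smul_right, inner_sub_right, real_inner_self_eq_norm_sq]
    have h4 := real_inner_le_norm (u - w) (hG.semigroup t (u - w))
    have h5 := hG.norm_semigroup_le ht0.le (u - w)
    refine mul_nonpos_of_nonneg_of_nonpos (by positivity) ?_
    nlinarith [norm_nonneg (u - w)]
  have h4 : u = w := by
    rw [real_inner_self_eq_norm_sq] at h3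
    have : ‖u - w‖ = 0 := by nlinarith [norm_nonneg (u - w)]
    exact sub_eq_zero.1 (norm_eq_zero.1 this)
  rw [← h4] at hw
  simpa using hw

end MaxDissipative

end KdV

/-! ### Mild solutions and integrated solutions -/

namespace KdV

set_option linter.unusedSectionVars false

variable {H : Type} [NormedAddCommGroup H] [InnerProductSpace ℝ H] [CompleteSpace H]

theorem graph_mem_of_eq {G : Submodule ℝ (H × H)} {p : H × H} {u v : H} (h : p ∈ G)
    (e₁ : p.1 = u) (e₂ : p.2 = v) : (u, v) ∈ G := by
  subst e₁ e₂
  exact h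

/-- The characterisation `mem_iff` involves only a bounded operator, which commutes with the
integral. -/
theorem MaxDissipative.integral_mem {G : Submodule ℝ (H × H)} (hG : MaxDissipative G) {a b : ℝ}
    (hab : a ≤ b) {u v : ℝ → H}
    (hu : IntervalIntegrable u volume a b) (hv : IntervalIntegrable v volume a b)
    (h : ∀ s ∈ Ioc a b, (u s, v s) ∈ G) : (∫ s in a..b, u s, ∫ s in a..b, v s) ∈ G := by
  rw [hG.mem_iff, ← intervalIntegral.integral_sub hu hv,
    ← ContinuousLinearMap.intervalIntegral_comp_comm _ (hu.sub hv)]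
  rw [intervalIntegral.integral_of_le hab, intervalIntegral.integral_of_le hab]
  exact setIntegral_congr_fun measurableSet_Ioc fun s hs => hG.mem_iff.1 (h s hs)

/-- Integrated solutions of `u' = A u + f`, `u 0 = u₀`, where `G` is the graph of `A`. -/
structure IntSol (G : Submodule ℝ (H × H)) (T : ℝ) (u₀ : H) (f u : ℝ → H) : Prop where
  cont : ContinuousOn u (Icc 0 T)
  mem : ∀ t ∈ Icc 0 T, (∫ s in (0 : ℝ)..t, u s, u t - u₀ - ∫ s in (0 : ℝ)..t, f s) ∈ G

/-- Strong continuity together with the uniform bound `‖S t‖ ≤ 1` gives joint continuity; the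
truncation at `0` makes it a statement on all of `ℝ × H`. -/
theorem continuous_semigroup {S : ℝ → H →L[ℝ] H} (hS : IsContractionSemigroup S) :
    Continuous fun p : ℝ × H => S (max p.1 0) p.2 := by
  rw [continuous_iff_continuousAt]
  rintro ⟨s, x⟩
  have h1 : Tendsto (fun p : ℝ × H => S (max p.1 0) x) (𝓝 (s, x)) (𝓝 (S (max s 0) x)) := by
    have hc : Continuous fun r : ℝ => S (max r 0) x :=
      (hS.continuousOn x).comp_continuous (by fun_prop) fun r => le_max_right r 0
    exact (hc.comp continuous_fst).tendsto (s, x)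
  have h2 : Tendsto (fun p : ℝ × H => S (max p.1 0) (p.2 - x)) (𝓝 (s, x)) (𝓝 0) := by
    have h3 : Tendsto (fun p : ℝ × H => ‖p.2 - x‖) (𝓝 (s, x)) (𝓝 0) := by
      have : Continuous fun p : ℝ × H => ‖p.2 - x‖ := by fun_prop
      simpa using this.tendsto (s, x)
    refine squeeze_zero_norm (fun p => ?_) h3
    refine ((S (max p.1 0)).le_opNorm _).trans ?_
    exact mul_le_of_le_one_left (norm_nonneg _) (hS.contraction _ (le_max_right _ _))
  simpa using! h1.add h2

theorem norm_semigroup_apply_le {S : ℝ → H →L[ℝ] H} (hS : IsContractionSemigroup S) {t : ℝ}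
    (ht : 0 ≤ t) (x : H) : ‖S t x‖ ≤ ‖x‖ :=
  ((S t).le_opNorm x).trans (mul_le_of_le_one_left (norm_nonneg _) (hS.contraction t ht))

theorem intervalIntegrable_duhamel {S : ℝ → H →L[ℝ] H} (hS : IsContractionSemigroup S) {T : ℝ}
    {f : ℝ → H} (hf : IntervalIntegrable f volume 0 T) (t : ℝ) :
    IntervalIntegrable (fun s => S (max (t - s) 0) (f s)) volume 0 T := by
  rw [intervalIntegrable_iff] at hf ⊢
  refine hf.norm.mono' ((continuous_semigroup hS).comp_aestronglyMeasurable
    ((by fun_prop : Continuous fun s : ℝ => t - s).aestronglyMeasurable.prodMk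
      hf.aestronglyMeasurable)) ?_
  filter_upwards with s using norm_semigroup_apply_le hS (le_max_right _ _) _

/-- The integral is rewritten over the fixed interval `[0, T]` with the cut-off `s ≤ t`. For given
`t` the integrand is continuous at `t` for every `s ≠ t`, so dominated convergence applies. -/
theorem continuousOn_duhamel {S : ℝ → H →L[ℝ] H} (hS : IsContractionSemigroup S) {T : ℝ}
    (hT : 0 ≤ T) {f : ℝ → H} (hf : IntervalIntegrable f volume 0 T) :
    ContinuousOn (fun t => ∫ s in (0 : ℝ)..t, S (t - s) (f s)) (Icc 0 T) := by
  have e : ∀ t ∈ Icc 0 T, ∫ s in (0 : ℝ)..t, S (t - s) (f s)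
      = ∫ s in (0 : ℝ)..T, (if s ≤ t then S (max (t - s) 0) (f s) else 0) := by
    intro t ht
    rw [intervalIntegral.integral_of_le ht.1, intervalIntegral.integral_of_le hT]
    have : ∀ s, (if s ≤ t then S (max (t - s) 0) (f s) else 0)
        = (Iic t).indicator (fun s => S (max (t - s) 0) (f s)) s := fun s => by
      simp [indicator]
    simp_rw [this]
    rw [integral_indicator measurableSet_Iic, Measure.restrict_restrict measurableSet_Iic,
      inter_comm, Ioc_inter_Iic, min_eq_right ht.2]
    refine setIntegral_congr_fun measurableSet_Ioc fun s hs => ?_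
    rw [max_eq_left (by linarith [hs.2])]
  refine ContinuousOn.congr ?_ e
  intro t ht
  refine ContinuousAt.continuousWithinAt ?_
  refine intervalIntegral.continuousAt_of_dominated_interval (bound := fun s => ‖f s‖) ?_ ?_
    hf.norm ?_
  · filter_upwards with t
    have h1 := (intervalIntegrable_iff.1 (intervalIntegrable_duhamel hS hf t)).aestronglyMeasurable
    have : (fun s => if s ≤ t then S (max (t - s) 0) (f s) else 0)
        = (Iic t).indicator (fun s => S (max (t - s) 0) (f s)) := by
      ext s; simp [indicator]
    rw [this]
    exact h1.indicator measurableSet_Iic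
  · filter_upwards with t
    filter_upwards with s _
    split_ifs
    · exact norm_semigroup_apply_le hS (le_max_right _ _) _
    · simp
  · have h0 : ∀ᵐ s : ℝ, s ≠ t := by simp [ae_iff, measure_singleton]
    filter_upwards [h0] with s hs _
    have hc : Continuous fun t : ℝ => S (max (t - s) 0) (f s) :=
      (continuous_semigroup hS).comp (by fun_prop : Continuous fun t : ℝ => (t - s, f s))
    rcases lt_or_gt_of_ne hs with h | h
    · refine hc.continuousAt.congr ?_
      filter_upwards [lt_mem_nhds h] with r hr
      rw [if_pos hr.le]
    · refine (continuousAt_const (y := (0 : H))).congr ?_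
      filter_upwards [gt_mem_nhds h] with r hr
      rw [if_neg (not_le.2 hr)]

/-- `S h` shifts the window of integration from `[0, t]` to `[h, t + h]`, so the difference quotient
only sees the two ends and tends to `S t x - x`. Only the description of the generator is used, so
every semigroup with this generator is covered. -/
theorem semigroup_integral_mem {G : Submodule ℝ (H × H)} {S : ℝ → H →L[ℝ] H}
    (hS : IsContractionSemigroup S)
    (hgen : ∀ u v, Tendsto (fun h : ℝ => h⁻¹ • (S h u - u)) (𝓝[>] 0) (𝓝 v) ↔ (u, v) ∈ G)
    {t : ℝ} (ht : 0 ≤ t) (x : H) : (∫ s in (0 : ℝ)..t, S s x, S t x - x) ∈ G := by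
  rw [← hgen]
  set c : ℝ → H := fun s => S (max s 0) x with hc'
  have hc : Continuous c := (continuous_semigroup hS).comp (by fun_prop : Continuous fun s : ℝ => (s, x))
  have e0 : ∀ t, 0 ≤ t → c t = S t x := fun t ht => by simp [hc', max_eq_left ht]
  have e1 : ∫ s in (0 : ℝ)..t, S s x = ∫ s in (0 : ℝ)..t, c s := by
    refine intervalIntegral.integral_congr fun s hs => ?_
    rw [uIcc_of_le ht] at hs
    exact (e0 s hs.1).symm
  have hd : ∀ t, HasDerivAt (fun t => ∫ s in (0 : ℝ)..t, c s) (c t) t := fun t =>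
    intervalIntegral.integral_hasDerivAt_right (hc.intervalIntegrable _ _)
      (hc.stronglyMeasurableAtFilter _ _) hc.continuousAt
  have hsl : ∀ t, Tendsto (fun h : ℝ => h⁻¹ • ((∫ s in (0 : ℝ)..(t + h), c s)
      - ∫ s in (0 : ℝ)..t, c s)) (𝓝[>] 0) (𝓝 (c t)) := fun t =>
    ((hasDerivAt_iff_tendsto_slope_zero.1 (hd t)).mono_left (nhdsWithin_mono _ (by
      intro y hy; exact ne_of_gt hy)))
  have h1 := (hsl t).sub (hsl 0)
  rw [e0 t ht, e0 0 le_rfl, hS.map_zero] at h1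
  refine h1.congr' ?_
  filter_upwards [self_mem_nhdsWithin] with h hh
  have hh0 : 0 < h := hh
  have e2 : S h (∫ s in (0 : ℝ)..t, c s) = ∫ s in h..(t + h), c s := by
    rw [← ContinuousLinearMap.intervalIntegral_comp_comm _ (hc.intervalIntegrable _ _)]
    have := intervalIntegral.integral_comp_add_right (a := 0) (b := t) c h
    rw [zero_add] at this
    rw [← this]
    refine intervalIntegral.integral_congr fun s hs => ?_
    rw [uIcc_of_le ht] at hs
    have hs0 := hs.1
    rw [e0 s hs0, e0 (s + h) (by linarith), add_comm s h, hS.map_add h s hh0.le hs0]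
    rfl
  rw [e1, e2, ← smul_sub]
  congr 1
  rw [zero_add, intervalIntegral.integral_same, sub_zero, sub_right_comm,
    intervalIntegral.integral_interval_sub_left (hc.intervalIntegrable _ _) (hc.intervalIntegrable _ _)]

/-- Mild solutions are integrated solutions. -/
theorem intSol_of_duhamel {G : Submodule ℝ (H × H)} (hG : MaxDissipative G) {S : ℝ → H →L[ℝ] H}
    (hS : IsContractionSemigroup S)
    (hgen : ∀ u v, Tendsto (fun h : ℝ => h⁻¹ • (S h u - u)) (𝓝[>] 0) (𝓝 v) ↔ (u, v) ∈ G)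
    {T : ℝ} (hT : 0 ≤ T) {u₀ : H} {f u : ℝ → H} (hf : IntervalIntegrable f volume 0 T)
    (hu : ∀ t ∈ Icc 0 T, u t = S t u₀ + ∫ s in (0 : ℝ)..t, S (t - s) (f s)) :
    IntSol G T u₀ f u := by
  have hcd := continuousOn_duhamel hS hT hf
  have hcu : ContinuousOn (fun t => S t u₀) (Icc 0 T) := (hS.continuousOn u₀).mono Icc_subset_Ici_self
  refine ⟨(hcu.add hcd).congr hu, fun t ht => ?_⟩
  have ht0 : (0 : ℝ) ≤ t := ht.1
  have hsub : Icc 0 t ⊆ Icc 0 T := Icc_subset_Icc_right ht.2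
  have hft := hf.mono_Icc ht
  have i1 : IntervalIntegrable (fun s => S s u₀) volume 0 t :=
    (hcu.mono hsub).intervalIntegrable_of_Icc ht0
  have i2 : IntervalIntegrable (fun s => ∫ r in (0 : ℝ)..s, S (s - r) (f r)) volume 0 t :=
    (hcd.mono hsub).intervalIntegrable_of_Icc ht0
  have e1 : ∫ s in (0 : ℝ)..t, u s
      = (∫ s in (0 : ℝ)..t, S s u₀) + ∫ s in (0 : ℝ)..t, ∫ r in (0 : ℝ)..s, S (s - r) (f r) := by
    rw [← intervalIntegral.integral_add i1 i2]
    refine intervalIntegral.integral_congr fun s hs => ?_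
    rw [uIcc_of_le ht0] at hs
    exact hu s (hsub hs)
  have hint : Integrable (Function.uncurry fun s r => S (max (s - r) 0) (f r))
      ((volume.restrict (Ioc 0 t)).prod (volume.restrict (Ioc 0 t))) := by
    have hft' := (intervalIntegrable_iff_integrableOn_Ioc_of_le ht0).1 hft
    have hf2 : Integrable (fun p : ℝ × ℝ => f p.2)
      ((volume.restrict (Ioc 0 t)).prod (volume.restrict (Ioc 0 t))) := hft'.comp_snd _
    refine hf2.norm.mono' ((continuous_semigroup hS).comp_aestronglyMeasurable
      ((by fun_prop : Continuous fun p : ℝ × ℝ => p.1 - p.2).aestronglyMeasurable.prodMk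
        hf2.aestronglyMeasurable)) ?_
    filter_upwards with p using norm_semigroup_apply_le hS (le_max_right _ _) _
  have e2 : ∫ s in (0 : ℝ)..t, ∫ r in (0 : ℝ)..s, S (s - r) (f r)
      = ∫ r in (0 : ℝ)..t, ∫ s in r..t, S (max (s - r) 0) (f r) := by
    rw [← integral_triangle_swap ht0 hint]
    refine intervalIntegral.integral_congr fun s hs => ?_
    rw [uIcc_of_le ht0] at hs
    refine intervalIntegral.integral_congr fun r hr => ?_
    rw [uIcc_of_le hs.1] at hr
    rw [max_eq_left (by linarith [hr.2])]
  have i3 := intervalIntegrable_triangle ht0 hint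
  have i4 := intervalIntegrable_duhamel hS hft t
  -- After the exchange of integrals, the inner integral for fixed `r` is a semigroup integral over
  -- `[0, t - r]`. It lies in the domain, and integrating in `r` stays in the graph.
  have hm : ∀ r ∈ Ioc 0 t, (∫ s in r..t, S (max (s - r) 0) (f r), S (max (t - r) 0) (f r) - f r) ∈ G := by
    intro r hr
    have h1 := semigroup_integral_mem hS hgen (sub_nonneg.2 hr.2) (f r)
    rw [max_eq_left (sub_nonneg.2 hr.2)]
    have e3 : ∫ s in r..t, S (max (s - r) 0) (f r) = ∫ s in (0 : ℝ)..(t - r), S s (f r) := by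
      rw [intervalIntegral.integral_comp_sub_right (fun s => S (max s 0) (f r)) r, sub_self]
      refine intervalIntegral.integral_congr fun s hs => ?_
      rw [uIcc_of_le (sub_nonneg.2 hr.2)] at hs
      rw [max_eq_left hs.1]
    rw [e3]
    exact h1
  have h3 := hG.integral_mem ht0 i3 (i4.sub hft) hm
  have h4 := G.add_mem (semigroup_integral_mem hS hgen ht0 u₀) h3
  rw [e1, e2]
  refine graph_mem_of_eq h4 rfl ?_
  show S t u₀ - u₀ + _ = _
  rw [intervalIntegral.integral_sub i4 hft, hu t ht]
  have e5 : ∫ s in (0 : ℝ)..t, S (max (t - s) 0) (f s) = ∫ s in (0 : ℝ)..t, S (t - s) (f s) := by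
    refine intervalIntegral.integral_congr fun r hr => ?_
    rw [uIcc_of_le ht0] at hr
    rw [max_eq_left (by linarith [hr.2])]
  rw [e5]
  exact sub_add_sub_comm _ _ _ _ |>.trans (by rw [sub_sub])

namespace IntSol

variable {G : Submodule ℝ (H × H)} {T : ℝ} {u₀ v₀ : H} {f g u v : ℝ → H}

/-- At `t = 0` the integrated equation reads `(0, u 0 - u₀) ∈ G`. -/
theorem eq_zero_left (hu : IntSol G T u₀ f u) (hG : MaxDissipative G) (hT : 0 ≤ T) : u 0 = u₀ := by
  have h := hu.mem 0 (left_mem_Icc.2 hT)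
  simp only [intervalIntegral.integral_same, sub_zero] at h
  exact sub_eq_zero.1 (hG.eq_zero _ h)

theorem sub (hu : IntSol G T u₀ f u) (hv : IntSol G T v₀ g v)
    (hf : IntervalIntegrable f volume 0 T) (hg : IntervalIntegrable g volume 0 T) :
    IntSol G T (u₀ - v₀) (fun t => f t - g t) (fun t => u t - v t) := by
  refine ⟨hu.cont.sub hv.cont, fun t ht => ?_⟩
  have h := G.sub_mem (hu.mem t ht) (hv.mem t ht)
  have hsub : Icc 0 t ⊆ Icc 0 T := Icc_subset_Icc_right ht.2
  rw [intervalIntegral.integral_sub ((hu.cont.mono hsub).intervalIntegrable_of_Icc ht.1)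
    ((hv.cont.mono hsub).intervalIntegrable_of_Icc ht.1),
    intervalIntegral.integral_sub (hf.mono_Icc ht) (hg.mono_Icc ht)]
  refine graph_mem_of_eq h rfl ?_
  simp only [Prod.snd_sub]
  abel_nf

theorem congr_source (hu : IntSol G T u₀ f u)
    (h : ∀ᵐ t ∂(volume.restrict (Ioo 0 T)), f t = g t) : IntSol G T u₀ g u := by
  refine ⟨hu.cont, fun t ht => ?_⟩
  have h1 := hu.mem t ht
  rwa [show ∫ s in (0 : ℝ)..t, f s = ∫ s in (0 : ℝ)..t, g s from ?_] at h1
  rw [intervalIntegral.integral_of_le ht.1, intervalIntegral.integral_of_le ht.1,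
    integral_Ioc_eq_integral_Ioo, integral_Ioc_eq_integral_Ioo]
  exact integral_congr_ae (ae_restrict_of_ae_restrict_of_subset (Ioo_subset_Ioo_right ht.2) h)

theorem mono (hu : IntSol G T u₀ f u) {t : ℝ} (ht : t ≤ T) : IntSol G t u₀ f u :=
  ⟨hu.cont.mono (Icc_subset_Icc_right ht), fun s hs => hu.mem s ⟨hs.1, hs.2.trans ht⟩⟩

end IntSol

end KdV

/-! ### Energy estimates for regularised solutions -/

namespace KdV

set_option linter.unusedSectionVars false

section SquareIntegrable

variable {α V : Type*} [MeasurableSpace α] {μ : Measure α} [NormedAddCommGroup V]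

theorem norm_toLp_sq {g : α → V} (hg : MemLp g 2 μ) : ‖hg.toLp g‖ ^ 2 = ∫ t, ‖g t‖ ^ 2 ∂μ := by
  have h := hg.eLpNorm_eq_integral_rpow_norm two_ne_zero ENNReal.ofNat_ne_top
  rw [Lp.norm_toLp, h, ENNReal.toReal_ofReal (by positivity)]
  simp only [ENNReal.toReal_ofNat, Real.rpow_ofNat]
  rw [← Real.rpow_natCast, ← Real.rpow_mul (integral_nonneg fun _ => by positivity)]
  norm_num

theorem norm_Lp_sq (g : Lp V 2 μ) : ‖g‖ ^ 2 = ∫ t, ‖g t‖ ^ 2 ∂μ := by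
  have := norm_toLp_sq (Lp.memLp g)
  rwa [Lp.toLp_coeFn] at this

theorem integrable_norm_sq {g : α → V} (hg : MemLp g 2 μ) : Integrable (fun t => ‖g t‖ ^ 2) μ :=
  hg.norm.integrable_sq

theorem integral_norm_mul_le {W : Type*} [NormedAddCommGroup W] {g : α → V} {h : α → W}
    (hg : MemLp g 2 μ) (hh : MemLp h 2 μ) :
    Integrable (fun t => ‖g t‖ * ‖h t‖) μ ∧
      ∫ t, ‖g t‖ * ‖h t‖ ∂μ ≤ √(∫ t, ‖g t‖ ^ 2 ∂μ) * √(∫ t, ‖h t‖ ^ 2 ∂μ) := by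
  refine ⟨hg.norm.integrable_mul hh.norm, ?_⟩
  have h1 := integral_mul_le_Lp_mul_Lq_of_nonneg (μ := μ) (p := 2) (q := 2)
    (Real.HolderConjugate.two_two) (f := fun t => ‖g t‖) (g := fun t => ‖h t‖)
    (ae_of_all _ fun _ => norm_nonneg _) (ae_of_all _ fun _ => norm_nonneg _)
    (by simpa using hg.norm) (by simpa using hh.norm)
  simpa [Real.sqrt_eq_rpow] using h1

end SquareIntegrable

section Time

variable {V : Type*} [NormedAddCommGroup V]

theorem intervalIntegrable_of_Ioo {T : ℝ} (hT : 0 ≤ T) {f : ℝ → V}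
    (hf : Integrable f (volume.restrict (Ioo 0 T))) : IntervalIntegrable f volume 0 T := by
  rw [intervalIntegrable_iff_integrableOn_Ioo_of_le hT]
  exact hf

theorem intervalIntegral_eq_Ioo [NormedSpace ℝ V] {t : ℝ} (ht : 0 ≤ t) (f : ℝ → V) :
    ∫ s in (0 : ℝ)..t, f s = ∫ s in Ioo 0 t, f s := by
  rw [intervalIntegral.integral_of_le ht, integral_Ioc_eq_integral_Ioo]

theorem memLp_mono_Ioo {t T : ℝ} (htT : t ≤ T) {f : ℝ → V}
    (hf : MemLp f 2 (volume.restrict (Ioo 0 T))) : MemLp f 2 (volume.restrict (Ioo 0 t)) :=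
  hf.mono_measure (Measure.restrict_mono (Ioo_subset_Ioo_right htT) le_rfl)

theorem memLp_of_continuousOn {T : ℝ} {f : ℝ → V} (hf : ContinuousOn f (Icc 0 T)) :
    MemLp f 2 (volume.restrict (Ioo 0 T)) := by
  obtain ⟨C, hC⟩ := isCompact_Icc.exists_bound_of_continuousOn hf
  refine MemLp.of_bound ((hf.mono Ioo_subset_Icc_self).aestronglyMeasurable measurableSet_Ioo) C ?_
  filter_upwards [ae_restrict_mem measurableSet_Ioo] with t ht using hC t (Ioo_subset_Icc_self ht)

end Time

variable {H : Type} [NormedAddCommGroup H] [InnerProductSpace ℝ H] [CompleteSpace H]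
  {V : Type*} [NormedAddCommGroup V] [NormedSpace ℝ V] [CompleteSpace V]

/-- A pair of bounded operators `P`, `A P` that commutes with the operator `A` with graph `G`. -/
structure Smoother (G : Submodule ℝ (H × H)) (P PA : H →L[ℝ] H) : Prop where
  mem : ∀ x, (P x, PA x) ∈ G
  comm : ∀ u v, (u, v) ∈ G → PA u = P v

theorem MaxDissipative.smoother_J {G : Submodule ℝ (H × H)} (hG : MaxDissipative G) (n : ℕ) :
    Smoother G (hG.J n) (hG.yosida n) :=
  ⟨hG.J_mem n, fun _ _ h => hG.yosida_eq n h⟩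

theorem Smoother.sub {G : Submodule ℝ (H × H)} {P PA P' PA' : H →L[ℝ] H} (h : Smoother G P PA)
    (h' : Smoother G P' PA') : Smoother G (P - P') (PA - PA') :=
  ⟨fun x => G.sub_mem (h.mem x) (h'.mem x), fun u v huv => by
    simp [h.comm u v huv, h'.comm u v huv]⟩

/-- Only the time integral of `u` lies in the domain. Applying `PA` to it and commuting shows that
`P u` is a primitive even though `u` itself need not be. -/
theorem Smoother.primitive {G : Submodule ℝ (H × H)} {P PA : H →L[ℝ] H} (h : Smoother G P PA)
    {T : ℝ} {u₀ : H} {f u : ℝ → H} (hu : IntSol G T u₀ f u)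
    (hf : IntervalIntegrable f volume 0 T) {t : ℝ} (ht : t ∈ Icc 0 T) :
    P (u t) = P u₀ + ∫ s in (0 : ℝ)..t, (PA (u s) + P (f s)) := by
  have hsub : Icc 0 t ⊆ Icc 0 T := Icc_subset_Icc_right ht.2
  have iu : IntervalIntegrable u volume 0 t := (hu.cont.mono hsub).intervalIntegrable_of_Icc ht.1
  have hft := hf.mono_Icc ht
  have h1 := h.comm _ _ (hu.mem t ht)
  rw [map_sub, map_sub] at h1
  rw [intervalIntegral.integral_add ⟨PA.integrable_comp iu.1, PA.integrable_comp iu.2⟩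
    ⟨P.integrable_comp hft.1, P.integrable_comp hft.2⟩,
    PA.intervalIntegral_comp_comm iu, P.intervalIntegral_comp_comm hft, h1]
  abel

/-- The energy identity for regularised solutions. -/
theorem Smoother.energy {G : Submodule ℝ (H × H)} (hG : MaxDissipative G) {P PA : H →L[ℝ] H}
    (h : Smoother G P PA) {Q : H →L[ℝ] H} (hQ : ∀ x y, inner ℝ (Q x) y = inner ℝ x (Q y))
    {T : ℝ} (hT : 0 ≤ T) {u₀ : H} {f u : ℝ → H} (hu : IntSol G T u₀ f u)
    (hf : IntervalIntegrable f volume 0 T) {t : ℝ} (ht : t ∈ Icc 0 T) :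
    inner ℝ (Q (P (u t))) (P (u t)) = inner ℝ (Q (P u₀)) (P u₀)
      + 2 * ∫ s in (0 : ℝ)..t, inner ℝ (Q (P (u s))) (PA (u s) + P (f s)) := by
  have hsub : Icc 0 t ⊆ Icc 0 T := Icc_subset_Icc_right ht.2
  have hu' := hu.mono ht.2
  have hft := hf.mono_Icc ht
  have iu : IntervalIntegrable u volume 0 t := hu'.cont.intervalIntegrable_of_Icc ht.1
  have ig : IntervalIntegrable (fun s => PA (u s) + P (f s)) volume 0 t :=
    IntervalIntegrable.add ⟨PA.integrable_comp iu.1, PA.integrable_comp iu.2⟩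
      ⟨P.integrable_comp hft.1, P.integrable_comp hft.2⟩
  have h0 := hu.eq_zero_left hG hT
  have hp : ∀ s ∈ Icc 0 t, P (u s) = P (u 0) + ∫ r in (0 : ℝ)..s, (PA (u r) + P (f r)) := by
    intro s hs
    rw [h0]
    exact h.primitive hu' hft hs
  -- Product rule for `⟪Q P u, P u⟫`; the symmetry of `Q` merges the two resulting terms.
  have key := bilin_primitive ((innerSL ℝ).comp Q) (u := fun s => P (u s)) (w := fun s => P (u s))
    ht.1 ig ig hp hp
  simp only [ContinuousLinearMap.comp_apply, innerSL_apply_apply, h0] at key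
  rw [key, ← intervalIntegral.integral_const_mul]
  congr 1
  refine intervalIntegral.integral_congr fun s _ => ?_
  rw [hQ, real_inner_comm]
  ring

/-- The functional setting: `G` is the graph of a maximal dissipative operator `A` on `H`, the
space `V` is embedded in `H` by `j`, and `Q` is a nonnegative multiplier that yields the smoothing
inequality `‖u‖_V² + ⟪Q u, A u⟫ ≤ K ‖u‖²`. -/
structure Frame (G : Submodule ℝ (H × H)) (j : V →L[ℝ] H) (Q : H →L[ℝ] H) (K : ℝ) : Prop where
  max : MaxDissipative G
  inj : Function.Injective j
  symm : ∀ x y, inner ℝ (Q x) y = inner ℝ x (Q y)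
  nonneg : ∀ x, 0 ≤ inner ℝ (Q x) x
  K_nonneg : 0 ≤ K
  lift : ∀ u v, (u, v) ∈ G → ∃ U : V, j U = u ∧ ‖U‖ ^ 2 + inner ℝ (Q u) v ≤ K * ‖u‖ ^ 2

/-- An admissible multiplier in the energy inequality. -/
structure Multiplier (G : Submodule ℝ (H × H)) (j : V →L[ℝ] H) (Q : H →L[ℝ] H) (α K : ℝ) : Prop where
  symm : ∀ x y, inner ℝ (Q x) y = inner ℝ x (Q y)
  le : ∀ u v, (u, v) ∈ G → ∀ U : V, j U = u → α * ‖U‖ ^ 2 + inner ℝ (Q u) v ≤ K * ‖u‖ ^ 2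

namespace Frame

variable {G : Submodule ℝ (H × H)} {j : V →L[ℝ] H} {Q : H →L[ℝ] H} {K : ℝ}

theorem multiplier (hF : Frame G j Q K) : Multiplier G j Q 1 K :=
  ⟨hF.symm, fun u v h U hU => by
    obtain ⟨U', h1, h2⟩ := hF.lift u v h
    rw [hF.inj (hU.trans h1.symm), one_mul]
    exact h2⟩

theorem multiplier_id (hF : Frame G j Q K) : Multiplier G j (ContinuousLinearMap.id ℝ H) 0 0 :=
  ⟨fun _ _ => rfl, fun u v h _ _ => by simpa using hF.max.dissip u v h⟩

/-- The operators `J_n` as bounded operators from `H` to `V`. -/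
def JV (hF : Frame G j Q K) (n : ℕ) : H →L[ℝ] V :=
  have hm := fun x => (hF.lift _ _ (hF.max.J_mem n x)).choose_spec
  LinearMap.mkContinuous
    { toFun := fun x => (hF.lift _ _ (hF.max.J_mem n x)).choose
      map_add' := fun x y => hF.inj <| (hm (x + y)).1.trans <| by
        rw [map_add, map_add, (hm x).1, (hm y).1]
      map_smul' := fun c x => hF.inj <| (hm (c • x)).1.trans <| by
        rw [RingHom.id_apply, map_smul, map_smul, (hm x).1] }
    -- The smoothing inequality at the pair `(J_n x, A_n x)`, with `‖J_n x‖ ≤ ‖x‖`, gives this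
    -- operator bound.
    (√(K + ‖Q‖ * ‖hF.max.yosida n‖)) fun x => by
      have h1 := (hm x).2
      have h2 := hF.max.norm_J_le n x
      have h3 := (abs_le.1 (abs_real_inner_le_norm (Q (hF.max.J n x)) (hF.max.yosida n x))).1
      have h4 : ‖Q (hF.max.J n x)‖ ≤ ‖Q‖ * ‖x‖ :=
        (Q.le_opNorm _).trans (by gcongr)
      have h5 := (hF.max.yosida n).le_opNorm x
      have h6 : ‖Q (hF.max.J n x)‖ * ‖hF.max.yosida n x‖
          ≤ (‖Q‖ * ‖x‖) * (‖hF.max.yosida n‖ * ‖x‖) := by gcongr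
      have h7 : K * ‖hF.max.J n x‖ ^ 2 ≤ K * ‖x‖ ^ 2 := by
        have := hF.K_nonneg
        gcongr
      have hK := hF.K_nonneg
      refine abs_le_of_sq_le_sq' ?_ (by positivity) |>.2
      rw [mul_pow, Real.sq_sqrt (by positivity)]
      simp only [LinearMap.coe_mk, AddHom.coe_mk]
      nlinarith

theorem j_JV (hF : Frame G j Q K) (n : ℕ) (x : H) : j (hF.JV n x) = hF.max.J n x :=
  (hF.lift _ _ (hF.max.J_mem n x)).choose_spec.1

variable {T : ℝ} {u₀ : H} {f u : ℝ → H}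

theorem smoother_energy_le (hF : Frame G j Q K) {P PA : H →L[ℝ] H} {PV : H →L[ℝ] V}
    (h : Smoother G P PA) (hPV : ∀ x, j (PV x) = P x) {Q' : H →L[ℝ] H} {α K' : ℝ}
    (hQ : Multiplier G j Q' α K') (hT : 0 ≤ T) (hu : IntSol G T u₀ f u)
    (hf : IntervalIntegrable f volume 0 T) {t : ℝ} (ht : t ∈ Icc 0 T) :
    inner ℝ (Q' (P (u t))) (P (u t)) + 2 * α * ∫ s in (0 : ℝ)..t, ‖PV (u s)‖ ^ 2
      ≤ inner ℝ (Q' (P u₀)) (P u₀) + 2 * K' * (∫ s in (0 : ℝ)..t, ‖P (u s)‖ ^ 2)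
      + 2 * ∫ s in (0 : ℝ)..t, inner ℝ (Q' (P (u s))) (P (f s)) := by
  have hu' := (hu.mono ht.2).cont
  have hft := hf.mono_Icc ht
  rw [h.energy hF.max hQ.symm hT hu hf ht]
  have hc1 : ContinuousOn (fun s => ‖PV (u s)‖ ^ 2) (Icc 0 t) := by fun_prop
  have hc2 : ContinuousOn (fun s => ‖P (u s)‖ ^ 2) (Icc 0 t) := by fun_prop
  have hc3 : ContinuousOn (fun s => inner ℝ (Q' (P (u s))) (PA (u s))) (Icc 0 t) := by fun_prop
  have hc4 : ContinuousOn (fun s => Q' (P (u s))) (uIcc 0 t) := by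
    rw [uIcc_of_le ht.1]; fun_prop
  have i1 := hc1.intervalIntegrable_of_Icc (μ := volume) ht.1
  have i2 := hc2.intervalIntegrable_of_Icc (μ := volume) ht.1
  have i3 := hc3.intervalIntegrable_of_Icc (μ := volume) ht.1
  have i4 : IntervalIntegrable (fun s => inner ℝ (Q' (P (u s))) (P (f s))) volume 0 t :=
    IntervalIntegrable.bilin_left (innerSL ℝ) hc4 (g := fun s => P (f s))
      ⟨P.integrable_comp hft.1, P.integrable_comp hft.2⟩
  simp_rw [inner_add_right]
  rw [intervalIntegral.integral_add i3 i4]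
  have key : α * (∫ s in (0 : ℝ)..t, ‖PV (u s)‖ ^ 2)
      + ∫ s in (0 : ℝ)..t, inner ℝ (Q' (P (u s))) (PA (u s))
      ≤ K' * ∫ s in (0 : ℝ)..t, ‖P (u s)‖ ^ 2 := by
    rw [← intervalIntegral.integral_const_mul, ← intervalIntegral.integral_const_mul,
      ← intervalIntegral.integral_add (i1.const_mul _) i3]
    exact intervalIntegral.integral_mono_on ht.1 ((i1.const_mul _).add i3) (i2.const_mul _)
      fun s _ => hQ.le _ _ (h.mem _) _ (hPV _)
  linarith

/-- At a maximum point of `‖P u‖`, with value `X`, the energy inequality reads `X² ≤ a² + 2 X F`,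
where `a = ‖P u₀‖` and `F = ∫ ‖P f‖`. Hence `X ≤ a + 2 F`. -/
theorem smoother_norm_le (hF : Frame G j Q K) {P PA : H →L[ℝ] H} {PV : H →L[ℝ] V}
    (h : Smoother G P PA) (hPV : ∀ x, j (PV x) = P x) (hT : 0 ≤ T) (hu : IntSol G T u₀ f u)
    (hf : IntervalIntegrable f volume 0 T) {t : ℝ} (ht : t ∈ Icc 0 T) :
    ‖P (u t)‖ ≤ ‖P u₀‖ + 2 * ∫ s in (0 : ℝ)..T, ‖P (f s)‖ := by
  have hcu := hu.cont
  have hc : ContinuousOn (fun s => ‖P (u s)‖) (Icc 0 T) := by fun_prop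
  obtain ⟨r, hr, hmax⟩ := isCompact_Icc.exists_isMaxOn ⟨t, ht⟩ hc
  have hPf : IntervalIntegrable (fun s => P (f s)) volume 0 T :=
    ⟨P.integrable_comp hf.1, P.integrable_comp hf.2⟩
  have h1 := hF.smoother_energy_le h hPV hF.multiplier_id hT hu hf hr
  simp only [ContinuousLinearMap.coe_id', id_eq, mul_zero, zero_mul, add_zero,
    real_inner_self_eq_norm_sq] at h1
  have h2 : ∫ s in (0 : ℝ)..r, inner ℝ (P (u s)) (P (f s))
      ≤ ‖P (u r)‖ * ∫ s in (0 : ℝ)..T, ‖P (f s)‖ := by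
    have hsub : Icc 0 r ⊆ Icc 0 T := Icc_subset_Icc_right hr.2
    have i1 : IntervalIntegrable (fun s => inner ℝ (P (u s)) (P (f s))) volume 0 r :=
      IntervalIntegrable.bilin_left (innerSL ℝ) (u := fun s => P (u s)) (by
        rw [uIcc_of_le hr.1]; have := hcu.mono hsub; fun_prop) (hPf.mono_Icc hr)
    calc _ ≤ ∫ s in (0 : ℝ)..r, ‖P (u r)‖ * ‖P (f s)‖ := by
          refine intervalIntegral.integral_mono_on hr.1 i1 ((hPf.mono_Icc hr).norm.const_mul _)
            fun s hs => (real_inner_le_norm _ _).trans ?_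
          gcongr
          exact hmax (hsub hs)
      _ = ‖P (u r)‖ * ∫ s in (0 : ℝ)..r, ‖P (f s)‖ := intervalIntegral.integral_const_mul _ _
      _ ≤ _ := by
          gcongr
          exact intervalIntegral.integral_mono_interval le_rfl hr.1 hr.2
            (ae_of_all _ fun _ => norm_nonneg _) hPf.norm
  refine (hmax ht).trans ?_
  have h3 : 0 ≤ ∫ s in (0 : ℝ)..T, ‖P (f s)‖ :=
    intervalIntegral.integral_nonneg hT fun _ _ => norm_nonneg _
  beta_reduce
  by_contra! hc
  have h4 := norm_nonneg (P u₀)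
  nlinarith

/-- Energy inequality with the multiplier `Q`: the term at time `T` is nonnegative and is dropped,
and the uniform bound of `smoother_norm_le` controls the right side. -/
theorem smoother_integral_le (hF : Frame G j Q K) {P PA : H →L[ℝ] H} {PV : H →L[ℝ] V}
    (h : Smoother G P PA) (hPV : ∀ x, j (PV x) = P x) (hT : 0 ≤ T) (hu : IntSol G T u₀ f u)
    (hf : IntervalIntegrable f volume 0 T) :
    ∫ s in (0 : ℝ)..T, ‖PV (u s)‖ ^ 2
      ≤ (‖Q‖ + K * T) * (‖P u₀‖ + 2 * ∫ s in (0 : ℝ)..T, ‖P (f s)‖) ^ 2 := by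
  have hcu := hu.cont
  set m := ‖P u₀‖ + 2 * ∫ s in (0 : ℝ)..T, ‖P (f s)‖ with hm
  have hb : ∀ t ∈ Icc 0 T, ‖P (u t)‖ ≤ m := fun t ht => hF.smoother_norm_le h hPV hT hu hf ht
  have hPf : IntervalIntegrable (fun s => P (f s)) volume 0 T :=
    ⟨P.integrable_comp hf.1, P.integrable_comp hf.2⟩
  have h3 : 0 ≤ ∫ s in (0 : ℝ)..T, ‖P (f s)‖ :=
    intervalIntegral.integral_nonneg hT fun _ _ => norm_nonneg _
  have hm0 : 0 ≤ m := by positivity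
  have h1 := hF.smoother_energy_le h hPV hF.multiplier hT hu hf (right_mem_Icc.2 hT)
  have h2 := hF.nonneg (P (u T))
  have h4 : inner ℝ (Q (P u₀)) (P u₀) ≤ ‖Q‖ * m * m := by
    refine (real_inner_le_norm _ _).trans ?_
    have : ‖P u₀‖ ≤ m := by linarith
    have h5 : ‖Q (P u₀)‖ ≤ ‖Q‖ * m := (Q.le_opNorm _).trans (by gcongr)
    gcongr
  have h5 : ∫ s in (0 : ℝ)..T, ‖P (u s)‖ ^ 2 ≤ T * m ^ 2 := by
    calc _ ≤ ∫ s in (0 : ℝ)..T, m ^ 2 := by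
          refine intervalIntegral.integral_mono_on hT (ContinuousOn.intervalIntegrable_of_Icc hT
            (by fun_prop)) (by simp) fun s hs => ?_
          have := hb s hs
          gcongr
      _ = _ := by simp
  have h6 : ∫ s in (0 : ℝ)..T, inner ℝ (Q (P (u s))) (P (f s))
      ≤ ‖Q‖ * m * ∫ s in (0 : ℝ)..T, ‖P (f s)‖ := by
    rw [← intervalIntegral.integral_const_mul]
    refine intervalIntegral.integral_mono_on hT ?_ (hPf.norm.const_mul _)
      fun s hs => (real_inner_le_norm _ _).trans ?_
    · exact IntervalIntegrable.bilin_left (innerSL ℝ) (u := fun s => Q (P (u s))) (by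
        rw [uIcc_of_le hT]; fun_prop) hPf
    · gcongr
      exact (Q.le_opNorm _).trans (by gcongr; exact hb s hs)
  have h7 : ‖Q‖ * m * ∫ s in (0 : ℝ)..T, ‖P (f s)‖ ≤ ‖Q‖ * m * (m / 2) := by
    gcongr
    linarith [norm_nonneg (P u₀)]
  have h8 : K * ∫ s in (0 : ℝ)..T, ‖P (u s)‖ ^ 2 ≤ K * (T * m ^ 2) :=
    mul_le_mul_of_nonneg_left h5 hF.K_nonneg
  nlinarith

end Frame

end KdV

/-! ### The linear problem: lift to `V`, energy inequality, uniqueness -/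

namespace KdV

set_option linter.unusedSectionVars false

theorem tendsto_integral_norm_sq {V : Type*} [NormedAddCommGroup V] {T t : ℝ} (ht : t ∈ Icc 0 T)
    {g : ℕ → ℝ → V} {g' : ℝ → V} (hg : ∀ n, MemLp (g n) 2 (volume.restrict (Ioo 0 T)))
    (hg' : MemLp g' 2 (volume.restrict (Ioo 0 T)))
    (h : Tendsto (fun n => ∫ s in Ioo 0 T, ‖g n s - g' s‖ ^ 2) atTop (𝓝 0)) :
    Tendsto (fun n => ∫ s in (0 : ℝ)..t, ‖g n s‖ ^ 2) atTop (𝓝 (∫ s in (0 : ℝ)..t, ‖g' s‖ ^ 2)) := by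
  have hgt := fun n => memLp_mono_Ioo ht.2 (hg n)
  have hgt' := memLp_mono_Ioo ht.2 hg'
  simp_rw [intervalIntegral_eq_Ioo ht.1, ← fun n => norm_toLp_sq (hgt n), ← norm_toLp_sq hgt']
  have h1 : Tendsto (fun n => (hgt n).toLp (g n)) atTop (𝓝 (hgt'.toLp g')) := by
    rw [tendsto_iff_norm_sub_tendsto_zero]
    have h2 : Tendsto (fun n => ‖(hgt n).toLp (g n) - hgt'.toLp g'‖ ^ 2) atTop (𝓝 0) := by
      refine squeeze_zero (fun _ => by positivity) (fun n => ?_) h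
      rw [← MemLp.toLp_sub, norm_toLp_sq ((hgt n).sub hgt')]
      exact setIntegral_mono_set (integrable_norm_sq ((hg n).sub hg'))
        (ae_of_all _ fun _ => by positivity) (Ioo_subset_Ioo_right ht.2).eventuallyLE
    have h3 := h2.sqrt
    simpa [Real.sqrt_sq] using h3
  exact h1.norm.pow 2

variable {H : Type} [NormedAddCommGroup H] [InnerProductSpace ℝ H] [CompleteSpace H]
  {V : Type*} [NormedAddCommGroup V] [NormedSpace ℝ V] [CompleteSpace V]

namespace Frame

variable {G : Submodule ℝ (H × H)} {j : V →L[ℝ] H} {Q : H →L[ℝ] H} {K : ℝ}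
  {T : ℝ} {u₀ : H} {f u : ℝ → H}

theorem tendsto_integral_J_sub (hF : Frame G j Q K) (hf : IntervalIntegrable f volume 0 T) :
    Tendsto (fun n => ∫ s in (0 : ℝ)..T, ‖hF.max.J n (f s) - f s‖) atTop (𝓝 0) := by
  have h := intervalIntegral.tendsto_integral_filter_of_dominated_convergence (μ := volume)
    (a := 0) (b := T) (l := atTop) (F := fun n s => ‖hF.max.J n (f s) - f s‖) (f := fun _ => (0 : ℝ))
    (fun s => 2 * ‖f s‖) ?_ ?_ (hf.norm.const_mul 2) ?_
  · simpa using h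
  · filter_upwards with n
    have := (intervalIntegrable_iff.1 hf).aestronglyMeasurable
    exact (((hF.max.J n).continuous.comp_aestronglyMeasurable this).sub this).norm
  · filter_upwards with n
    filter_upwards with s _
    rw [norm_norm]
    have := norm_sub_le (hF.max.J n (f s)) (f s)
    have := hF.max.norm_J_le n (f s)
    linarith
  · filter_upwards with s _
    have := ((hF.max.tendsto_J (f s)).sub_const (f s)).norm
    simpa using this

/-- `J_n - J_m` is again a smoother, so `smoother_integral_le` shows that `J_n u` is Cauchy in
`L²(0, T; V)`. Its limit lifts `u` because `J_n u(t) → u(t)` for each `t`. The convergence in `L²`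
is kept in order to pass to the limit in energy inequalities. -/
theorem exists_lift_tendsto (hF : Frame G j Q K) (hT : 0 ≤ T) (hu : IntSol G T u₀ f u)
    (hf : IntervalIntegrable f volume 0 T) :
    ∃ U : ℝ → V, MemLp U 2 (volume.restrict (Ioo 0 T)) ∧
      (∀ᵐ t ∂(volume.restrict (Ioo 0 T)), j (U t) = u t) ∧
      Tendsto (fun n => ∫ s in Ioo 0 T, ‖hF.JV n (u s) - U s‖ ^ 2) atTop (𝓝 0) := by
  have hcu := hu.cont
  have hW : ∀ n, MemLp (fun t => hF.JV n (u t)) 2 (volume.restrict (Ioo 0 T)) := fun n =>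
    memLp_of_continuousOn (by fun_prop)
  set W : ℕ → Lp V 2 (volume.restrict (Ioo 0 T)) := fun n => (hW n).toLp _ with hWdef
  set δ : ℕ → ℝ := fun n => ‖hF.max.J n u₀ - u₀‖ + 2 * ∫ s in (0 : ℝ)..T, ‖hF.max.J n (f s) - f s‖
  have hδ : Tendsto δ atTop (𝓝 0) := by
    have h1 := ((hF.max.tendsto_J u₀).sub_const u₀).norm
    have h2 := (hF.tendsto_integral_J_sub hf).const_mul 2
    simpa using h1.add h2
  set C := ‖Q‖ + K * T
  have hC : 0 ≤ C := by have := hF.K_nonneg; positivity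
  have hJf : ∀ n, IntervalIntegrable (fun s => ‖hF.max.J n (f s) - f s‖) volume 0 T := fun n =>
    (IntervalIntegrable.sub ⟨(hF.max.J n).integrable_comp hf.1, (hF.max.J n).integrable_comp hf.2⟩
      hf).norm
  have hbound : ∀ n m, ‖W n - W m‖ ≤ √C * (δ n + δ m) := by
    intro n m
    have h1 := hF.smoother_integral_le ((hF.max.smoother_J n).sub (hF.max.smoother_J m))
      (PV := hF.JV n - hF.JV m) (fun x => by simp [hF.j_JV]) hT hu hf
    have e : ‖W n - W m‖ ^ 2 = ∫ s in (0 : ℝ)..T, ‖(hF.JV n - hF.JV m) (u s)‖ ^ 2 := by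
      rw [← MemLp.toLp_sub, norm_toLp_sq ((hW n).sub (hW m)), intervalIntegral_eq_Ioo hT]
      rfl
    have h2 : ‖(hF.max.J n - hF.max.J m) u₀‖
        + 2 * (∫ s in (0 : ℝ)..T, ‖(hF.max.J n - hF.max.J m) (f s)‖) ≤ δ n + δ m := by
      have tri : ∀ x, ‖(hF.max.J n - hF.max.J m) x‖ ≤ ‖hF.max.J n x - x‖ + ‖hF.max.J m x - x‖ := by
        intro x
        have : (hF.max.J n - hF.max.J m) x = (hF.max.J n x - x) - (hF.max.J m x - x) := by
          simp
        rw [this]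
        exact norm_sub_le _ _
      have h3 : ∫ s in (0 : ℝ)..T, ‖(hF.max.J n - hF.max.J m) (f s)‖
          ≤ (∫ s in (0 : ℝ)..T, ‖hF.max.J n (f s) - f s‖)
            + ∫ s in (0 : ℝ)..T, ‖hF.max.J m (f s) - f s‖ := by
        rw [← intervalIntegral.integral_add (hJf n) (hJf m)]
        refine intervalIntegral.integral_mono_on hT ?_ ((hJf n).add (hJf m)) fun s _ => tri _
        exact IntervalIntegrable.norm ⟨(hF.max.J n - hF.max.J m).integrable_comp hf.1,
          (hF.max.J n - hF.max.J m).integrable_comp hf.2⟩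
      have := tri u₀
      simp only [δ]
      linarith
    have hn : 0 ≤ ∫ s in (0 : ℝ)..T, ‖(hF.max.J n - hF.max.J m) (f s)‖ :=
      intervalIntegral.integral_nonneg hT fun _ _ => norm_nonneg _
    have h4 : 0 ≤ δ n + δ m := le_trans (by positivity) h2
    refine le_of_sq_le_sq ?_ (by positivity)
    rw [e, mul_pow, Real.sq_sqrt hC]
    refine h1.trans ?_
    gcongr
  have hcauchy : CauchySeq W := by
    rw [Metric.cauchySeq_iff]
    intro ε hε
    have h5 : Tendsto (fun n => √C * (2 * δ n)) atTop (𝓝 0) := by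
      simpa using (hδ.const_mul 2).const_mul (√C)
    obtain ⟨N, hN⟩ := (h5.eventually (gt_mem_nhds hε)).exists_forall_of_atTop
    refine ⟨N, fun n hn m hm => ?_⟩
    rw [dist_eq_norm]
    have := hbound n m
    have := hN n hn
    have := hN m hm
    linarith
  obtain ⟨U, hU⟩ := cauchySeq_tendsto_of_complete hcauchy
  refine ⟨U, Lp.memLp U, ?_, ?_⟩
  · have hm := tendstoInMeasure_of_tendsto_Lp hU
    obtain ⟨ns, hns, hae⟩ := hm.exists_seq_tendsto_ae
    have hall : ∀ᵐ t ∂(volume.restrict (Ioo 0 T)), ∀ n, W n t = hF.JV n (u t) :=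
      ae_all_iff.2 fun n => (hW n).coeFn_toLp
    filter_upwards [hae, hall] with t h1 h2
    have h3 := (j.continuous.tendsto _).comp h1
    have h4 := (hF.max.tendsto_J (u t)).comp hns.tendsto_atTop
    refine tendsto_nhds_unique h3 (h4.congr fun i => ?_)
    simp [h2, hF.j_JV]
  · have h1 := (tendsto_iff_norm_sub_tendsto_zero.1 hU).pow 2
    rw [zero_pow two_ne_zero] at h1
    refine h1.congr fun n => ?_
    rw [norm_Lp_sq]
    refine integral_congr_ae ?_
    filter_upwards [(hW n).coeFn_toLp, Lp.coeFn_sub (W n) U] with t h2 h3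
    rw [h3, Pi.sub_apply, h2]

theorem ae_eq_of_lift (hF : Frame G j Q K) {U U' : ℝ → V}
    (h : ∀ᵐ t ∂(volume.restrict (Ioo 0 T)), j (U t) = u t)
    (h' : ∀ᵐ t ∂(volume.restrict (Ioo 0 T)), j (U' t) = u t) :
    ∀ᵐ t ∂(volume.restrict (Ioo 0 T)), U t = U' t := by
  filter_upwards [h, h'] with t h1 h2 using hF.inj (h1.trans h2.symm)

/-- Integrated solutions take values in `V` for almost every time. -/
theorem exists_lift (hF : Frame G j Q K) (hT : 0 ≤ T) (hu : IntSol G T u₀ f u)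
    (hf : IntervalIntegrable f volume 0 T) :
    ∃ U : ℝ → V, MemLp U 2 (volume.restrict (Ioo 0 T)) ∧
      ∀ᵐ t ∂(volume.restrict (Ioo 0 T)), j (U t) = u t :=
  let ⟨U, h1, h2, _⟩ := hF.exists_lift_tendsto hT hu hf
  ⟨U, h1, h2⟩

/-- The energy inequality for integrated solutions. -/
theorem energy_le (hF : Frame G j Q K) {Q' : H →L[ℝ] H} {α K' : ℝ}
    (hQ : Multiplier G j Q' α K') (hT : 0 ≤ T) (hu : IntSol G T u₀ f u)
    (hf : IntervalIntegrable f volume 0 T) {U : ℝ → V}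
    (hjU : ∀ᵐ t ∂(volume.restrict (Ioo 0 T)), j (U t) = u t) {t : ℝ} (ht : t ∈ Icc 0 T) :
    inner ℝ (Q' (u t)) (u t) + 2 * α * ∫ s in (0 : ℝ)..t, ‖U s‖ ^ 2
      ≤ inner ℝ (Q' u₀) u₀ + 2 * K' * (∫ s in (0 : ℝ)..t, ‖u s‖ ^ 2)
      + 2 * ∫ s in (0 : ℝ)..t, inner ℝ (Q' (u s)) (f s) := by
  obtain ⟨U', hU', hjU', hlim⟩ := hF.exists_lift_tendsto hT hu hf
  have e : ∫ s in (0 : ℝ)..t, ‖U s‖ ^ 2 = ∫ s in (0 : ℝ)..t, ‖U' s‖ ^ 2 := by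
    rw [intervalIntegral_eq_Ioo ht.1, intervalIntegral_eq_Ioo ht.1]
    refine integral_congr_ae ?_
    filter_upwards [ae_restrict_of_ae_restrict_of_subset (Ioo_subset_Ioo_right ht.2)
      (hF.ae_eq_of_lift hjU hjU')] with s hs
    rw [hs]
  rw [e]
  have hcu := hu.cont
  have hcu' := (hu.mono ht.2).cont
  have hft := hf.mono_Icc ht
  obtain ⟨M, hM⟩ := isCompact_Icc.exists_bound_of_continuousOn hcu'
  have l1 : ∀ x, Tendsto (fun n => inner ℝ (Q' (hF.max.J n x)) (hF.max.J n x)) atTop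
      (𝓝 (inner ℝ (Q' x) x)) := fun x =>
    ((Q'.continuous.tendsto _).comp (hF.max.tendsto_J x)).inner (hF.max.tendsto_J x)
  have l2 := tendsto_integral_norm_sq ht (fun n => memLp_of_continuousOn (T := T)
    (f := fun t => hF.JV n (u t)) (by fun_prop)) hU' hlim
  have l3 : Tendsto (fun n => ∫ s in (0 : ℝ)..t, ‖hF.max.J n (u s)‖ ^ 2) atTop
      (𝓝 (∫ s in (0 : ℝ)..t, ‖u s‖ ^ 2)) := by
    refine intervalIntegral.tendsto_integral_filter_of_dominated_convergence
      (fun s => ‖u s‖ ^ 2) ?_ ?_ ?_ ?_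
    · filter_upwards with n
      rw [uIoc_of_le ht.1]
      refine ContinuousOn.aestronglyMeasurable ?_ measurableSet_Ioc
      have := hcu'.mono Ioc_subset_Icc_self
      fun_prop
    · filter_upwards with n
      filter_upwards with s _
      rw [Real.norm_of_nonneg (by positivity)]
      have := hF.max.norm_J_le n (u s)
      gcongr
    · exact ContinuousOn.intervalIntegrable_of_Icc ht.1 (by fun_prop)
    · filter_upwards with s _ using (hF.max.tendsto_J (u s)).norm.pow 2
  have l4 : Tendsto (fun n => ∫ s in (0 : ℝ)..t, inner ℝ (Q' (hF.max.J n (u s))) (hF.max.J n (f s)))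
      atTop (𝓝 (∫ s in (0 : ℝ)..t, inner ℝ (Q' (u s)) (f s))) := by
    refine intervalIntegral.tendsto_integral_filter_of_dominated_convergence
      (fun s => ‖Q'‖ * M * ‖f s‖) ?_ ?_ (hft.norm.const_mul _) ?_
    · filter_upwards with n
      refine AEStronglyMeasurable.inner ?_
        ((hF.max.J n).continuous.comp_aestronglyMeasurable (intervalIntegrable_iff.1 hft).aestronglyMeasurable)
      rw [uIoc_of_le ht.1]
      refine ContinuousOn.aestronglyMeasurable ?_ measurableSet_Ioc
      have := hcu'.mono Ioc_subset_Icc_self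
      fun_prop
    · filter_upwards with n
      filter_upwards with s hs
      rw [uIoc_of_le ht.1] at hs
      refine (abs_real_inner_le_norm _ _).trans ?_
      have h1 := hF.max.norm_J_le n (u s)
      have h2 := hF.max.norm_J_le n (f s)
      have h3 := hM s (Ioc_subset_Icc_self hs)
      have hM0 : 0 ≤ M := (norm_nonneg _).trans h3
      have h4 : ‖Q' (hF.max.J n (u s))‖ ≤ ‖Q'‖ * M :=
        (Q'.le_opNorm _).trans (by gcongr; exact h1.trans h3)
      gcongr
    · filter_upwards with s _ using
        ((Q'.continuous.tendsto _).comp (hF.max.tendsto_J (u s))).inner (hF.max.tendsto_J (f s))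
  refine le_of_tendsto_of_tendsto' ((l1 (u t)).add (l2.const_mul (2 * α)))
    (((l1 u₀).add (l3.const_mul (2 * K'))).add (l4.const_mul 2)) fun n => ?_
  exact hF.smoother_energy_le (hF.max.smoother_J n) (hF.j_JV n) hQ hT hu hf ht

/-- The linear estimate. -/
theorem linear_bound (hF : Frame G j Q K) (hT : 0 ≤ T) (hu : IntSol G T u₀ f u)
    (hf : IntervalIntegrable f volume 0 T) {U : ℝ → V}
    (hjU : ∀ᵐ t ∂(volume.restrict (Ioo 0 T)), j (U t) = u t) :
    (∀ t ∈ Icc 0 T, ‖u t‖ ≤ ‖u₀‖ + 2 * ∫ s in (0 : ℝ)..T, ‖f s‖) ∧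
    ∫ s in (0 : ℝ)..T, ‖U s‖ ^ 2
      ≤ (‖Q‖ + K * T) * (‖u₀‖ + 2 * ∫ s in (0 : ℝ)..T, ‖f s‖) ^ 2 := by
  obtain ⟨U', hU', hjU', hlim⟩ := hF.exists_lift_tendsto hT hu hf
  have e : ∫ s in (0 : ℝ)..T, ‖U s‖ ^ 2 = ∫ s in (0 : ℝ)..T, ‖U' s‖ ^ 2 := by
    rw [intervalIntegral_eq_Ioo hT, intervalIntegral_eq_Ioo hT]
    refine integral_congr_ae ?_
    filter_upwards [hF.ae_eq_of_lift hjU hjU'] with s hs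
    rw [hs]
  have hcu := hu.cont
  have hK := hF.K_nonneg
  have hle : ∀ n, ‖hF.max.J n u₀‖ + 2 * (∫ s in (0 : ℝ)..T, ‖hF.max.J n (f s)‖)
      ≤ ‖u₀‖ + 2 * ∫ s in (0 : ℝ)..T, ‖f s‖ := by
    intro n
    have h1 := hF.max.norm_J_le n u₀
    have h2 : ∫ s in (0 : ℝ)..T, ‖hF.max.J n (f s)‖ ≤ ∫ s in (0 : ℝ)..T, ‖f s‖ :=
      intervalIntegral.integral_mono_on hT (IntervalIntegrable.norm
        ⟨(hF.max.J n).integrable_comp hf.1, (hF.max.J n).integrable_comp hf.2⟩) hf.norm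
        fun s _ => hF.max.norm_J_le n (f s)
    linarith
  constructor
  · intro t ht
    refine le_of_tendsto' (hF.max.tendsto_J (u t)).norm fun n => ?_
    exact (hF.smoother_norm_le (hF.max.smoother_J n) (hF.j_JV n) hT hu hf ht).trans (hle n)
  · rw [e]
    refine le_of_tendsto' (tendsto_integral_norm_sq (right_mem_Icc.2 hT)
      (fun n => memLp_of_continuousOn (T := T)
      (f := fun t => hF.JV n (u t)) (by fun_prop)) hU' hlim) fun n => ?_
    refine (hF.smoother_integral_le (hF.max.smoother_J n) (hF.j_JV n) hT hu hf).trans ?_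
    have h0 : 0 ≤ ∫ s in (0 : ℝ)..T, ‖hF.max.J n (f s)‖ :=
      intervalIntegral.integral_nonneg hT fun _ _ => norm_nonneg _
    have := hle n
    gcongr

/-- A semigroup and hence an integrated solution exists for every integrable source. -/
theorem exists_intSol (hF : Frame G j Q K) (hT : 0 ≤ T) (u₀ : H)
    (hf : IntervalIntegrable f volume 0 T) : ∃ u, IntSol G T u₀ f u :=
  ⟨_, intSol_of_duhamel hF.max hF.max.isContractionSemigroup hF.max.semigroup_generator hT hf
    fun _ _ => rfl⟩

theorem intSol_unique (hF : Frame G j Q K) (hT : 0 ≤ T) {v : ℝ → H} (hu : IntSol G T u₀ f u)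
    (hv : IntSol G T u₀ f v) (hf : IntervalIntegrable f volume 0 T) {t : ℝ} (ht : t ∈ Icc 0 T) :
    u t = v t := by
  have h := hu.sub hv hf hf
  simp only [sub_self] at h
  obtain ⟨U, -, hU⟩ := hF.exists_lift hT h (by simp)
  have := (hF.linear_bound hT h (by simp) hU).1 t ht
  simp only [norm_zero, intervalIntegral.integral_zero, mul_zero, add_zero] at this
  exact sub_eq_zero.1 (norm_le_zero_iff.1 this)

end Frame

end KdV

/-! ### A priori bounds and uniqueness for the nonlinear problem -/

namespace KdV

set_option linter.unusedSectionVars false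

section

variable {V H : Type*} [NormedAddCommGroup H] [NormedSpace ℝ H]
  [NormedAddCommGroup V] [NormedSpace ℝ V]

theorem integrable_bilin {α : Type*} [MeasurableSpace α] {μ : Measure α} (B : V →L[ℝ] V →L[ℝ] H)
    {U W : α → V} (hU : MemLp U 2 μ) (hW : MemLp W 2 μ) :
    Integrable (fun t => B (U t) (W t)) μ := by
  refine ((hU.norm.integrable_mul hW.norm).const_mul ‖B‖).mono'
    (B.aestronglyMeasurable_comp₂ hU.aestronglyMeasurable hW.aestronglyMeasurable) ?_
  filter_upwards with t
  refine (B.le_opNorm₂ _ _).trans (le_of_eq ?_)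
  simp [mul_assoc]

end

variable {H : Type} [NormedAddCommGroup H] [InnerProductSpace ℝ H] [CompleteSpace H]
  {V : Type*} [NormedAddCommGroup V] [NormedSpace ℝ V] [CompleteSpace V]
  {G : Submodule ℝ (H × H)} {j : V →L[ℝ] H} {Q : H →L[ℝ] H} {K : ℝ}
  {T : ℝ} {u₀ : H} {f u : ℝ → H} {U : ℝ → V}

/-- An estimate for solutions with a source that is controlled by the norm in `V`. -/
theorem Frame.gronwall_bound (hF : Frame G j Q K) (hT : 0 ≤ T) (hu : IntSol G T u₀ f u)
    (hf : IntervalIntegrable f volume 0 T) (hU : MemLp U 2 (volume.restrict (Ioo 0 T)))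
    (hjU : ∀ᵐ t ∂(volume.restrict (Ioo 0 T)), j (U t) = u t) {κ : ℝ → ℝ}
    (hκ : Integrable (fun t => κ t ^ 2) (volume.restrict (Ioo 0 T)))
    (hfκ : ∀ᵐ t ∂(volume.restrict (Ioo 0 T)), ‖f t‖ ≤ κ t * ‖U t‖) {t : ℝ} (ht : t ∈ Icc 0 T) :
    ‖u t‖ ^ 2 + ∫ s in (0 : ℝ)..t, ‖U s‖ ^ 2 ≤ (1 + ‖Q‖) * ‖u₀‖ ^ 2
      * Real.exp (2 * K * T + (1 + ‖Q‖) ^ 2 * ∫ s in (0 : ℝ)..T, κ s ^ 2) := by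
  have hcu := hu.cont
  have hK := hF.K_nonneg
  have hU2 : IntervalIntegrable (fun s => ‖U s‖ ^ 2) volume 0 T :=
    intervalIntegrable_of_Ioo hT (integrable_norm_sq hU)
  have hκ2 : IntervalIntegrable (fun s => κ s ^ 2) volume 0 T := intervalIntegrable_of_Ioo hT hκ
  set κ' : ℝ → ℝ := fun s => 2 * K + (1 + ‖Q‖) ^ 2 * κ s ^ 2 with hκ'
  have hκ'i : IntervalIntegrable κ' volume 0 T :=
    IntervalIntegrable.add (by simp) (hκ2.const_mul _)
  have hprim := continuousOn_integral hT hU2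
  -- The smoothing integral is made part of the Gronwall quantity, so both bounds come out together.
  set φ : ℝ → ℝ := fun t => ‖u t‖ ^ 2 + ∫ s in (0 : ℝ)..t, ‖U s‖ ^ 2 with hφ
  have hφc : ContinuousOn φ (Icc 0 T) := (hcu.norm.pow 2).add hprim
  have hle : ∀ t ∈ Icc 0 T, φ t ≤ (1 + ‖Q‖) * ‖u₀‖ ^ 2 + ∫ s in (0 : ℝ)..t, κ' s * φ s := by
    intro t ht
    have hsub : Icc 0 t ⊆ Icc 0 T := Icc_subset_Icc_right ht.2
    have h1 := hF.energy_le hF.multiplier_id hT hu hf hjU ht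
    have h2 := hF.energy_le hF.multiplier hT hu hf hjU ht
    simp only [ContinuousLinearMap.coe_id', id_eq, mul_zero, zero_mul, add_zero,
      real_inner_self_eq_norm_sq] at h1
    have h3 := hF.nonneg (u t)
    have h4 : inner ℝ (Q u₀) u₀ ≤ ‖Q‖ * ‖u₀‖ ^ 2 := by
      refine (real_inner_le_norm _ _).trans ?_
      rw [pow_two, ← mul_assoc]
      gcongr
      exact Q.le_opNorm _
    have hft := hf.mono_Icc ht
    have i1 : IntervalIntegrable (fun s => inner ℝ (u s) (f s)) volume 0 t :=
      IntervalIntegrable.bilin_left (innerSL ℝ) (u := fun s => u s) (by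
        rw [uIcc_of_le ht.1]; exact hcu.mono hsub) hft
    have i2 : IntervalIntegrable (fun s => inner ℝ (Q (u s)) (f s)) volume 0 t :=
      IntervalIntegrable.bilin_left (innerSL ℝ) (u := fun s => Q (u s)) (by
        rw [uIcc_of_le ht.1]; have := hcu.mono hsub; fun_prop) hft
    have i3 : IntervalIntegrable (fun s => ‖u s‖ ^ 2) volume 0 t :=
      ((hcu.mono hsub).norm.pow 2).intervalIntegrable_of_Icc ht.1
    have i4 := hU2.mono_Icc ht
    have i5 : IntervalIntegrable (fun s => κ' s * φ s) volume 0 t :=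
      (hκ'i.mono_Icc ht).mul_continuousOn (by rw [uIcc_of_le ht.1]; exact hφc.mono hsub)
    -- Adding the energy inequalities for the identity and for `Q` leaves `2 ∫ ‖U‖²` on the left.
    -- One copy absorbs the source by Young's inequality `2 (1 + ‖Q‖) κ ‖u‖ ‖U‖ ≤ (1 + ‖Q‖)² κ² ‖u‖²
    -- + ‖U‖²`; the other stays in `φ`.
    have key : 2 * K * (∫ s in (0 : ℝ)..t, ‖u s‖ ^ 2) + 2 * (∫ s in (0 : ℝ)..t, inner ℝ (u s) (f s))
        + 2 * (∫ s in (0 : ℝ)..t, inner ℝ (Q (u s)) (f s)) - (∫ s in (0 : ℝ)..t, ‖U s‖ ^ 2)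
        ≤ ∫ s in (0 : ℝ)..t, κ' s * φ s := by
      rw [← intervalIntegral.integral_const_mul, ← intervalIntegral.integral_const_mul,
        ← intervalIntegral.integral_const_mul,
        ← intervalIntegral.integral_add (i3.const_mul _) (i1.const_mul _),
        ← intervalIntegral.integral_add ((i3.const_mul _).add (i1.const_mul _)) (i2.const_mul _),
        ← intervalIntegral.integral_sub (((i3.const_mul _).add (i1.const_mul _)).add
          (i2.const_mul _)) i4]
      have i6 := (((i3.const_mul (2 * K)).add (i1.const_mul 2)).add (i2.const_mul 2)).sub i4
      rw [intervalIntegral_eq_Ioo ht.1, intervalIntegral_eq_Ioo ht.1]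
      refine integral_mono_ae ((intervalIntegrable_iff_integrableOn_Ioo_of_le ht.1).1 i6)
        ((intervalIntegrable_iff_integrableOn_Ioo_of_le ht.1).1 i5) ?_
      filter_upwards [ae_restrict_of_ae_restrict_of_subset (Ioo_subset_Ioo_right ht.2) hfκ,
        ae_restrict_mem measurableSet_Ioo] with s hs hs'
      have a1 := real_inner_le_norm (u s) (f s)
      have a2 : inner ℝ (Q (u s)) (f s) ≤ ‖Q‖ * ‖u s‖ * ‖f s‖ :=
        (real_inner_le_norm _ _).trans (by gcongr; exact Q.le_opNorm _)
      have a3 : (1 + ‖Q‖) * ‖u s‖ * ‖f s‖ ≤ (1 + ‖Q‖) * ‖u s‖ * (κ s * ‖U s‖) := by gcongr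
      have a4 : ‖u s‖ ^ 2 ≤ φ s := by
        have : 0 ≤ ∫ r in (0 : ℝ)..s, ‖U r‖ ^ 2 :=
          intervalIntegral.integral_nonneg hs'.1.le fun _ _ => by positivity
        simp only [hφ]
        linarith
      have a5 : κ' s * ‖u s‖ ^ 2 ≤ κ' s * φ s := by
        have : 0 ≤ κ' s := by simp only [hκ']; positivity
        gcongr
      have a6 : κ' s * ‖u s‖ ^ 2 = 2 * K * ‖u s‖ ^ 2 + (1 + ‖Q‖) ^ 2 * κ s ^ 2 * ‖u s‖ ^ 2 := by
        simp only [hκ']; ring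
      nlinarith [sq_nonneg ((1 + ‖Q‖) * κ s * ‖u s‖ - ‖U s‖)]
    simp only [hφ] at key ⊢
    linarith
  have hg := gronwall_integral hκ'i (fun s _ => by simp only [hκ']; positivity) hφc hle ht
  refine hg.trans ?_
  gcongr
  have e : ∫ s in (0 : ℝ)..T, κ' s = 2 * K * T + (1 + ‖Q‖) ^ 2 * ∫ s in (0 : ℝ)..T, κ s ^ 2 := by
    simp only [hκ']
    rw [intervalIntegral.integral_add (by simp) (hκ2.const_mul _), intervalIntegral.integral_const,
      intervalIntegral.integral_const_mul, sub_zero, smul_eq_mul]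
    ring
  rw [← e]
  exact intervalIntegral.integral_mono_interval le_rfl ht.1 ht.2
    (ae_of_all _ fun s => by simp only [hκ']; positivity) hκ'i

/-- The algebraic properties of the convection term `B(u, v) = (u v)' / 2`. -/
structure Convection (j : V →L[ℝ] H) (Q : H →L[ℝ] H) (K : ℝ) (B : V →L[ℝ] V →L[ℝ] H) : Prop where
  symm : ∀ U W, B U W = B W U
  skew : ∀ U, inner ℝ (j U) (B U U) = 0
  bound : ∀ U, |inner ℝ (Q (j U)) (B U U)| ≤ K * ‖U‖ * ‖j U‖ ^ 2

/-- Solutions of `u' + B(u, u) = A u`, `u 0 = u₀`. -/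
structure IsNLSol (G : Submodule ℝ (H × H)) (j : V →L[ℝ] H) (B : V →L[ℝ] V →L[ℝ] H) (T : ℝ) (u₀ : H)
    (u : ℝ → H) (U : ℝ → V) : Prop where
  sol : IntSol G T u₀ (fun t => -B (U t) (U t)) u
  memLp : MemLp U 2 (volume.restrict (Ioo 0 T))
  lift : ∀ᵐ t ∂(volume.restrict (Ioo 0 T)), j (U t) = u t

namespace IsNLSol

variable {B : V →L[ℝ] V →L[ℝ] H}

theorem intervalIntegrable (h : IsNLSol G j B T u₀ u U) (hT : 0 ≤ T) :
    IntervalIntegrable (fun t => -B (U t) (U t)) volume 0 T :=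
  intervalIntegrable_of_Ioo hT (integrable_bilin B h.memLp h.memLp).neg

/-- Energy inequality with the identity as multiplier: skewness removes the convection term. -/
theorem norm_le (h : IsNLSol G j B T u₀ u U) (hF : Frame G j Q K) (hB : Convection j Q K B)
    (hT : 0 ≤ T) {t : ℝ} (ht : t ∈ Icc 0 T) : ‖u t‖ ≤ ‖u₀‖ := by
  have h1 := hF.energy_le hF.multiplier_id hT h.sol (h.intervalIntegrable hT) h.lift ht
  simp only [ContinuousLinearMap.coe_id', id_eq, mul_zero, zero_mul, add_zero,
    real_inner_self_eq_norm_sq] at h1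
  have h2 : ∫ s in (0 : ℝ)..t, inner ℝ (u s) (-B (U s) (U s)) = 0 := by
    rw [intervalIntegral_eq_Ioo ht.1]
    refine integral_eq_zero_of_ae ?_
    filter_upwards [ae_restrict_of_ae_restrict_of_subset (Ioo_subset_Ioo_right ht.2) h.lift] with s hs
    rw [← hs, inner_neg_right, hB.skew, neg_zero, Pi.zero_apply]
  rw [h2] at h1
  exact le_of_sq_le_sq (by linarith) (norm_nonneg _)

/-- Energy inequality with the multiplier `Q`. The convection term is at most `2 K ‖U‖ ‖u‖² ≤ ‖U‖² +
K² ‖u₀‖⁴`, and half of the smoothing term absorbs it. -/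
theorem integral_le (h : IsNLSol G j B T u₀ u U) (hF : Frame G j Q K) (hB : Convection j Q K B)
    (hT : 0 ≤ T) : ∫ s in (0 : ℝ)..T, ‖U s‖ ^ 2
      ≤ (‖Q‖ + 2 * K * T + K ^ 2 * T * ‖u₀‖ ^ 2) * ‖u₀‖ ^ 2 := by
  have hcu := h.sol.cont
  have hK := hF.K_nonneg
  have h1 := hF.energy_le hF.multiplier hT h.sol (h.intervalIntegrable hT) h.lift (right_mem_Icc.2 hT)
  have h3 := hF.nonneg (u T)
  have h4 : inner ℝ (Q u₀) u₀ ≤ ‖Q‖ * ‖u₀‖ ^ 2 := by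
    refine (real_inner_le_norm _ _).trans ?_
    rw [pow_two, ← mul_assoc]
    gcongr
    exact Q.le_opNorm _
  have h5 : ∫ s in (0 : ℝ)..T, ‖u s‖ ^ 2 ≤ T * ‖u₀‖ ^ 2 := by
    calc _ ≤ ∫ s in (0 : ℝ)..T, ‖u₀‖ ^ 2 := by
          refine intervalIntegral.integral_mono_on hT (ContinuousOn.intervalIntegrable_of_Icc hT
            (by fun_prop)) (by simp) fun s hs => ?_
          have := h.norm_le hF hB hT hs
          gcongr
      _ = _ := by simp
  have h6 : 2 * ∫ s in (0 : ℝ)..T, inner ℝ (Q (u s)) (-B (U s) (U s))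
      ≤ (∫ s in (0 : ℝ)..T, ‖U s‖ ^ 2) + K ^ 2 * ‖u₀‖ ^ 4 * T := by
    have hi : IntervalIntegrable (fun s => inner ℝ (Q (u s)) (-B (U s) (U s))) volume 0 T :=
      IntervalIntegrable.bilin_left (innerSL ℝ) (u := fun s => Q (u s)) (by
        rw [uIcc_of_le hT]; fun_prop) (h.intervalIntegrable hT)
    have hU2 : IntervalIntegrable (fun s => ‖U s‖ ^ 2) volume 0 T :=
      intervalIntegrable_of_Ioo hT (integrable_norm_sq h.memLp)
    have e : (∫ s in (0 : ℝ)..T, ‖U s‖ ^ 2) + K ^ 2 * ‖u₀‖ ^ 4 * T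
        = ∫ s in (0 : ℝ)..T, (‖U s‖ ^ 2 + K ^ 2 * ‖u₀‖ ^ 4) := by
      rw [intervalIntegral.integral_add hU2 (by simp)]
      rw [intervalIntegral.integral_const, sub_zero, smul_eq_mul]
      ring
    rw [e, ← intervalIntegral.integral_const_mul, intervalIntegral_eq_Ioo hT,
      intervalIntegral_eq_Ioo hT]
    refine integral_mono_ae ((intervalIntegrable_iff_integrableOn_Ioo_of_le hT).1 (hi.const_mul 2))
      ((intervalIntegrable_iff_integrableOn_Ioo_of_le hT).1 (hU2.add (by simp))) ?_
    filter_upwards [h.lift, ae_restrict_mem measurableSet_Ioo] with s hs hs'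
    have a1 := (abs_le.1 (hB.bound (U s))).1
    have a2 := h.norm_le hF hB hT (Ioo_subset_Icc_self hs')
    rw [hs] at a1
    rw [inner_neg_right]
    have a3 : K * ‖U s‖ * ‖u s‖ ^ 2 ≤ K * ‖U s‖ * ‖u₀‖ ^ 2 := by gcongr
    nlinarith [sq_nonneg (‖U s‖ - K * ‖u₀‖ ^ 2)]
  have h7 : 2 * K * ∫ s in (0 : ℝ)..T, ‖u s‖ ^ 2 ≤ 2 * K * (T * ‖u₀‖ ^ 2) := by gcongr
  nlinarith

/-- By symmetry of `B` the sources differ by `-B(U + W, U - W)`. So `gronwall_bound` applies with `κ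
= ‖B‖ ‖U + W‖`, and `integral_le` bounds the integral of `κ²` in terms of `R`. -/
theorem sub_le {w₀ : H} {w : ℝ → H} {W : ℝ → V} (h : IsNLSol G j B T u₀ u U)
    (h' : IsNLSol G j B T w₀ w W) (hF : Frame G j Q K) (hB : Convection j Q K B)
    (hT : 0 ≤ T) {R : ℝ} (hu₀ : ‖u₀‖ ≤ R) (hw₀ : ‖w₀‖ ≤ R) {t : ℝ} (ht : t ∈ Icc 0 T) :
    ‖u t - w t‖ ^ 2 + ∫ s in (0 : ℝ)..t, ‖U s - W s‖ ^ 2 ≤ (1 + ‖Q‖) * ‖u₀ - w₀‖ ^ 2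
      * Real.exp (2 * K * T + (1 + ‖Q‖) ^ 2 * (‖B‖ ^ 2 *
        (4 * ((‖Q‖ + 2 * K * T + K ^ 2 * T * R ^ 2) * R ^ 2)))) := by
  have hK := hF.K_nonneg
  have hs := h.sol.sub h'.sol (h.intervalIntegrable hT) (h'.intervalIntegrable hT)
  have hUW : MemLp (fun s => U s + W s) 2 (volume.restrict (Ioo 0 T)) := h.memLp.add h'.memLp
  have hb : ∀ s, ‖-B (U s) (U s) - -B (W s) (W s)‖ ≤ ‖B‖ * ‖U s + W s‖ * ‖U s - W s‖ := by
    intro s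
    have e : -B (U s) (U s) - -B (W s) (W s) = -B (U s + W s) (U s - W s) := by
      simp only [map_add, map_sub, add_apply, hB.symm (W s) (U s)]
      abel
    rw [e, norm_neg]
    exact B.le_opNorm₂ _ _
  have key := hF.gronwall_bound hT hs ((h.intervalIntegrable hT).sub (h'.intervalIntegrable hT))
    (h.memLp.sub h'.memLp) (by
      filter_upwards [h.lift, h'.lift] with s h1 h2
      rw [← h1, ← h2]; simp) (κ := fun s => ‖B‖ * ‖U s + W s‖) (by
      simp_rw [mul_pow]
      exact (integrable_norm_sq hUW).const_mul _) (ae_of_all _ hb) ht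
  simp only [Pi.sub_apply] at key
  refine key.trans ?_
  have hU2 : IntervalIntegrable (fun s => ‖U s‖ ^ 2) volume 0 T :=
    intervalIntegrable_of_Ioo hT (integrable_norm_sq h.memLp)
  have hW2 : IntervalIntegrable (fun s => ‖W s‖ ^ 2) volume 0 T :=
    intervalIntegrable_of_Ioo hT (integrable_norm_sq h'.memLp)
  have hUW2 : IntervalIntegrable (fun s => ‖U s + W s‖ ^ 2) volume 0 T :=
    intervalIntegrable_of_Ioo hT (integrable_norm_sq hUW)
  have b1 : ∫ s in (0 : ℝ)..T, ‖U s + W s‖ ^ 2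
      ≤ 2 * (∫ s in (0 : ℝ)..T, ‖U s‖ ^ 2) + 2 * ∫ s in (0 : ℝ)..T, ‖W s‖ ^ 2 := by
    rw [← intervalIntegral.integral_const_mul, ← intervalIntegral.integral_const_mul,
      ← intervalIntegral.integral_add (hU2.const_mul 2) (hW2.const_mul 2)]
    refine intervalIntegral.integral_mono_on hT hUW2 ((hU2.const_mul 2).add (hW2.const_mul 2))
      fun s _ => ?_
    have := norm_add_le (U s) (W s)
    nlinarith [norm_nonneg (U s + W s), sq_nonneg (‖U s‖ - ‖W s‖)]
  have b2 : ∫ s in (0 : ℝ)..T, ‖U s‖ ^ 2 ≤ (‖Q‖ + 2 * K * T + K ^ 2 * T * R ^ 2) * R ^ 2 :=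
    (h.integral_le hF hB hT).trans (by gcongr)
  have b3 : ∫ s in (0 : ℝ)..T, ‖W s‖ ^ 2 ≤ (‖Q‖ + 2 * K * T + K ^ 2 * T * R ^ 2) * R ^ 2 :=
    (h'.integral_le hF hB hT).trans (by gcongr)
  simp_rw [mul_pow]
  rw [intervalIntegral.integral_const_mul]
  gcongr
  linarith

theorem unique {w : ℝ → H} {W : ℝ → V} (h : IsNLSol G j B T u₀ u U)
    (h' : IsNLSol G j B T u₀ w W) (hF : Frame G j Q K) (hB : Convection j Q K B)
    (hT : 0 ≤ T) {t : ℝ} (ht : t ∈ Icc 0 T) : u t = w t := by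
  have h1 := h.sub_le h' hF hB hT le_rfl le_rfl ht
  have h2 : 0 ≤ ∫ s in (0 : ℝ)..t, ‖U s - W s‖ ^ 2 :=
    intervalIntegral.integral_nonneg ht.1 fun _ _ => by positivity
  rw [sub_self, norm_zero, zero_pow two_ne_zero, mul_zero, zero_mul] at h1
  have h3 : ‖u t - w t‖ = 0 := by
    have := norm_nonneg (u t - w t)
    nlinarith
  exact sub_eq_zero.1 (norm_eq_zero.1 h3)

end IsNLSol

end KdV

/-! ### Concatenation of functions of time -/

namespace KdV

set_option linter.unusedSectionVars false

section Glue

variable {E : Type*} [NormedAddCommGroup E]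

/-- Concatenation of functions on `[0, a]` and `[0, b]` to a function on `[0, a + b]`. -/
def glue (a : ℝ) (g g' : ℝ → E) (s : ℝ) : E := if s ≤ a then g s else g' (s - a)

theorem glue_of_le {a s : ℝ} (h : s ≤ a) (g g' : ℝ → E) : glue a g g' s = g s := if_pos h

theorem glue_of_lt {a s : ℝ} (h : a < s) (g g' : ℝ → E) : glue a g g' s = g' (s - a) :=
  if_neg (not_le.2 h)

theorem glue_integral_left [NormedSpace ℝ E] {a s : ℝ} (hs : s ∈ Icc 0 a) (g g' : ℝ → E) :
    ∫ r in (0 : ℝ)..s, glue a g g' r = ∫ r in (0 : ℝ)..s, g r := by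
  refine intervalIntegral.integral_congr fun r hr => ?_
  rw [uIcc_of_le hs.1] at hr
  exact glue_of_le (hr.2.trans hs.2) _ _

theorem intervalIntegrable_glue_left {a : ℝ} (ha : 0 ≤ a) {g : ℝ → E} (g' : ℝ → E)
    (hg : IntervalIntegrable g volume 0 a) : IntervalIntegrable (glue a g g') volume 0 a := by
  refine hg.congr fun r hr => ?_
  rw [uIoc_of_le ha] at hr
  exact (glue_of_le hr.2 _ _).symm

theorem intervalIntegrable_glue_right {a b : ℝ} (hb : 0 ≤ b) (g : ℝ → E) {g' : ℝ → E}
    (hg : IntervalIntegrable g' volume 0 b) :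
    IntervalIntegrable (glue a g g') volume a (a + b) := by
  have h := hg.comp_sub_right a
  rw [zero_add, add_comm b a] at h
  refine h.congr fun r hr => ?_
  rw [uIoc_of_le (by linarith)] at hr
  exact (glue_of_lt hr.1 _ _).symm

theorem glue_integral_right [NormedSpace ℝ E] {a b : ℝ} (ha : 0 ≤ a) (hb : 0 ≤ b) {g g' : ℝ → E}
    (hg : IntervalIntegrable g volume 0 a) (hg' : IntervalIntegrable g' volume 0 b) :
    ∫ r in (0 : ℝ)..(a + b), glue a g g' r
      = (∫ r in (0 : ℝ)..a, g r) + ∫ r in (0 : ℝ)..b, g' r := by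
  rw [← intervalIntegral.integral_add_adjacent_intervals (intervalIntegrable_glue_left ha g' hg)
    (intervalIntegrable_glue_right hb g hg'), glue_integral_left (right_mem_Icc.2 ha)]
  congr 1
  have h := intervalIntegral.integral_comp_sub_right (a := a) (b := a + b) g' a
  rw [sub_self, add_sub_cancel_left] at h
  rw [← h, intervalIntegral.integral_of_le (by linarith), intervalIntegral.integral_of_le (by linarith)]
  exact setIntegral_congr_fun measurableSet_Ioc fun r hr => glue_of_lt hr.1 _ _

theorem preimage_sub_Ioo (a b : ℝ) : (fun x : ℝ => x - a) ⁻¹' Ioo 0 b = Ioo a (a + b) := by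
  ext x
  simp only [mem_preimage, mem_Ioo, sub_pos, sub_lt_iff_lt_add']

theorem memLp_glue {a b : ℝ} {g g' : ℝ → E}
    (hg : MemLp g 2 (volume.restrict (Ioo 0 a))) (hg' : MemLp g' 2 (volume.restrict (Ioo 0 b))) :
    MemLp (glue a g g') 2 (volume.restrict (Ioo 0 (a + b))) := by
  classical
  have h1 : MemLp g 2 ((volume.restrict (Ioo 0 (a + b))).restrict (Iic a)) := by
    rw [Measure.restrict_restrict measurableSet_Iic]
    have : MemLp g 2 (volume.restrict (Ioc 0 a)) := by
      rwa [← restrict_Ioo_eq_restrict_Ioc]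
    refine this.mono_measure (Measure.restrict_mono ?_ le_rfl)
    rintro x ⟨hx1, hx2⟩
    exact ⟨hx2.1, hx1⟩
  have hmp := (measurePreserving_sub_right volume a).restrict_preimage
    (measurableSet_Ioo (a := (0 : ℝ)) (b := b))
  rw [preimage_sub_Ioo] at hmp
  have h2 : MemLp (fun s => g' (s - a)) 2 ((volume.restrict (Ioo 0 (a + b))).restrict (Iic a)ᶜ) := by
    rw [Measure.restrict_restrict measurableSet_Iic.compl]
    refine (hg'.comp_measurePreserving hmp).mono_measure (Measure.restrict_mono ?_ le_rfl)
    rintro x ⟨hx1, hx2⟩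
    exact ⟨not_le.1 hx1, hx2.2⟩
  exact MemLp.piecewise measurableSet_Iic h1 h2

theorem ae_glue {F : Type*} [NormedAddCommGroup F] {a b : ℝ} {g g' : ℝ → E} {k k' : ℝ → F}
    {P : E → F → Prop} (h : ∀ᵐ t ∂(volume.restrict (Ioo 0 a)), P (g t) (k t))
    (h' : ∀ᵐ t ∂(volume.restrict (Ioo 0 b)), P (g' t) (k' t)) :
    ∀ᵐ t ∂(volume.restrict (Ioo 0 (a + b))), P (glue a g g' t) (glue a k k' t) := by
  have hmp := (measurePreserving_sub_right volume a).restrict_preimage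
    (measurableSet_Ioo (a := (0 : ℝ)) (b := b))
  rw [preimage_sub_Ioo] at hmp
  have h2 := (ae_restrict_iff' measurableSet_Ioo).1 (hmp.quasiMeasurePreserving.ae h')
  have h1 := (ae_restrict_iff' measurableSet_Ioo).1 h
  have h0 : ∀ᵐ s : ℝ, s ≠ a := by simp [ae_iff, measure_singleton]
  rw [ae_restrict_iff' measurableSet_Ioo]
  filter_upwards [h0, h1, h2] with t ht0 ht1 ht2 ht
  rcases lt_or_gt_of_ne ht0 with hlt | hlt
  · rw [glue_of_le hlt.le, glue_of_le hlt.le]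
    exact ht1 ⟨ht.1, hlt⟩
  · rw [glue_of_lt hlt, glue_of_lt hlt]
    exact ht2 ⟨hlt, ht.2⟩

theorem continuousOn_glue {a b : ℝ} {g g' : ℝ → E} (hg : ContinuousOn g (Icc 0 a))
    (hg' : ContinuousOn g' (Icc 0 b)) (h : g a = g' 0) :
    ContinuousOn (glue a g g') (Icc 0 (a + b)) := by
  have h1 : ContinuousOn (glue a g g') (Icc 0 a) := hg.congr fun x hx => glue_of_le hx.2 _ _
  have h2 : ContinuousOn (glue a g g') (Icc a (a + b)) := by
    have : ContinuousOn (fun x => g' (x - a)) (Icc a (a + b)) :=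
      hg'.comp (by fun_prop) fun x hx => ⟨by linarith [hx.1], by linarith [hx.2]⟩
    refine this.congr fun x hx => ?_
    rcases hx.1.eq_or_lt with rfl | hlt
    · simp [glue_of_le le_rfl, h]
    · exact glue_of_lt hlt _ _
  refine (h1.union_of_isClosed h2 isClosed_Icc isClosed_Icc).mono fun x hx => ?_
  rcases le_total x a with hxa | hxa
  · exact Or.inl ⟨hx.1, hxa⟩
  · exact Or.inr ⟨hxa, hx.2⟩

end Glue

end KdV

/-! ### The equation for the time derivative -/

namespace KdV

set_option linter.unusedSectionVars false

theorem integral_norm_le_sqrt {V : Type*} [NormedAddCommGroup V] {T : ℝ} (hT : 0 ≤ T) {Z : ℝ → V}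
    (hZ : MemLp Z 2 (volume.restrict (Ioo 0 T))) :
    ∫ s in (0 : ℝ)..T, ‖Z s‖ ≤ √T * √(∫ s in (0 : ℝ)..T, ‖Z s‖ ^ 2) := by
  have h := (integral_norm_mul_le (g := fun _ : ℝ => (1 : ℝ)) (μ := volume.restrict (Ioo 0 T))
    (memLp_const 1) hZ).2
  rw [intervalIntegral_eq_Ioo hT, intervalIntegral_eq_Ioo hT]
  simpa [hT] using h

theorem intervalIntegrable_of_memLp {V : Type*} [NormedAddCommGroup V] {T : ℝ} (hT : 0 ≤ T)
    {Z : ℝ → V} (hZ : MemLp Z 2 (volume.restrict (Ioo 0 T))) : IntervalIntegrable Z volume 0 T :=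
  intervalIntegrable_of_Ioo hT (hZ.integrable one_le_two)

theorem norm_integral_le_sqrt {V : Type*} [NormedAddCommGroup V] [NormedSpace ℝ V] {T t : ℝ}
    (ht : t ∈ Icc 0 T) {Z : ℝ → V} (hZ : MemLp Z 2 (volume.restrict (Ioo 0 T))) :
    ‖∫ s in (0 : ℝ)..t, Z s‖ ≤ √T * √(∫ s in (0 : ℝ)..T, ‖Z s‖ ^ 2) := by
  have hT := ht.1.trans ht.2
  refine (intervalIntegral.norm_integral_le_integral_norm ht.1).trans
    (le_trans ?_ (integral_norm_le_sqrt hT hZ))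
  exact intervalIntegral.integral_mono_interval le_rfl ht.1 ht.2
    (ae_of_all _ fun _ => norm_nonneg _) (intervalIntegrable_of_memLp hT hZ).norm

variable {H : Type} [NormedAddCommGroup H] [InnerProductSpace ℝ H] [CompleteSpace H]
  {V : Type*} [NormedAddCommGroup V] [NormedSpace ℝ V] [CompleteSpace V]
  {G : Submodule ℝ (H × H)} {j : V →L[ℝ] H} {Q : H →L[ℝ] H} {K : ℝ} {B : V →L[ℝ] V →L[ℝ] H}
  {T : ℝ} {Y₀ : V} {z₀ : H} {z : ℝ → H} {Z : ℝ → V}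

theorem IntSol.glue {a b : ℝ} (ha : 0 ≤ a) {u₀ : H} {f u f' u' : ℝ → H}
    (h : IntSol G a u₀ f u) (h' : IntSol G b (u a) f' u') (h0 : u a = u' 0)
    (hf : IntervalIntegrable f volume 0 a) (hf' : IntervalIntegrable f' volume 0 b) :
    IntSol G (a + b) u₀ (glue a f f') (glue a u u') := by
  refine ⟨continuousOn_glue h.cont h'.cont h0, fun t ht => ?_⟩
  rcases le_or_gt t a with hta | hta
  · rw [glue_integral_left ⟨ht.1, hta⟩, glue_integral_left ⟨ht.1, hta⟩, glue_of_le hta]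
    exact h.mem t ⟨ht.1, hta⟩
  · obtain ⟨s, rfl⟩ : ∃ s, t = a + s := ⟨t - a, by ring⟩
    have hs : s ∈ Icc 0 b := ⟨by linarith, by linarith [ht.2]⟩
    rw [glue_of_lt hta, glue_integral_right ha hs.1 (h.cont.intervalIntegrable_of_Icc ha)
      ((h'.mono hs.2).cont.intervalIntegrable_of_Icc hs.1),
      glue_integral_right ha hs.1 hf (hf'.mono_Icc hs), add_sub_cancel_left]
    refine graph_mem_of_eq (G.add_mem (h.mem a (right_mem_Icc.2 ha)) (h'.mem _ hs)) rfl ?_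
    simp only [Prod.snd_add]
    abel

/-- The function with derivative `Z` and initial value `Y₀`. -/
def prim (Y₀ : V) (Z : ℝ → V) (t : ℝ) : V := Y₀ + ∫ s in (0 : ℝ)..t, Z s

theorem continuousOn_prim (hT : 0 ≤ T) (hZ : MemLp Z 2 (volume.restrict (Ioo 0 T))) (Y₀ : V) :
    ContinuousOn (prim Y₀ Z) (Icc 0 T) :=
  continuousOn_const.add (continuousOn_integral hT (intervalIntegrable_of_memLp hT hZ))

/-- Solutions `z` of the equation `z' + 2 B(y, z) = A z`, `z 0 = z₀`, where `y' = z`, `y 0 = Y₀`. -/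
structure IsRegSol (G : Submodule ℝ (H × H)) (j : V →L[ℝ] H) (B : V →L[ℝ] V →L[ℝ] H) (T : ℝ)
    (Y₀ : V) (z₀ : H) (z : ℝ → H) (Z : ℝ → V) : Prop where
  sol : IntSol G T z₀ (fun t => -((2 : ℝ) • B (prim Y₀ Z t) (Z t))) z
  memLp : MemLp Z 2 (volume.restrict (Ioo 0 T))
  lift : ∀ᵐ t ∂(volume.restrict (Ioo 0 T)), j (Z t) = z t

theorem intervalIntegrable_regSource (hT : 0 ≤ T) (hZ : MemLp Z 2 (volume.restrict (Ioo 0 T)))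
    (Y₀ : V) : IntervalIntegrable (fun t => -((2 : ℝ) • B (prim Y₀ Z t) (Z t))) volume 0 T :=
  ((IntervalIntegrable.bilin_left B (by rw [uIcc_of_le hT]; exact continuousOn_prim hT hZ Y₀)
    (intervalIntegrable_of_memLp hT hZ)).smul (2 : ℝ)).neg

namespace IsRegSol

theorem mono (h : IsRegSol G j B T Y₀ z₀ z Z) {t : ℝ} (ht : t ≤ T) : IsRegSol G j B t Y₀ z₀ z Z :=
  ⟨h.sol.mono ht, memLp_mono_Ioo ht h.memLp,
    ae_restrict_of_ae_restrict_of_subset (Ioo_subset_Ioo_right ht) h.lift⟩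

/-- The source depends on the past through `prim`. Restarting from the pair `prim Y₀ Z a`, `z a`
reproduces it, because the primitive of the glued function continues from the value reached at time
`a`. -/
theorem glue (hG : MaxDissipative G) {a b : ℝ} (ha : 0 ≤ a) (hb : 0 ≤ b) {z' : ℝ → H} {Z' : ℝ → V}
    (h : IsRegSol G j B a Y₀ z₀ z Z) (h' : IsRegSol G j B b (prim Y₀ Z a) (z a) z' Z') :
    IsRegSol G j B (a + b) Y₀ z₀ (glue a z z') (glue a Z Z') := by
  have h1 := h.sol.glue ha h'.sol (h'.sol.eq_zero_left hG hb).symm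
    (intervalIntegrable_regSource ha h.memLp _) (intervalIntegrable_regSource hb h'.memLp _)
  refine ⟨h1.congr_source ?_, memLp_glue h.memLp h'.memLp, ae_glue (P := fun v u => j v = u)
    h.lift h'.lift⟩
  filter_upwards [ae_restrict_mem measurableSet_Ioo] with t ht
  rcases le_or_gt t a with hta | hta
  · rw [glue_of_le hta, glue_of_le hta, prim, prim, glue_integral_left ⟨ht.1.le, hta⟩]
  · have hs : t - a ∈ Icc 0 b := ⟨by linarith, by linarith [ht.2]⟩
    have e : t = a + (t - a) := by ring
    rw [glue_of_lt hta, glue_of_lt hta]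
    have e2 : prim Y₀ (KdV.glue a Z Z') t = prim (prim Y₀ Z a) Z' (t - a) := by
      simp only [prim]
      conv_lhs => rw [e]
      rw [glue_integral_right ha hs.1 (intervalIntegrable_of_memLp ha h.memLp)
        ((intervalIntegrable_of_memLp hb h'.memLp).mono_Icc hs), add_assoc]
    rw [e2]

theorem j_prim (h : IsRegSol G j B T Y₀ z₀ z Z) {t : ℝ} (ht : t ∈ Icc 0 T) :
    j (prim Y₀ Z t) = j Y₀ + ∫ s in (0 : ℝ)..t, z s := by
  have hT := ht.1.trans ht.2
  rw [prim, map_add, ← j.intervalIntegral_comp_comm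
    ((intervalIntegrable_of_memLp hT h.memLp).mono_Icc ht)]
  congr 1
  rw [intervalIntegral_eq_Ioo ht.1, intervalIntegral_eq_Ioo ht.1]
  exact integral_congr_ae (ae_restrict_of_ae_restrict_of_subset (Ioo_subset_Ioo_right ht.2) h.lift)

/-- The time derivative `z` of a regular solution `y` is `A y - B(y, y)`. -/
theorem mem (h : IsRegSol G j B T Y₀ z₀ z Z) (hB : Convection j Q K B)
    (h0 : (j Y₀, z₀ + B Y₀ Y₀) ∈ G) {t : ℝ} (ht : t ∈ Icc 0 T) :
    (j (prim Y₀ Z t), z t + B (prim Y₀ Z t) (prim Y₀ Z t)) ∈ G := by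
  have hT := ht.1.trans ht.2
  have hZ := (intervalIntegrable_of_memLp hT h.memLp).mono_Icc ht
  -- Product rule in time: by symmetry the derivative of `B(y, y)` is `2 B(y, Z)`. This cancels the
  -- source in the integrated equation for `z`.
  have e : B (prim Y₀ Z t) (prim Y₀ Z t)
      = B Y₀ Y₀ + ∫ s in (0 : ℝ)..t, (2 : ℝ) • B (prim Y₀ Z s) (Z s) := by
    have h1 := bilin_primitive B ht.1 (u := prim Y₀ Z) (w := prim Y₀ Z) hZ hZ
      (by simp [prim]) (by simp [prim])
    have h2 : prim Y₀ Z 0 = Y₀ := by simp [prim]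
    rw [h1, h2]
    congr 1
    refine intervalIntegral.integral_congr fun s _ => ?_
    rw [hB.symm (Z s), two_smul]
  refine graph_mem_of_eq (G.add_mem h0 (h.sol.mem t ht)) (h.j_prim ht).symm ?_
  simp only [Prod.snd_add]
  rw [e, intervalIntegral.integral_neg]
  abel

/-- Integrate the pointwise equation of `mem` in time. -/
theorem isNLSol (h : IsRegSol G j B T Y₀ z₀ z Z) (hG : MaxDissipative G) (hB : Convection j Q K B)
    (hT : 0 ≤ T) (h0 : (j Y₀, z₀ + B Y₀ Y₀) ∈ G) :
    IsNLSol G j B T (j Y₀) (fun t => j (prim Y₀ Z t)) (prim Y₀ Z) := by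
  have hc := continuousOn_prim hT h.memLp Y₀
  have hcz := h.sol.cont
  have hc1 : ContinuousOn (fun t => j (prim Y₀ Z t)) (Icc 0 T) := by fun_prop
  have hc2 : ContinuousOn (fun t => B (prim Y₀ Z t) (prim Y₀ Z t)) (Icc 0 T) := by fun_prop
  refine ⟨⟨hc1, fun t ht => ?_⟩, memLp_of_continuousOn hc, ae_of_all _ fun _ => rfl⟩
  have hsub : Icc 0 t ⊆ Icc 0 T := Icc_subset_Icc_right ht.2
  have i1 := (hc1.mono hsub).intervalIntegrable_of_Icc (μ := volume) ht.1
  have i2 := (hc2.mono hsub).intervalIntegrable_of_Icc (μ := volume) ht.1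
  have i3 := (hcz.mono hsub).intervalIntegrable_of_Icc (μ := volume) ht.1
  have h1 := hG.integral_mem ht.1 i1 (i3.add i2)
    fun s hs => h.mem hB h0 (hsub (Ioc_subset_Icc_self hs))
  refine graph_mem_of_eq h1 rfl ?_
  simp only
  rw [intervalIntegral.integral_add i3 i2, intervalIntegral.integral_neg, h.j_prim ht]
  abel

/-- The constant in the estimate of the time derivative. -/
def const (Q : H →L[ℝ] H) (K : ℝ) (B : V →L[ℝ] V →L[ℝ] H) (T R : ℝ) : ℝ :=
  (1 + ‖Q‖) * Real.exp (2 * K * T + (1 + ‖Q‖) ^ 2 * (4 * ‖B‖ ^ 2 *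
    ((‖Q‖ + 2 * K * T + K ^ 2 * T * R ^ 2) * R ^ 2)))

theorem const_pos (Q : H →L[ℝ] H) (K : ℝ) (B : V →L[ℝ] V →L[ℝ] H) (T R : ℝ) : 0 < const Q K B T R := by
  have := norm_nonneg Q
  unfold const
  positivity

/-- For given `y` the equation for `z` is linear, so `gronwall_bound` applies with `κ = 2 ‖B‖
‖y‖_V`. The integral of `κ²` is controlled by `integral_le`, that is, by `‖j Y₀‖` alone. The
constant is taken at a later time `T'` so that it stays fixed during continuation. -/
theorem bound (h : IsRegSol G j B T Y₀ z₀ z Z) (hF : Frame G j Q K) (hB : Convection j Q K B)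
    (hT : 0 ≤ T) {T' : ℝ} (hTT' : T ≤ T') (h0 : (j Y₀, z₀ + B Y₀ Y₀) ∈ G)
    {t : ℝ} (ht : t ∈ Icc 0 T) :
    ‖z t‖ ^ 2 + ∫ s in (0 : ℝ)..t, ‖Z s‖ ^ 2 ≤ const Q K B T' ‖j Y₀‖ * ‖z₀‖ ^ 2 := by
  have hK := hF.K_nonneg
  have hY := h.isNLSol hF.max hB hT h0
  have key := hF.gronwall_bound hT h.sol (intervalIntegrable_regSource hT h.memLp _) h.memLp h.lift
    (κ := fun s => 2 * ‖B‖ * ‖prim Y₀ Z s‖) (by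
      simp_rw [mul_pow]
      exact (integrable_norm_sq hY.memLp).const_mul _) (ae_of_all _ fun s => by
      rw [norm_neg, norm_smul, Real.norm_ofNat, mul_assoc, mul_assoc]
      have := B.le_opNorm₂ (prim Y₀ Z s) (Z s)
      linarith) ht
  refine key.trans ?_
  have h1 := hY.integral_le hF hB hT
  simp_rw [mul_pow]
  rw [intervalIntegral.integral_const_mul, const]
  have h2 : (2 : ℝ) ^ 2 * ‖B‖ ^ 2 * (∫ s in (0 : ℝ)..T, ‖prim Y₀ Z s‖ ^ 2)
      ≤ 4 * ‖B‖ ^ 2 * ((‖Q‖ + 2 * K * T' + K ^ 2 * T' * ‖j Y₀‖ ^ 2) * ‖j Y₀‖ ^ 2) := by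
    norm_num
    gcongr
    refine h1.trans ?_
    gcongr
  rw [mul_right_comm]
  gcongr

end IsRegSol

end KdV

/-! ### Local and global existence of regular solutions -/

namespace KdV

set_option linter.unusedSectionVars false

variable {H : Type} [NormedAddCommGroup H] [InnerProductSpace ℝ H] [CompleteSpace H]
  {V : Type*} [NormedAddCommGroup V] [NormedSpace ℝ V] [CompleteSpace V]
  {G : Submodule ℝ (H × H)} {j : V →L[ℝ] H} {Q : H →L[ℝ] H} {K : ℝ} {B : V →L[ℝ] V →L[ℝ] H}
  {T : ℝ}

/-- The source in the equation for the time derivative of a solution. -/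
def regSource (B : V →L[ℝ] V →L[ℝ] H) (Y₀ : V) (Z : ℝ → V) (t : ℝ) : H :=
  -((2 : ℝ) • B (prim Y₀ Z t) (Z t))

/-- Split the difference as `B(y, Z - Z') + B(y - y', Z')`, up to the factor `-2`. Every term gains
a factor `√T`, from the passage from `L²` to `L¹` in time. -/
theorem integral_regSource_sub_le (hT : 0 ≤ T) {Y₀ : V} {M ρ : ℝ} (hY₀ : ‖Y₀‖ ≤ M)
    {Z Z' : Lp V 2 (volume.restrict (Ioo 0 T))} (hZ : ‖Z‖ ≤ ρ) (hZ' : ‖Z'‖ ≤ ρ) :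
    ∫ s in (0 : ℝ)..T, ‖regSource B Y₀ Z s - regSource B Y₀ Z' s‖
      ≤ 2 * ‖B‖ * (M + 2 * (√T * ρ)) * √T * ‖Z - Z'‖ := by
  have hm := Lp.memLp Z
  have hm' := Lp.memLp Z'
  have iZ := intervalIntegrable_of_memLp hT hm
  have iZ' := intervalIntegrable_of_memLp hT hm'
  have nrm : ∀ W : Lp V 2 (volume.restrict (Ioo 0 T)), √(∫ s in (0 : ℝ)..T, ‖W s‖ ^ 2) = ‖W‖ := by
    intro W
    rw [intervalIntegral_eq_Ioo hT, ← norm_Lp_sq, Real.sqrt_sq (norm_nonneg _)]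
  have hsub : ∀ᵐ t ∂(volume.restrict (Ioo 0 T)), (Z - Z' : Lp V 2 (volume.restrict (Ioo 0 T))) t
      = Z t - Z' t := Lp.coeFn_sub Z Z'
  have hb : ∀ s ∈ Icc 0 T, ‖prim Y₀ Z s‖ ≤ M + √T * ρ := by
    intro s hs
    refine (norm_add_le _ _).trans (add_le_add hY₀ ?_)
    refine (norm_integral_le_sqrt hs hm).trans ?_
    rw [nrm]
    gcongr
  have hd : ∀ s ∈ Icc 0 T, ‖prim Y₀ Z s - prim Y₀ Z' s‖ ≤ √T * ‖Z - Z'‖ := by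
    intro s hs
    have e : prim Y₀ Z s - prim Y₀ Z' s
        = ∫ r in (0 : ℝ)..s, (Z - Z' : Lp V 2 (volume.restrict (Ioo 0 T))) r := by
      rw [prim, prim, add_sub_add_left_eq_sub,
        ← intervalIntegral.integral_sub (iZ.mono_Icc hs) (iZ'.mono_Icc hs),
        intervalIntegral_eq_Ioo hs.1, intervalIntegral_eq_Ioo hs.1]
      refine integral_congr_ae ?_
      filter_upwards [ae_restrict_of_ae_restrict_of_subset (Ioo_subset_Ioo_right hs.2) hsub] with r hr
      rw [hr]
    rw [e, ← nrm]
    exact norm_integral_le_sqrt hs (Lp.memLp _)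
  have hρ : 0 ≤ ρ := (norm_nonneg _).trans hZ
  have hM : 0 ≤ M := (norm_nonneg _).trans hY₀
  have i1 : IntervalIntegrable (fun s => ‖regSource B Y₀ Z s - regSource B Y₀ Z' s‖) volume 0 T :=
    ((intervalIntegrable_regSource hT hm Y₀).sub (intervalIntegrable_regSource hT hm' Y₀)).norm
  have i2 := (intervalIntegrable_of_memLp hT (Lp.memLp (Z - Z'))).norm
  calc ∫ s in (0 : ℝ)..T, ‖regSource B Y₀ Z s - regSource B Y₀ Z' s‖
      ≤ ∫ s in (0 : ℝ)..T, (2 * ‖B‖ * (M + √T * ρ) * ‖(Z - Z' : Lp V 2 (volume.restrict (Ioo 0 T))) s‖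
        + 2 * ‖B‖ * (√T * ‖Z - Z'‖) * ‖Z' s‖) := by
        rw [intervalIntegral_eq_Ioo hT, intervalIntegral_eq_Ioo hT]
        refine integral_mono_ae ((intervalIntegrable_iff_integrableOn_Ioo_of_le hT).1 i1)
          ((intervalIntegrable_iff_integrableOn_Ioo_of_le hT).1 ((i2.const_mul _).add
            (iZ'.norm.const_mul _))) ?_
        filter_upwards [hsub, ae_restrict_mem measurableSet_Ioo] with s hs hs'
        have e : regSource B Y₀ Z s - regSource B Y₀ Z' s
            = -((2 : ℝ) • (B (prim Y₀ Z s) (Z s - Z' s) + B (prim Y₀ Z s - prim Y₀ Z' s) (Z' s))) := by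
          simp only [regSource, map_sub, sub_apply, smul_add, smul_sub]
          abel
        rw [e, norm_neg, norm_smul, Real.norm_ofNat, hs]
        have a1 := B.le_opNorm₂ (prim Y₀ Z s) (Z s - Z' s)
        have a2 := B.le_opNorm₂ (prim Y₀ Z s - prim Y₀ Z' s) (Z' s)
        have a3 := hb s (Ioo_subset_Icc_self hs')
        have a4 := hd s (Ioo_subset_Icc_self hs')
        have a5 : ‖B‖ * ‖prim Y₀ Z s‖ * ‖Z s - Z' s‖ ≤ ‖B‖ * (M + √T * ρ) * ‖Z s - Z' s‖ := by gcongr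
        have a6 : ‖B‖ * ‖prim Y₀ Z s - prim Y₀ Z' s‖ * ‖Z' s‖ ≤ ‖B‖ * (√T * ‖Z - Z'‖) * ‖Z' s‖ := by
          gcongr
        have a7 := norm_add_le (B (prim Y₀ Z s) (Z s - Z' s)) (B (prim Y₀ Z s - prim Y₀ Z' s) (Z' s))
        linarith
    _ = 2 * ‖B‖ * (M + √T * ρ) * (∫ s in (0 : ℝ)..T, ‖(Z - Z' : Lp V 2 (volume.restrict (Ioo 0 T))) s‖)
        + 2 * ‖B‖ * (√T * ‖Z - Z'‖) * ∫ s in (0 : ℝ)..T, ‖Z' s‖ := by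
        rw [intervalIntegral.integral_add (i2.const_mul _) (iZ'.norm.const_mul _),
          intervalIntegral.integral_const_mul, intervalIntegral.integral_const_mul]
    _ ≤ 2 * ‖B‖ * (M + √T * ρ) * (√T * ‖Z - Z'‖) + 2 * ‖B‖ * (√T * ‖Z - Z'‖) * (√T * ρ) := by
        have b1 := integral_norm_le_sqrt hT (Lp.memLp (Z - Z'))
        have b2 := integral_norm_le_sqrt hT hm'
        rw [nrm] at b1 b2
        have b3 : √T * ‖Z'‖ ≤ √T * ρ := by gcongr
        gcongr
        exact b2.trans b3
    _ = _ := by ring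

theorem regSource_zero (Y₀ : V) :
    ∀ᵐ t ∂(volume.restrict (Ioo 0 T)),
      regSource B Y₀ (0 : Lp V 2 (volume.restrict (Ioo 0 T))) t = 0 := by
  filter_upwards [Lp.coeFn_zero V 2 (volume.restrict (Ioo 0 T))] with t ht
  rw [regSource, ht]
  simp

/-- Local existence of regular solutions. -/
theorem Frame.exists_local_regSol (hF : Frame G j Q K) {M : ℝ} (hM : 0 ≤ M) :
    ∃ τ > 0, ∀ (Y₀ : V) (z₀ : H), ‖Y₀‖ ≤ M → ‖z₀‖ ≤ M → ∃ z Z, IsRegSol G j B τ Y₀ z₀ z Z := by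
  have hK := hF.K_nonneg
  -- `c` bounds the linear solution operator on intervals of length at most `1`. The radius `ρ` then
  -- exceeds the bound `c M` on the image of `0` by `1`.
  set c := √(‖Q‖ + K) with hc
  set ρ := c * M + 1 with hρ
  have hρ0 : 0 ≤ ρ := by positivity
  -- With `σ = 1 / D` and `τ = σ²`, so that `√τ = σ`, the Lipschitz constant `4 c ‖B‖ (M + 2 σ ρ) σ`
  -- on the ball is at most `1 / 2`. The extra factor `1 + ρ` keeps the ball invariant.
  set D := 1 + 8 * c * ‖B‖ * (M + 2 * ρ) * (1 + ρ) with hD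
  have hD0 : 1 ≤ D := by
    have : 0 ≤ 8 * c * ‖B‖ * (M + 2 * ρ) * (1 + ρ) := by positivity
    linarith
  set σ := D⁻¹ with hσ
  have hσ0 : 0 < σ := by positivity
  have hσ1 : σ ≤ 1 := inv_le_one_of_one_le₀ hD0
  have hσD : 8 * c * ‖B‖ * (M + 2 * ρ) * (1 + ρ) * σ ≤ 1 := by
    have : D * σ = 1 := mul_inv_cancel₀ (by positivity)
    nlinarith
  refine ⟨σ ^ 2, by positivity, fun Y₀ z₀ hY₀ hz₀ => ?_⟩
  have hT : (0 : ℝ) ≤ σ ^ 2 := by positivity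
  have hsq : √(σ ^ 2) = σ := Real.sqrt_sq hσ0.le
  set μ := volume.restrict (Ioo (0 : ℝ) (σ ^ 2)) with hμ
  have hint : ∀ Z : Lp V 2 μ, IntervalIntegrable (regSource B Y₀ Z) volume 0 (σ ^ 2) := fun Z =>
    intervalIntegrable_regSource hT (Lp.memLp Z) Y₀
  choose z hz using fun Z : Lp V 2 μ => hF.exists_intSol hT z₀ (hint Z)
  choose U hU hjU using fun Z : Lp V 2 μ => hF.exists_lift hT (hz Z) (hint Z)
  -- `Φ Z` is the lift to `V` of the linear solution whose source is built from `Z`; a fixed point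
  -- solves the equation.
  set Φ : Lp V 2 μ → Lp V 2 μ := fun Z => (hU Z).toLp (U Z) with hΦ
  have hCle : ‖Q‖ + K * σ ^ 2 ≤ c ^ 2 := by
    rw [hc, Real.sq_sqrt (by positivity)]
    have : K * σ ^ 2 ≤ K * 1 := by gcongr; nlinarith
    linarith
  have hlip : ∀ Z Z' : Lp V 2 μ, ‖Z‖ ≤ ρ → ‖Z'‖ ≤ ρ → ‖Φ Z - Φ Z'‖
      ≤ c * (2 * (2 * ‖B‖ * (M + 2 * (σ * ρ)) * σ * ‖Z - Z'‖)) := by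
    intro Z Z' h1 h2
    have hs := (hz Z).sub (hz Z') (hint Z) (hint Z')
    rw [sub_self] at hs
    have h3 := (hF.linear_bound hT hs ((hint Z).sub (hint Z')) (U := fun t => U Z t - U Z' t) (by
      filter_upwards [hjU Z, hjU Z'] with t e1 e2
      rw [map_sub, e1, e2])).2
    have h4 := integral_regSource_sub_le (B := B) hT hY₀ h1 h2
    rw [hsq] at h4
    have e : ‖Φ Z - Φ Z'‖ ^ 2 = ∫ s in (0 : ℝ)..(σ ^ 2), ‖U Z s - U Z' s‖ ^ 2 := by
      rw [hΦ, ← MemLp.toLp_sub, norm_toLp_sq ((hU Z).sub (hU Z')), intervalIntegral_eq_Ioo hT]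
      rfl
    rw [norm_zero, zero_add] at h3
    have h0 : 0 ≤ ∫ s in (0 : ℝ)..(σ ^ 2), ‖regSource B Y₀ Z s - regSource B Y₀ Z' s‖ :=
      intervalIntegral.integral_nonneg hT fun _ _ => norm_nonneg _
    refine le_of_sq_le_sq ?_ (by positivity)
    rw [e, mul_pow]
    refine h3.trans ?_
    gcongr
  have hcontr : ∀ Z Z' : Lp V 2 μ, ‖Z‖ ≤ ρ → ‖Z'‖ ≤ ρ → ‖Φ Z - Φ Z'‖ ≤ 1 / 2 * ‖Z - Z'‖ := by
    intro Z Z' h1 h2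
    refine (hlip Z Z' h1 h2).trans ?_
    have h3 : c * (2 * (2 * ‖B‖ * (M + 2 * (σ * ρ)) * σ * ‖Z - Z'‖))
        = (4 * c * ‖B‖ * (M + 2 * (σ * ρ)) * σ) * ‖Z - Z'‖ := by ring
    rw [h3]
    gcongr
    have h4 : 4 * c * ‖B‖ * (M + 2 * (σ * ρ)) * σ ≤ 4 * c * ‖B‖ * (M + 2 * (1 * ρ)) * σ := by gcongr
    have h5 : 4 * c * ‖B‖ * (M + 2 * (1 * ρ)) * σ ≤ 4 * c * ‖B‖ * (M + 2 * ρ) * (1 + ρ) * σ := by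
      have : 0 ≤ 4 * c * ‖B‖ * (M + 2 * ρ) * ρ * σ := by positivity
      linarith
    linarith
  have hzero : ‖Φ 0‖ ≤ c * M := by
    have h3 := (hF.linear_bound hT (hz 0) (hint 0) (hjU 0)).2
    have h4 : ∫ s in (0 : ℝ)..(σ ^ 2), ‖regSource B Y₀ (0 : Lp V 2 μ) s‖ = 0 := by
      rw [intervalIntegral_eq_Ioo hT]
      refine integral_eq_zero_of_ae ?_
      filter_upwards [regSource_zero (B := B) Y₀] with t ht
      rw [ht, norm_zero, Pi.zero_apply]
    have e : ‖Φ 0‖ ^ 2 = ∫ s in (0 : ℝ)..(σ ^ 2), ‖U 0 s‖ ^ 2 := by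
      rw [hΦ, norm_toLp_sq, intervalIntegral_eq_Ioo hT]
    refine le_of_sq_le_sq ?_ (by positivity)
    rw [e, mul_pow]
    refine h3.trans ?_
    rw [h4, mul_zero, add_zero]
    gcongr
  have hmaps : MapsTo Φ (Metric.closedBall 0 ρ) (Metric.closedBall 0 ρ) := by
    intro Z hZ
    rw [mem_closedBall_zero_iff] at hZ ⊢
    have h1 := hlip Z 0 hZ (by simpa using hρ0)
    rw [sub_zero] at h1
    have h2 : c * (2 * (2 * ‖B‖ * (M + 2 * (σ * ρ)) * σ * ‖Z‖)) ≤ 1 := by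
      have h4 : c * (2 * (2 * ‖B‖ * (M + 2 * (σ * ρ)) * σ * ‖Z‖))
          ≤ c * (2 * (2 * ‖B‖ * (M + 2 * (1 * ρ)) * σ * (1 + ρ))) := by gcongr; linarith
      have h5 : 0 ≤ 4 * c * ‖B‖ * (M + 2 * ρ) * (1 + ρ) * σ := by positivity
      linarith
    have h3 : ‖Φ Z‖ ≤ ‖Φ Z - Φ 0‖ + ‖Φ 0‖ := by
      simpa using norm_add_le (Φ Z - Φ 0) (Φ 0)
    linarith
  have hcw : ContractingWith (1 / 2) (hmaps.restrict Φ _ _) := by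
    refine ⟨by
      rw [← NNReal.coe_lt_coe]
      norm_num, LipschitzWith.of_dist_le_mul fun Z Z' => ?_⟩
    have h1 := Z.2
    have h2 := Z'.2
    rw [mem_closedBall_zero_iff] at h1 h2
    simp only [Subtype.dist_eq, MapsTo.val_restrict_apply, dist_eq_norm]
    simpa using hcontr Z Z' h1 h2
  obtain ⟨Z, -, hZ, -⟩ := hcw.exists_fixedPoint' Metric.isClosed_closedBall.isComplete hmaps
    (x := 0) (by simpa using hρ0) (edist_ne_top _ _)
  refine ⟨z Z, Z, hz Z, Lp.memLp Z, ?_⟩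
  have h1 : ∀ᵐ t ∂μ, U Z t = Z t := by
    have := (hU Z).coeFn_toLp
    have e : (hU Z).toLp (U Z) = Z := hZ
    rw [e] at this
    filter_upwards [this] with t ht using ht.symm
  filter_upwards [h1, hjU Z] with t e1 e2
  rw [← e1, e2]

/-- Global existence of regular solutions. -/
theorem Frame.exists_regSol (hF : Frame G j Q K) (hB : Convection j Q K B) (hT : 0 ≤ T) {Y₀ : V}
    {z₀ : H} (h0 : (j Y₀, z₀ + B Y₀ Y₀) ∈ G) : ∃ z Z, IsRegSol G j B T Y₀ z₀ z Z := by
  set C := IsRegSol.const Q K B T ‖j Y₀‖ with hC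
  have hC0 : 0 < C := IsRegSol.const_pos _ _ _ _ _
  -- By `IsRegSol.bound`, `m` bounds both `‖z‖` and the `L²` norm of `Z` on every interval reached.
  -- So `M` bounds the data at each restart, and the length `τ` of the steps is uniform.
  set m := √(C * ‖z₀‖ ^ 2) with hm
  set M := ‖Y₀‖ + √T * m + m with hM
  have hM0 : 0 ≤ M := by positivity
  obtain ⟨τ, hτ, hloc⟩ := hF.exists_local_regSol (B := B) hM0
  have key : ∀ n : ℕ, ∃ z Z, IsRegSol G j B (min (n * τ) T) Y₀ z₀ z Z := by
    intro n
    induction n with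
    -- The interval degenerates to a point; a solution there is the restriction of any local
    -- solution.
    | zero =>
      obtain ⟨ε, hε, hl⟩ := hF.exists_local_regSol (B := B) (M := ‖Y₀‖ + ‖z₀‖) (by positivity)
      obtain ⟨z, Z, h⟩ := hl Y₀ z₀ (by linarith [norm_nonneg z₀]) (by linarith [norm_nonneg Y₀])
      refine ⟨z, Z, h.mono ?_⟩
      simp only [Nat.cast_zero, zero_mul]
      exact (min_le_left _ _).trans hε.le
    | succ n ih =>
      obtain ⟨z, Z, h⟩ := ih
      set a := min ((n : ℝ) * τ) T with ha
      have ha0 : 0 ≤ a := le_min (by positivity) hT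
      have haT : a ≤ T := min_le_right _ _
      have hb1 := h.bound hF hB ha0 haT h0 (right_mem_Icc.2 ha0)
      have hZ0 : 0 ≤ ∫ s in (0 : ℝ)..a, ‖Z s‖ ^ 2 :=
        intervalIntegral.integral_nonneg ha0 fun _ _ => by positivity
      have hza : ‖z a‖ ≤ m := by
        refine Real.le_sqrt_of_sq_le ?_
        linarith
      have hYa : ‖prim Y₀ Z a‖ ≤ ‖Y₀‖ + √T * m := by
        refine (norm_add_le _ _).trans (add_le_add le_rfl ?_)
        refine (norm_integral_le_sqrt (right_mem_Icc.2 ha0) h.memLp).trans ?_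
        gcongr
        exact Real.sqrt_le_sqrt (by nlinarith [sq_nonneg ‖z a‖])
      have hm0 : 0 ≤ m := Real.sqrt_nonneg _
      obtain ⟨z', Z', h'⟩ := hloc (prim Y₀ Z a) (z a) (by linarith) (by
        have : 0 ≤ ‖Y₀‖ + √T * m := by positivity
        linarith)
      set a' := min (((n + 1 : ℕ) : ℝ) * τ) T with ha'
      have h1 : a ≤ a' := by
        refine min_le_min_right T ?_
        push_cast
        nlinarith
      have h2 : a' - a ≤ τ := by
        rw [ha, ha']
        push_cast
        rcases le_total ((n : ℝ) * τ) T with h3 | h3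
        · rw [min_eq_left h3]
          have := min_le_left (((n : ℝ) + 1) * τ) T
          linarith
        · rw [min_eq_right h3]
          have := min_le_right (((n : ℝ) + 1) * τ) T
          linarith
      have h3 := IsRegSol.glue hF.max ha0 (sub_nonneg.2 h1) h (h'.mono h2)
      rw [add_sub_cancel] at h3
      exact ⟨_, _, h3⟩
  obtain ⟨n, hn⟩ := exists_nat_ge (T / τ)
  have := key n
  rwa [min_eq_right ((div_le_iff₀ hτ).1 hn)] at this

end KdV

/-! ### Existence for rough data; the linear estimate for regular data -/

namespace KdV

set_option linter.unusedSectionVars false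

variable {H : Type} [NormedAddCommGroup H] [InnerProductSpace ℝ H] [CompleteSpace H]
  {V : Type*} [NormedAddCommGroup V] [NormedSpace ℝ V] [CompleteSpace V]
  {G : Submodule ℝ (H × H)} {j : V →L[ℝ] H} {Q : H →L[ℝ] H} {K : ℝ} {B : V →L[ℝ] V →L[ℝ] H}
  {T : ℝ}

theorem cauchySeq_of_norm_sub_le {E F : Type*} [NormedAddCommGroup E] [NormedAddCommGroup F]
    {x : ℕ → E} {w : ℕ → F} {c : ℝ} (hc : 0 ≤ c) (hw : CauchySeq w)
    (h : ∀ n m, ‖x n - x m‖ ≤ c * ‖w n - w m‖) : CauchySeq x := by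
  rw [Metric.cauchySeq_iff] at hw ⊢
  intro ε hε
  obtain ⟨N, hN⟩ := hw (ε / (c + 1)) (by positivity)
  refine ⟨N, fun n hn m hm => ?_⟩
  have h1 := hN n hn m hm
  rw [dist_eq_norm, lt_div_iff₀ (by positivity)] at h1
  rw [dist_eq_norm]
  nlinarith [norm_nonneg (w n - w m), h n m]

theorem MaxDissipative.isClosed (hG : MaxDissipative G) : IsClosed (G : Set (H × H)) := by
  have : (G : Set (H × H)) = {p | hG.res 0 (p.1 - p.2) = p.1} := by
    ext ⟨u, v⟩
    exact hG.mem_iff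
  rw [this]
  exact isClosed_eq (by fun_prop) continuous_fst

/-- With `E = Y n - Y'` the sources differ by `-(B(E, E) + 2 B(E, Y'))`; Cauchy–Schwarz in time
concludes. -/
theorem tendsto_integral_bilin {t : ℝ} (ht : t ∈ Icc 0 T) (hB : ∀ U W, B U W = B W U)
    {Y : ℕ → ℝ → V} {Y' : ℝ → V} (hY : ∀ n, MemLp (Y n) 2 (volume.restrict (Ioo 0 T)))
    (hY' : MemLp Y' 2 (volume.restrict (Ioo 0 T)))
    (h : Tendsto (fun n => ∫ s in Ioo 0 T, ‖Y n s - Y' s‖ ^ 2) atTop (𝓝 0)) :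
    Tendsto (fun n => ∫ s in (0 : ℝ)..t, -B (Y n s) (Y n s)) atTop
      (𝓝 (∫ s in (0 : ℝ)..t, -B (Y' s) (Y' s))) := by
  rw [tendsto_iff_norm_sub_tendsto_zero]
  set e : ℕ → ℝ := fun n => √(∫ s in Ioo 0 T, ‖Y n s - Y' s‖ ^ 2) with he
  have he0 : Tendsto e atTop (𝓝 0) := by simpa using h.sqrt
  set N := √(∫ s in Ioo 0 T, ‖Y' s‖ ^ 2) with hN
  refine squeeze_zero (g := fun n => ‖B‖ * (e n * e n + 2 * (e n * N))) (fun _ => norm_nonneg _)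
    (fun n => ?_) (by simpa using ((he0.mul he0).add ((he0.mul_const N).const_mul 2)).const_mul ‖B‖)
  have hd : MemLp (fun s => Y n s - Y' s) 2 (volume.restrict (Ioo 0 T)) := (hY n).sub hY'
  have i1 := integral_norm_mul_le hd hd
  have i2 := integral_norm_mul_le hd hY'
  have j1 : Integrable (fun s => -B (Y n s) (Y n s)) (volume.restrict (Ioo 0 T)) :=
    (integrable_bilin B (hY n) (hY n)).neg
  have j2 : Integrable (fun s => -B (Y' s) (Y' s)) (volume.restrict (Ioo 0 T)) :=
    (integrable_bilin B hY' hY').neg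
  have hT := ht.1.trans ht.2
  rw [← intervalIntegral.integral_sub ((intervalIntegrable_of_Ioo hT j1).mono_Icc ht)
    ((intervalIntegrable_of_Ioo hT j2).mono_Icc ht)]
  refine (intervalIntegral.norm_integral_le_integral_norm ht.1).trans ?_
  have hle : ∫ s in (0 : ℝ)..t, ‖-B (Y n s) (Y n s) - -B (Y' s) (Y' s)‖
      ≤ ∫ s in Ioo 0 T, ‖-B (Y n s) (Y n s) - -B (Y' s) (Y' s)‖ := by
    rw [intervalIntegral_eq_Ioo ht.1]
    exact setIntegral_mono_set (j1.sub j2).norm (ae_of_all _ fun _ => norm_nonneg _)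
      (Ioo_subset_Ioo_right ht.2).eventuallyLE
  refine hle.trans ?_
  calc _ ≤ ∫ s in Ioo 0 T, ‖B‖ * (‖Y n s - Y' s‖ * ‖Y n s - Y' s‖
        + 2 * (‖Y n s - Y' s‖ * ‖Y' s‖)) := by
        refine integral_mono (j1.sub j2).norm ((i1.1.add (i2.1.const_mul 2)).const_mul _) fun s => ?_
        have e1 : -B (Y n s) (Y n s) - -B (Y' s) (Y' s)
            = -(B (Y n s - Y' s) (Y n s - Y' s) + (2 : ℝ) • B (Y n s - Y' s) (Y' s)) := by
          simp only [map_sub, sub_apply, two_smul, hB (Y' s) (Y n s)]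
          abel
        simp only
        rw [e1, norm_neg]
        have a1 := norm_add_le (B (Y n s - Y' s) (Y n s - Y' s)) ((2 : ℝ) • B (Y n s - Y' s) (Y' s))
        have a2 := B.le_opNorm₂ (Y n s - Y' s) (Y n s - Y' s)
        have a3 := B.le_opNorm₂ (Y n s - Y' s) (Y' s)
        rw [norm_smul, Real.norm_ofNat] at a1
        linarith
    _ = ‖B‖ * ((∫ s in Ioo 0 T, ‖Y n s - Y' s‖ * ‖Y n s - Y' s‖)
        + 2 * ∫ s in Ioo 0 T, ‖Y n s - Y' s‖ * ‖Y' s‖) := by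
        rw [integral_const_mul, integral_add i1.1 (i2.1.const_mul 2), integral_const_mul]
    _ ≤ _ := by
        have b1 := i1.2
        have b2 := i2.2
        simp only [he, hN]
        gcongr

/-- Existence of solutions for all initial data in `H`. -/
theorem Frame.exists_nlSol (hF : Frame G j Q K) (hB : Convection j Q K B) (hT : 0 ≤ T) (y₀ : H) :
    ∃ y Y, IsNLSol G j B T y₀ y Y := by
  have hex : ∀ n, ∃ y Y, IsNLSol G j B T (hF.max.J n y₀) y Y := by
    intro n
    -- The datum `J_n y₀` lies in the domain, and its initial time derivative `A_n y₀ - B(J_n y₀,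
    -- J_n y₀)` is dictated by the equation.
    have hm : (j (hF.JV n y₀), (hF.max.yosida n y₀ - B (hF.JV n y₀) (hF.JV n y₀))
        + B (hF.JV n y₀) (hF.JV n y₀)) ∈ G := by
      rw [sub_add_cancel, hF.j_JV]
      exact hF.max.J_mem n y₀
    obtain ⟨z, Z, h⟩ := hF.exists_regSol hB hT hm
    have := h.isNLSol hF.max hB hT hm
    rw [hF.j_JV] at this
    exact ⟨_, _, this⟩
  choose y Y h using hex
  set c := (1 + ‖Q‖) * Real.exp (2 * K * T + (1 + ‖Q‖) ^ 2 * (‖B‖ ^ 2 *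
        (4 * ((‖Q‖ + 2 * K * T + K ^ 2 * T * ‖y₀‖ ^ 2) * ‖y₀‖ ^ 2)))) with hc
  have hc0 : 0 ≤ c := by positivity
  have hJc := (hF.max.tendsto_J y₀).cauchySeq
  have hdiff : ∀ n m, ∀ t ∈ Icc 0 T, ‖y n t - y m t‖ ^ 2 + ∫ s in (0 : ℝ)..t, ‖Y n s - Y m s‖ ^ 2
      ≤ c * ‖hF.max.J n y₀ - hF.max.J m y₀‖ ^ 2 := by
    intro n m t ht
    have := (h n).sub_le (h m) hF hB hT (hF.max.norm_J_le n y₀) (hF.max.norm_J_le m y₀) ht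
    rw [mul_right_comm] at this
    exact this
  have hd1 : ∀ n m, ∀ t ∈ Icc 0 T, ‖y n t - y m t‖ ≤ √c * ‖hF.max.J n y₀ - hF.max.J m y₀‖ := by
    intro n m t ht
    have h0 : 0 ≤ ∫ s in (0 : ℝ)..t, ‖Y n s - Y m s‖ ^ 2 :=
      intervalIntegral.integral_nonneg ht.1 fun _ _ => by positivity
    refine le_of_sq_le_sq ?_ (by positivity)
    rw [mul_pow, Real.sq_sqrt hc0]
    linarith [hdiff n m t ht]
  set W : ℕ → Lp V 2 (volume.restrict (Ioo 0 T)) := fun n => (h n).memLp.toLp (Y n) with hW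
  have hd2 : ∀ n m, ‖W n - W m‖ ≤ √c * ‖hF.max.J n y₀ - hF.max.J m y₀‖ := by
    intro n m
    refine le_of_sq_le_sq ?_ (by positivity)
    rw [mul_pow, Real.sq_sqrt hc0, hW, ← MemLp.toLp_sub, norm_toLp_sq ((h n).memLp.sub (h m).memLp)]
    have := hdiff n m T (right_mem_Icc.2 hT)
    rw [intervalIntegral_eq_Ioo hT] at this
    simp only [Pi.sub_apply]
    linarith [sq_nonneg ‖y n T - y m T‖]
  have hWc : CauchySeq W := cauchySeq_of_norm_sub_le (Real.sqrt_nonneg c) hJc hd2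
  obtain ⟨Y', hY'⟩ := cauchySeq_tendsto_of_complete hWc
  have hlim : ∀ t, ∃ x, t ∈ Icc 0 T → Tendsto (fun n => y n t) atTop (𝓝 x) := by
    intro t
    by_cases ht : t ∈ Icc 0 T
    · obtain ⟨x, hx⟩ := cauchySeq_tendsto_of_complete 
        (cauchySeq_of_norm_sub_le (Real.sqrt_nonneg c) hJc fun n m => hd1 n m t ht)
      exact ⟨x, fun _ => hx⟩
    · exact ⟨0, fun h => absurd h ht⟩
  choose y' hy' using hlim
  have hunif : ∀ n, ∀ t ∈ Icc 0 T, ‖y n t - y' t‖ ≤ √c * ‖hF.max.J n y₀ - y₀‖ := by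
    intro n t ht
    exact le_of_tendsto_of_tendsto' ((hy' t ht).const_sub (y n t)).norm
      (((hF.max.tendsto_J y₀).const_sub (hF.max.J n y₀)).norm.const_mul _) fun m => hd1 n m t ht
  have hδ : Tendsto (fun n => √c * ‖hF.max.J n y₀ - y₀‖) atTop (𝓝 0) := by
    have := (((hF.max.tendsto_J y₀).sub_const y₀).norm).const_mul √c
    simpa using this
  have hcont : ContinuousOn y' (Icc 0 T) := by
    have hu : TendstoUniformlyOn y y' atTop (Icc 0 T) := by
      rw [Metric.tendstoUniformlyOn_iff]
      intro ε hε
      filter_upwards [hδ.eventually (gt_mem_nhds hε)] with n hn t ht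
      rw [dist_comm, dist_eq_norm]
      exact (hunif n t ht).trans_lt hn
    exact hu.continuousOn (Frequently.of_forall fun n => (h n).sol.cont)
  have hL2 : Tendsto (fun n => ∫ s in Ioo 0 T, ‖Y n s - Y' s‖ ^ 2) atTop (𝓝 0) := by
    have h1 := (tendsto_iff_norm_sub_tendsto_zero.1 hY').pow 2
    rw [zero_pow two_ne_zero] at h1
    refine h1.congr fun n => ?_
    rw [norm_Lp_sq]
    refine integral_congr_ae ?_
    filter_upwards [(h n).memLp.coeFn_toLp, Lp.coeFn_sub (W n) Y'] with t h2 h3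
    rw [h3, Pi.sub_apply, h2]
  refine ⟨y', Y', ⟨hcont, fun t ht => ?_⟩, Lp.memLp Y', ?_⟩
  · have hsub : Icc 0 t ⊆ Icc 0 T := Icc_subset_Icc_right ht.2
    have l1 : Tendsto (fun n => ∫ s in (0 : ℝ)..t, y n s) atTop (𝓝 (∫ s in (0 : ℝ)..t, y' s)) := by
      refine intervalIntegral.tendsto_integral_filter_of_dominated_convergence
        (fun _ => ‖y₀‖) ?_ ?_ (by simp) ?_
      · filter_upwards with n
        rw [uIoc_of_le ht.1]
        exact ((h n).sol.cont.mono (Ioc_subset_Icc_self.trans hsub)).aestronglyMeasurable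
          measurableSet_Ioc
      · filter_upwards with n
        filter_upwards with s hs
        rw [uIoc_of_le ht.1] at hs
        exact ((h n).norm_le hF hB hT (hsub (Ioc_subset_Icc_self hs))).trans (hF.max.norm_J_le n y₀)
      · filter_upwards with s hs
        rw [uIoc_of_le ht.1] at hs
        exact hy' s (hsub (Ioc_subset_Icc_self hs))
    have l2 := tendsto_integral_bilin ht hB.symm (fun n => (h n).memLp) (Lp.memLp Y') hL2
    -- Each term of the integrated equation converges, and the graph is closed.
    refine hF.max.isClosed.mem_of_tendsto (l1.prodMk_nhds (((hy' t ht).sub (hF.max.tendsto_J y₀)).sub l2))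
      (Eventually.of_forall fun n => (h n).sol.mem t ht)
  · obtain ⟨ns, hns, hae⟩ := (tendstoInMeasure_of_tendsto_Lp hY').exists_seq_tendsto_ae
    have hall : ∀ᵐ t ∂(volume.restrict (Ioo 0 T)), ∀ n, W n t = Y n t :=
      ae_all_iff.2 fun n => (h n).memLp.coeFn_toLp
    have hall2 : ∀ᵐ t ∂(volume.restrict (Ioo 0 T)), ∀ n, j (Y n t) = y n t :=
      ae_all_iff.2 fun n => (h n).lift
    filter_upwards [hae, hall, hall2, ae_restrict_mem measurableSet_Ioo] with t h1 h2 h3 ht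
    have h4 := (j.continuous.tendsto _).comp h1
    refine tendsto_nhds_unique h4 (((hy' t (Ioo_subset_Icc_self ht)).comp hns.tendsto_atTop).congr
      fun i => ?_)
    simp [h2, h3]

/-- Solutions with initial data in the domain of `A` are regular, with a linear estimate whose
constant only depends on the norm of the initial datum in `H`. -/
theorem Frame.exists_regular_bound (hF : Frame G j Q K) (hB : Convection j Q K B) (hT : 0 ≤ T) :
    ∃ C : ℝ → ℝ, (∀ R, 0 < C R) ∧ ∀ (Y₀ : V) (v₀ : H), (j Y₀, v₀) ∈ G →
      ∃ z Z, IsRegSol G j B T Y₀ (v₀ - B Y₀ Y₀) z Z ∧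
        (∀ t ∈ Icc 0 T, ‖j (prim Y₀ Z t)‖ + ‖z t + B (prim Y₀ Z t) (prim Y₀ Z t)‖
          ≤ C ‖j Y₀‖ * (‖j Y₀‖ + ‖v₀‖)) ∧
        ∫ s in (0 : ℝ)..T, ‖Z s‖ ^ 2 ≤ (C ‖j Y₀‖ * (‖j Y₀‖ + ‖v₀‖)) ^ 2 := by
  have hK := hF.K_nonneg
  -- With `S = ‖y₀‖ + ‖A y₀‖`: `c₁` bounds the initial time derivative by `c₁ S`, `c₃` is its growth
  -- in time, and `c₂` bounds `‖Y‖²` by `c₂ (‖y‖ + ‖z‖)`. All depend on the `L²` norm `R` only, so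
  -- the final bound is linear in `S`.
  set c₁ : ℝ → ℝ := fun R => 1 + ‖B‖ * (K + ‖Q‖) * |R| with hc₁
  set c₂ : ℝ → ℝ := fun R => 2 * K * |R| + 2 * ‖Q‖ * |R| + K ^ 2 * |R| ^ 3 with hc₂
  set c₃ : ℝ → ℝ := fun R => √(IsRegSol.const Q K B T R) with hc₃
  refine ⟨fun R => (1 + c₃ R * c₁ R) * (1 + ‖B‖ * c₂ R), fun R => by positivity, fun Y₀ v₀ hm => ?_⟩
  set R := ‖j Y₀‖ with hR
  have hR0 : 0 ≤ R := norm_nonneg _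
  have hRa : |R| = R := abs_of_nonneg hR0
  set S := R + ‖v₀‖ with hS
  have hS0 : 0 ≤ S := by positivity
  have hm' : (j Y₀, (v₀ - B Y₀ Y₀) + B Y₀ Y₀) ∈ G := by rwa [sub_add_cancel]
  obtain ⟨z, Z, h⟩ := hF.exists_regSol hB hT hm'
  have hY := h.isNLSol hF.max hB hT hm'
  have hBY : ∀ Y, ‖B Y Y‖ ≤ ‖B‖ * ‖Y‖ ^ 2 := fun Y => by
    refine (B.le_opNorm₂ Y Y).trans (le_of_eq (by ring))
  have hinner : ∀ x v : H, -inner ℝ (Q x) v ≤ ‖Q‖ * ‖x‖ * ‖v‖ := by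
    intro x v
    rw [← inner_neg_right]
    refine (real_inner_le_norm _ _).trans ?_
    rw [norm_neg]
    gcongr
    exact Q.le_opNorm x
  have hz₀ : ‖v₀ - B Y₀ Y₀‖ ≤ c₁ R * S := by
    have a1 := hF.multiplier.le _ _ hm Y₀ rfl
    have a2 := hinner (j Y₀) v₀
    -- The smoothing inequality gives `‖Y₀‖² ≤ K R² + ‖Q‖ R ‖v₀‖`: quadratic in the datum, but with
    -- one factor `R`.
    have a3 : ‖Y₀‖ ^ 2 ≤ (K + ‖Q‖) * R * S := by
      rw [← hR] at a1 a2
      have : 0 ≤ K * R * ‖v₀‖ := by positivity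
      have : 0 ≤ ‖Q‖ * R * R := by positivity
      rw [hS]
      nlinarith
    have a4 := norm_sub_le v₀ (B Y₀ Y₀)
    have a5 : ‖B‖ * ‖Y₀‖ ^ 2 ≤ ‖B‖ * ((K + ‖Q‖) * R * S) := by gcongr
    have a6 := hBY Y₀
    have a7 : ‖v₀‖ ≤ S := by linarith
    simp only [hc₁, hRa]
    linarith
  have hbound := fun t ht => h.bound hF hB hT le_rfl hm' (t := t) ht
  have hc30 : 0 ≤ c₃ R := Real.sqrt_nonneg _
  have hc3 : c₃ R ^ 2 = IsRegSol.const Q K B T R := Real.sq_sqrt (IsRegSol.const_pos _ _ _ _ _).le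
  have hc10 : 0 ≤ c₁ R := by positivity
  have hc20 : 0 ≤ c₂ R := by positivity
  have hb2 : ∀ t ∈ Icc 0 T, ‖z t‖ ^ 2 + ∫ s in (0 : ℝ)..t, ‖Z s‖ ^ 2 ≤ (c₃ R * (c₁ R * S)) ^ 2 := by
    intro t ht
    refine (hbound t ht).trans ?_
    rw [mul_pow, hc3]
    have := (IsRegSol.const_pos Q K B T R).le
    gcongr
  have hzt : ∀ t ∈ Icc 0 T, ‖z t‖ ≤ c₃ R * c₁ R * S := by
    intro t ht
    have h0 : 0 ≤ ∫ s in (0 : ℝ)..t, ‖Z s‖ ^ 2 :=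
      intervalIntegral.integral_nonneg ht.1 fun _ _ => by positivity
    refine le_of_sq_le_sq ?_ (by positivity)
    have := hb2 t ht
    rw [mul_assoc]
    linarith
  refine ⟨z, Z, h, fun t ht => ?_, ?_⟩
  · set Y := prim Y₀ Z t with hYdef
    have b1 : ‖j Y‖ ≤ R := hY.norm_le hF hB hT ht
    have b2 := hzt t ht
    have b3 := hF.multiplier.le _ _ (h.mem hB hm' ht) Y rfl
    rw [inner_add_right] at b3
    have b4 := hinner (j Y) (z t)
    have b5 := (abs_le.1 (hB.bound Y)).1
    -- Smoothing inequality at `A y = z + B(y, y)`. The term `⟪Q y, B(y, y)⟫` is at most `K ‖Y‖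
    -- ‖y‖²` and is absorbed by Young's inequality.
    have b6 : ‖Y‖ ^ 2 ≤ 2 * K * ‖j Y‖ ^ 2 + 2 * ‖Q‖ * ‖j Y‖ * ‖z t‖ + K ^ 2 * ‖j Y‖ ^ 4 := by
      nlinarith [sq_nonneg (‖Y‖ - K * ‖j Y‖ ^ 2)]
    have b7 : ‖Y‖ ^ 2 ≤ c₂ R * (‖j Y‖ + ‖z t‖) := by
      have p1 : 2 * K * ‖j Y‖ ^ 2 ≤ 2 * K * R * ‖j Y‖ := by
        rw [pow_two, ← mul_assoc]; gcongr
      have p2 : 2 * ‖Q‖ * ‖j Y‖ * ‖z t‖ ≤ 2 * ‖Q‖ * R * ‖z t‖ := by gcongr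
      have p3 : K ^ 2 * ‖j Y‖ ^ 4 ≤ K ^ 2 * R ^ 3 * ‖j Y‖ := by
        rw [pow_succ ‖j Y‖ 3, ← mul_assoc]; gcongr
      have p4 : 0 ≤ 2 * K * R * ‖z t‖ := by positivity
      have p5 : 0 ≤ 2 * ‖Q‖ * R * ‖j Y‖ := by positivity
      have p6 : 0 ≤ K ^ 2 * R ^ 3 * ‖z t‖ := by positivity
      simp only [hc₂, hRa]
      linarith
    have b8 := norm_add_le (z t) (B Y Y)
    have b9 := hBY Y
    have b10 : ‖B‖ * ‖Y‖ ^ 2 ≤ ‖B‖ * (c₂ R * (‖j Y‖ + ‖z t‖)) := by gcongr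
    have b11 : ‖j Y‖ + ‖z t‖ ≤ (1 + c₃ R * c₁ R) * S := by
      have : R ≤ S := by linarith [norm_nonneg v₀]
      linarith
    calc ‖j Y‖ + ‖z t + B Y Y‖ ≤ (1 + ‖B‖ * c₂ R) * (‖j Y‖ + ‖z t‖) := by linarith
      _ ≤ (1 + ‖B‖ * c₂ R) * ((1 + c₃ R * c₁ R) * S) := by gcongr
      _ = _ := by ring
  · have b1 := hb2 T (right_mem_Icc.2 hT)
    have b2 : c₃ R * (c₁ R * S) ≤ (1 + c₃ R * c₁ R) * (1 + ‖B‖ * c₂ R) * S := by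
      have q1 : 0 ≤ c₃ R * c₁ R := by positivity
      have q2 : 0 ≤ ‖B‖ * c₂ R := by positivity
      have : c₃ R * c₁ R ≤ (1 + c₃ R * c₁ R) * (1 + ‖B‖ * c₂ R) := by nlinarith [mul_nonneg q1 q2]
      rw [← mul_assoc]
      gcongr
    have b3 : (c₃ R * (c₁ R * S)) ^ 2 ≤ ((1 + c₃ R * c₁ R) * (1 + ‖B‖ * c₂ R) * S) ^ 2 := by gcongr
    linarith [sq_nonneg ‖z T‖]

end KdV

/-! ### Multiplication, integration and weak derivatives in `L²(0, L)` -/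

namespace KdV
set_option linter.unusedSectionVars false

variable {L : ℝ}

theorem memLp_mul_of_bound {g : ℝ → ℝ} {C : ℝ}
    (hg : AEStronglyMeasurable g (volume.restrict (Ioo 0 L)))
    (hC : ∀ᵐ x ∂(volume.restrict (Ioo 0 L)), ‖g x‖ ≤ C) (u : L2 L) :
    MemLp (fun x => g x * u x) 2 (volume.restrict (Ioo 0 L)) :=
  (Lp.memLp u).of_le_mul (hg.mul (Lp.aestronglyMeasurable u)) (c := C) (by
    filter_upwards [hC] with x hx
    rw [norm_mul]
    gcongr)

/-- Multiplication by a bounded function. -/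
def mulOp (g : ℝ → ℝ) (C : ℝ) (hg : AEStronglyMeasurable g (volume.restrict (Ioo 0 L)))
    (hC : ∀ᵐ x ∂(volume.restrict (Ioo 0 L)), ‖g x‖ ≤ C) : L2 L →L[ℝ] L2 L :=
  LinearMap.mkContinuous
    { toFun := fun u => (memLp_mul_of_bound hg hC u).toLp _
      map_add' := fun u v => by
        apply Lp.ext
        filter_upwards [(memLp_mul_of_bound hg hC (u + v)).coeFn_toLp,
          (memLp_mul_of_bound hg hC u).coeFn_toLp, (memLp_mul_of_bound hg hC v).coeFn_toLp,
          Lp.coeFn_add u v, Lp.coeFn_add ((memLp_mul_of_bound hg hC u).toLp _)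
            ((memLp_mul_of_bound hg hC v).toLp _)] with x h1 h2 h3 h4 h5
        rw [h1, h5, Pi.add_apply, h2, h3, h4, Pi.add_apply, mul_add]
      map_smul' := fun c u => by
        apply Lp.ext
        filter_upwards [(memLp_mul_of_bound hg hC (c • u)).coeFn_toLp,
          (memLp_mul_of_bound hg hC u).coeFn_toLp,
          Lp.coeFn_smul c u, Lp.coeFn_smul c ((memLp_mul_of_bound hg hC u).toLp _)]
          with x h1 h2 h3 h4
        rw [h1, RingHom.id_apply, h4, Pi.smul_apply, h2, h3, Pi.smul_apply, smul_eq_mul,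
          smul_eq_mul, mul_left_comm] }
    C fun u => by
      refine Lp.norm_le_mul_norm_of_ae_le_mul ?_
      filter_upwards [hC, (memLp_mul_of_bound hg hC u).coeFn_toLp] with x hx h1
      refine (congrArg norm h1).le.trans ?_
      rw [norm_mul]
      gcongr

theorem coeFn_mulOp {g : ℝ → ℝ} {C : ℝ} (hg : AEStronglyMeasurable g (volume.restrict (Ioo 0 L)))
    (hC : ∀ᵐ x ∂(volume.restrict (Ioo 0 L)), ‖g x‖ ≤ C) (u : L2 L) :
    mulOp g C hg hC u =ᵐ[volume.restrict (Ioo 0 L)] fun x => g x * u x :=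
  (memLp_mul_of_bound hg hC u).coeFn_toLp

theorem norm_mulOp_le {g : ℝ → ℝ} {C : ℝ} (hg : AEStronglyMeasurable g (volume.restrict (Ioo 0 L)))
    (hC : ∀ᵐ x ∂(volume.restrict (Ioo 0 L)), ‖g x‖ ≤ C) (h0 : 0 ≤ C) :
    ‖mulOp g C hg hC‖ ≤ C :=
  LinearMap.mkContinuous_norm_le _ h0 _

/-- The primitive of `v` that vanishes at the origin. -/
def prm (v : L2 L) (x : ℝ) : ℝ := ∫ s in (0 : ℝ)..x, v s

theorem prm_zero (v : L2 L) : prm v 0 = 0 := intervalIntegral.integral_same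

theorem intervalIntegrable_L2 (hL : 0 ≤ L) (v : L2 L) : IntervalIntegrable v volume 0 L :=
  intervalIntegrable_of_memLp hL (Lp.memLp v)

theorem continuousOn_prm (hL : 0 ≤ L) (v : L2 L) : ContinuousOn (prm v) (Icc 0 L) :=
  continuousOn_integral hL (intervalIntegrable_L2 hL v)

theorem integral_L2 (hL : 0 ≤ L) (f : ℝ → ℝ) :
    ∫ x in Ioo 0 L, f x = ∫ x in (0 : ℝ)..L, f x := (intervalIntegral_eq_Ioo hL f).symm

theorem abs_prm_le (v : L2 L) {x : ℝ} (hx : x ∈ Icc 0 L) : |prm v x| ≤ √L * ‖v‖ := by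
  have h := norm_integral_le_sqrt hx (Lp.memLp v)
  rwa [intervalIntegral_eq_Ioo (hx.1.trans hx.2), ← norm_Lp_sq, Real.sqrt_sq (norm_nonneg v)] at h

theorem prm_congr {f : ℝ → ℝ} {v : L2 L} (h : v =ᵐ[volume.restrict (Ioo 0 L)] f)
    {x : ℝ} (hx : x ∈ Icc 0 L) : prm v x = ∫ s in (0 : ℝ)..x, f s := by
  rw [prm, intervalIntegral_eq_Ioo hx.1, intervalIntegral_eq_Ioo hx.1]
  exact integral_congr_ae (ae_restrict_of_ae_restrict_of_subset (Ioo_subset_Ioo_right hx.2) h)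

theorem prm_add (hL : 0 ≤ L) (v w : L2 L) {x : ℝ} (hx : x ∈ Icc 0 L) :
    prm (v + w) x = prm v x + prm w x := by
  rw [prm_congr (Lp.coeFn_add v w) hx]
  exact intervalIntegral.integral_add ((intervalIntegrable_L2 hL v).mono_Icc hx)
    ((intervalIntegrable_L2 hL w).mono_Icc hx)

theorem prm_smul (c : ℝ) (v : L2 L) {x : ℝ} (hx : x ∈ Icc 0 L) :
    prm (c • v) x = c * prm v x := by
  rw [prm_congr (Lp.coeFn_smul c v) hx]
  exact intervalIntegral.integral_const_mul c _

theorem aestronglyMeasurable_prm (v : L2 L) :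
    AEStronglyMeasurable (prm v) (volume.restrict (Ioo 0 L)) := by
  rcases le_or_gt 0 L with hL | hL
  · exact ((continuousOn_prm hL v).mono Ioo_subset_Icc_self).aestronglyMeasurable measurableSet_Ioo
  · rw [Ioo_eq_empty_of_le hL.le, Measure.restrict_empty]
    exact aestronglyMeasurable_zero_measure _

theorem ae_mem_Icc : ∀ᵐ x ∂(volume.restrict (Ioo 0 L)), x ∈ Icc 0 L := by
  filter_upwards [ae_restrict_mem measurableSet_Ioo] with x hx using Ioo_subset_Icc_self hx

theorem ae_abs_prm_le (v : L2 L) :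
    ∀ᵐ x ∂(volume.restrict (Ioo 0 L)), ‖prm v x‖ ≤ √L * ‖v‖ := by
  filter_upwards [ae_mem_Icc] with x hx using abs_prm_le v hx

/-- The bilinear map that sends `(v, w)` to the product of the primitive of `v` and of `w`. -/
def volMul : L2 L →L[ℝ] L2 L →L[ℝ] L2 L :=
  LinearMap.mkContinuous
    { toFun := fun v => mulOp (prm v) (√L * ‖v‖) (aestronglyMeasurable_prm v) (ae_abs_prm_le v)
      map_add' := fun v v' => by
        ext1 w
        apply Lp.ext
        rw [add_apply]
        filter_upwards [ae_mem_Icc, coeFn_mulOp (aestronglyMeasurable_prm v) (ae_abs_prm_le v) w,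
          coeFn_mulOp (aestronglyMeasurable_prm v') (ae_abs_prm_le v') w,
          coeFn_mulOp (aestronglyMeasurable_prm (v + v')) (ae_abs_prm_le (v + v')) w,
          Lp.coeFn_add (mulOp _ _ (aestronglyMeasurable_prm v) (ae_abs_prm_le v) w)
            (mulOp _ _ (aestronglyMeasurable_prm v') (ae_abs_prm_le v') w)] with x hx h1 h2 h3 h4
        rw [h3, h4, Pi.add_apply, h1, h2, prm_add (hx.1.trans hx.2) v v' hx, add_mul]
      map_smul' := fun c v => by
        ext1 w
        apply Lp.ext
        rw [RingHom.id_apply, smul_apply]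
        filter_upwards [ae_mem_Icc, coeFn_mulOp (aestronglyMeasurable_prm v) (ae_abs_prm_le v) w,
          coeFn_mulOp (aestronglyMeasurable_prm (c • v)) (ae_abs_prm_le (c • v)) w,
          Lp.coeFn_smul c (mulOp _ _ (aestronglyMeasurable_prm v) (ae_abs_prm_le v) w)]
          with x hx h1 h2 h3
        rw [h2, h3, Pi.smul_apply, h1, prm_smul c v hx, smul_eq_mul, mul_assoc] }
    -- Cauchy–Schwarz: `|∫₀ˣ v| ≤ √L ‖v‖`, the embedding of `H¹` in the bounded functions.
    (√L) fun v =>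
      norm_mulOp_le (aestronglyMeasurable_prm v) (ae_abs_prm_le v) (by positivity)

theorem coeFn_volMul (v w : L2 L) :
    volMul v w =ᵐ[volume.restrict (Ioo 0 L)] fun x => prm v x * w x :=
  coeFn_mulOp (aestronglyMeasurable_prm v) (ae_abs_prm_le v) w

variable (L) in
/-- The constant function `1`. -/
def one : L2 L := Lp.const 2 _ 1

theorem coeFn_one : one L =ᵐ[volume.restrict (Ioo 0 L)] fun _ => 1 := Lp.coeFn_const _ _ _

variable (L) in
/-- Integration from the origin, as an operator on `L²(0, L)`. -/
def integ : L2 L →L[ℝ] L2 L := volMul.flip (one L)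

theorem coeFn_integ (v : L2 L) : integ L v =ᵐ[volume.restrict (Ioo 0 L)] prm v := by
  filter_upwards [coeFn_volMul v (one L), coeFn_one] with x h1 h2
  rw [integ, ContinuousLinearMap.flip_apply, h1, h2, mul_one]

theorem coeFn_const_add_integ (c : ℝ) (v : L2 L) :
    (c • one L + integ L v : L2 L) =ᵐ[volume.restrict (Ioo 0 L)] fun x => c + prm v x := by
  filter_upwards [Lp.coeFn_add (c • one L) (integ L v), Lp.coeFn_smul c (one L),
    coeFn_one (L := L), coeFn_integ v] with x h1 h2 h3 h4
  rw [h1, Pi.add_apply, h2, h4, Pi.smul_apply, h3, smul_eq_mul, mul_one]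

theorem inner_eq_integral (u v : L2 L) : inner ℝ u v = ∫ x in Ioo 0 L, u x * v x := by
  rw [L2.inner_def]
  exact integral_congr_ae (ae_of_all _ fun x => mul_comm _ _)

variable (L) in
/-- The integral over `(0, L)`. -/
def total : L2 L →L[ℝ] ℝ := innerSL ℝ (one L)

theorem total_apply (hL : 0 ≤ L) (v : L2 L) : total L v = prm v L := by
  rw [total, innerSL_apply_apply, inner_eq_integral, prm, ← integral_L2 hL]
  refine integral_congr_ae ?_
  filter_upwards [coeFn_one (L := L)] with x h
  rw [h, one_mul]

/-- Test functions are supported in `J`, so only the values there matter. On a piece, multiplication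
by a power of `p` is thereby multiplication by a constant. -/
theorem IsWeakDeriv.congr {J : Set ℝ} (hJ : J ⊆ Ioo 0 L) {u u' v v' : L2 L}
    (h : IsWeakDeriv J u v) (hu : u =ᵐ[volume.restrict J] u') (hv : v =ᵐ[volume.restrict J] v') :
    IsWeakDeriv J u' v' := by
  have key : ∀ {f g : ℝ → ℝ} (φ : ℝ → ℝ), f =ᵐ[volume.restrict J] g → tsupport φ ⊆ J →
      ∫ x in Ioo 0 L, f x * φ x = ∫ x in Ioo 0 L, g x * φ x := by
    intro f g φ hfg hφ
    have e : ∀ f : ℝ → ℝ, ∫ x in Ioo 0 L, f x * φ x = ∫ x in J, f x * φ x := fun f =>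
      setIntegral_eq_of_subset_of_forall_sdiff_eq_zero measurableSet_Ioo hJ fun x hx => by
        rw [image_eq_zero_of_notMem_tsupport fun h => hx.2 (hφ h), mul_zero]
    rw [e, e]
    refine integral_congr_ae ?_
    filter_upwards [hfg] with x hx
    rw [hx]
  intro φ h1 h2 h3
  rw [← key _ hu ((tsupport_deriv_subset (f := φ) (𝕜 := ℝ)).trans h3), ← key _ hv h3, h φ h1 h2 h3]

theorem eq_zero_of_tsupport_subset_Ioo {a b : ℝ} {φ : ℝ → ℝ} (h : tsupport φ ⊆ Ioo a b) :
    φ a = 0 ∧ φ b = 0 :=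
  ⟨image_eq_zero_of_notMem_tsupport fun h' => (h h').1.false,
    image_eq_zero_of_notMem_tsupport fun h' => (h h').2.false⟩

theorem isWeakDeriv_const_add_integ (hL : 0 ≤ L) {J : Set ℝ} (hJ : J ⊆ Ioo 0 L) (c : ℝ) (v : L2 L) :
    IsWeakDeriv J (c • one L + integ L v) v := by
  intro φ h1 h2 h3
  obtain ⟨h0, hφL⟩ := eq_zero_of_tsupport_subset_Ioo (h3.trans hJ)
  have hd : Continuous (deriv φ) := h1.continuous_deriv (by simp)
  have hi := intervalIntegrable_L2 hL v
  have e := mul_primitive hL hi (hd.intervalIntegrable 0 L) (u := fun x => c + prm v x) (w := φ)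
    (fun t ht => by simp [prm])
    (fun t ht => by
      rw [intervalIntegral.integral_deriv_eq_sub' φ rfl (fun x _ =>
        (h1.differentiable (by simp)).differentiableAt) hd.continuousOn]
      ring)
  rw [h0, hφL, mul_zero, mul_zero, zero_add, intervalIntegral.integral_add
    (hi.mul_continuousOn h1.continuous.continuousOn)
    ((hd.intervalIntegrable 0 L).continuousOn_mul (by
      rw [uIcc_of_le hL]
      exact continuousOn_const.add (continuousOn_prm hL v)))] at e
  rw [integral_L2 hL (fun x => v x * φ x), ← eq_neg_of_add_eq_zero_right e.symm,
    ← integral_L2 hL]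
  refine integral_congr_ae ?_
  filter_upwards [coeFn_const_add_integ c v] with x hx
  rw [hx]

theorem exists_test_function {a b : ℝ} (hab : a < b) :
    ∃ ψ : ℝ → ℝ, ContDiff ℝ ∞ ψ ∧ HasCompactSupport ψ ∧ tsupport ψ ⊆ Ioo a b ∧ ∫ x, ψ x = 1 := by
  let f : ContDiffBump ((a + b) / 2) := ⟨(b - a) / 8, (b - a) / 4, by linarith, by linarith⟩
  refine ⟨f.normed volume, f.contDiff_normed, f.hasCompactSupport_normed, ?_, f.integral_normed⟩
  rw [f.tsupport_normed_eq, Real.closedBall_eq_Icc]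
  intro x hx
  simp only [f, mem_Icc] at hx
  constructor <;> linarith [hx.1, hx.2]

/-- A test function with vanishing integral is the derivative of a test function. -/
theorem exists_primitive_test {a b : ℝ} {θ : ℝ → ℝ} (h1 : ContDiff ℝ ∞ θ)
    (h2 : HasCompactSupport θ) (h3 : tsupport θ ⊆ Ioo a b) (h4 : ∫ x, θ x = 0) :
    ∃ φ : ℝ → ℝ, ContDiff ℝ ∞ φ ∧ HasCompactSupport φ ∧ tsupport φ ⊆ Ioo a b ∧ deriv φ = θ := by
  rcases (tsupport θ).eq_empty_or_nonempty with he | hne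
  · have : θ = 0 := tsupport_eq_empty_iff.1 he
    exact ⟨0, contDiff_const, HasCompactSupport.zero, by simp [tsupport], by simp [this]⟩
  -- The primitive starting at the leftmost point `a'` of the support vanishes beyond the rightmost
  -- point `b'` since the integral is zero.
  obtain ⟨a', ha', hla⟩ := IsCompact.exists_isLeast h2 hne
  obtain ⟨b', hb', hlb⟩ := IsCompact.exists_isGreatest h2 hne
  have hz : ∀ x, x ∉ Icc a' b' → θ x = 0 := fun x hx =>
    image_eq_zero_of_notMem_tsupport fun h => hx ⟨hla h, hlb h⟩
  have hc := h1.continuous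
  have hd : ∀ x, HasDerivAt (fun x => ∫ s in a'..x, θ s) (θ x) x := fun x =>
    hc.integral_hasStrictDerivAt a' x |>.hasDerivAt
  have hdφ : deriv (fun x => ∫ s in a'..x, θ s) = θ := funext fun x => (hd x).deriv
  have hsub : tsupport (fun x => ∫ s in a'..x, θ s) ⊆ Icc a' b' := by
    refine closure_minimal (fun x hx => ?_) isClosed_Icc
    by_contra hn
    refine hx ?_
    rcases lt_or_ge x a' with hxa | hxa
    · refine intervalIntegral.integral_zero_ae ?_
      filter_upwards [Measure.ae_ne volume a'] with s hs hm
      rw [uIoc_of_ge hxa.le] at hm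
      exact hz s fun h => hs (le_antisymm hm.2 h.1)
    · have hxb : b' < x := by
        by_contra! h
        exact hn ⟨hxa, h⟩
      beta_reduce
      rw [intervalIntegral.integral_of_le hxa, ← h4]
      refine (setIntegral_eq_integral_of_ae_compl_eq_zero ?_)
      filter_upwards [Measure.ae_ne volume a'] with s hs hm
      refine hz s fun h => hm ⟨lt_of_le_of_ne h.1 hs.symm, h.2.trans hxb.le⟩
  refine ⟨fun x => ∫ s in a'..x, θ s, ?_, HasCompactSupport.of_support_subset_isCompact
    (isCompact_Icc (a := a') (b := b')) ((subset_tsupport _).trans hsub), hsub.trans fun x hx =>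
      ⟨(h3 ha').1.trans_le hx.1, hx.2.trans_lt (h3 hb').2⟩, hdφ⟩
  exact contDiff_infty_iff_deriv.2 ⟨fun x => (hd x).differentiableAt, by rwa [hdφ]⟩

theorem ae_eq_zero_of_integral_test {a b : ℝ} (hab : Ioo a b ⊆ Ioo 0 L) {f : ℝ → ℝ}
    (hf : Integrable f (volume.restrict (Ioo 0 L)))
    (h : ∀ φ : ℝ → ℝ, ContDiff ℝ ∞ φ → HasCompactSupport φ → tsupport φ ⊆ Ioo a b →
      ∫ x in Ioo 0 L, φ x * f x = 0) : ∀ᵐ x ∂(volume.restrict (Ioo a b)), f x = 0 := by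
  have := (isOpen_Ioo (a := a) (b := b)).ae_eq_zero_of_integral_contDiff_smul_eq_zero
    (hf.locallyIntegrable.locallyIntegrableOn _) h
  have h' := ae_restrict_of_ae_restrict_of_subset hab this
  filter_upwards [h', ae_restrict_mem measurableSet_Ioo] with x h1 h2 using h1 h2

theorem integrable_L2 (u : L2 L) : Integrable u (volume.restrict (Ioo 0 L)) :=
  (Lp.memLp u).integrable one_le_two

theorem IsWeakDeriv.unique {a b : ℝ} (hab : Ioo a b ⊆ Ioo 0 L) {u v v' : L2 L}
    (h : IsWeakDeriv (Ioo a b) u v) (h' : IsWeakDeriv (Ioo a b) u v') :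
    ∀ᵐ x ∂(volume.restrict (Ioo a b)), v x = v' x := by
  have := ae_eq_zero_of_integral_test hab ((integrable_L2 v).sub (integrable_L2 v'))
    fun φ h1 h2 h3 => by
      have e1 := h φ h1 h2 h3
      rw [h' φ h1 h2 h3, neg_inj] at e1
      simp only [Pi.sub_apply, mul_sub]
      rw [integral_sub]
      · simp only [mul_comm (φ _), e1, sub_self]
      · simpa only [mul_comm] using integrable_mul_test v h1.continuous h2
      · simpa only [mul_comm] using integrable_mul_test v' h1.continuous h2
  filter_upwards [this] with x hx using sub_eq_zero.1 hx

/-- The du Bois-Reymond argument. Fix a test function `ψ` of integral `1`; then `φ - (∫ φ) ψ` has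
integral zero, so it is the derivative of a test function and is orthogonal to `u`. Hence `u - ∫ u
ψ` is orthogonal to every `φ`. -/
theorem IsWeakDeriv.ae_eq_const {a b : ℝ} (h0 : a < b) (hab : Ioo a b ⊆ Ioo 0 L) {u : L2 L}
    (h : IsWeakDeriv (Ioo a b) u 0) : ∃ c : ℝ, ∀ᵐ x ∂(volume.restrict (Ioo a b)), u x = c := by
  obtain ⟨ψ, hψ1, hψ2, hψ3, hψ4⟩ := exists_test_function h0
  refine ⟨∫ x in Ioo 0 L, u x * ψ x, ?_⟩
  set c := ∫ x in Ioo 0 L, u x * ψ x with hc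
  have := ae_eq_zero_of_integral_test hab ((integrable_L2 u).sub (integrable_const c))
    fun φ h1 h2 h3 => by
      set m := ∫ x, φ x with hm
      have hi : Integrable φ := h1.continuous.integrable_of_hasCompactSupport h2
      have hψi : Integrable ψ := hψ1.continuous.integrable_of_hasCompactSupport hψ2
      obtain ⟨Φ, k1, k2, k3, k4⟩ := exists_primitive_test (θ := fun x => φ x - m * ψ x)
        (h1.sub (contDiff_const.mul hψ1)) (h2.sub (hψ2.mul_left))
        ((tsupport_sub _ _).trans (union_subset h3 ((tsupport_mul_subset_right).trans hψ3)))
        (by rw [integral_sub hi (hψi.const_mul m), integral_const_mul, hψ4, mul_one, sub_self])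
      have e1 := h Φ k1 k2 k3
      have e2 := isWeakDeriv_zero (L := L) (Ioo a b) Φ k1 k2 k3
      have e3 : ∫ x in Ioo 0 L, (0 : L2 L) x * deriv Φ x = 0 := by
        rw [integral_congr_ae (g := fun _ => (0 : ℝ)), integral_zero]
        filter_upwards [Lp.coeFn_zero ℝ 2 (volume.restrict (Ioo (0 : ℝ) L))] with x hx
        rw [hx, Pi.zero_apply, zero_mul]
      rw [← e2, e3, k4] at e1
      have i1 := integrable_mul_test u h1.continuous h2
      have i2 := integrable_mul_test u hψ1.continuous hψ2
      have e4 : ∫ x in Ioo 0 L, u x * (φ x - m * ψ x) = (∫ x in Ioo 0 L, u x * φ x) - m * c := by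
        rw [hc, ← integral_const_mul, ← integral_sub i1 (i2.const_mul m)]
        exact integral_congr_ae (ae_of_all _ fun x => by ring)
      have e5 : ∫ x in Ioo 0 L, φ x = m :=
        setIntegral_eq_integral_of_forall_compl_eq_zero fun x hx =>
          image_eq_zero_of_notMem_tsupport fun h => hx (hab (h3 h))
      simp only [Pi.sub_apply, mul_sub]
      rw [integral_sub (by simpa only [mul_comm] using i1) (hi.restrict.mul_const c),
        integral_mul_const, e5]
      simp only [mul_comm (φ _)]
      linarith
  filter_upwards [this] with x hx using sub_eq_zero.1 hx

theorem eqOn_Icc_of_ae_eq {a b : ℝ} (hab : a < b) {f g : ℝ → ℝ} (hf : ContinuousOn f (Icc a b))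
    (hg : ContinuousOn g (Icc a b)) (h : ∀ᵐ x ∂(volume.restrict (Ioo a b)), f x = g x) :
    EqOn f g (Icc a b) := by
  refine Measure.eqOn_Icc_of_ae_eq volume hab.ne ?_ hf hg
  rwa [Measure.restrict_congr_set Ioo_ae_eq_Icc] at h

/-- The continuous representative of a function with a weak derivative is a primitive of it. -/
theorem IsWeakDeriv.eq_add_prm {a b : ℝ} (h0 : a < b) (hab : Icc a b ⊆ Icc 0 L) {u v : L2 L}
    (h : IsWeakDeriv (Ioo a b) u v) {g : ℝ → ℝ} (hg : ContinuousOn g (Icc a b))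
    (hu : ∀ᵐ x ∂(volume.restrict (Ioo a b)), u x = g x) :
    ∀ x ∈ Icc a b, g x = g a + (prm v x - prm v a) := by
  have ha := hab (left_mem_Icc.2 h0.le)
  have hb := hab (right_mem_Icc.2 h0.le)
  have hL : 0 ≤ L := ha.1.trans ha.2
  have hsub : Ioo a b ⊆ Ioo 0 L := Ioo_subset_Ioo ha.1 hb.2
  have hd := h.add ((isWeakDeriv_const_add_integ hL hsub 0 v).smul (-1))
  rw [neg_one_smul, neg_one_smul, add_neg_cancel] at hd
  obtain ⟨c, hc⟩ := hd.ae_eq_const h0 hsub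
  have e : ∀ᵐ x ∂(volume.restrict (Ioo a b)), g x = c + prm v x := by
    have k1 := ae_restrict_of_ae_restrict_of_subset hsub (coeFn_const_add_integ 0 v)
    have k2 := ae_restrict_of_ae_restrict_of_subset hsub
      (Lp.coeFn_add u (-((0 : ℝ) • one L + integ L v)))
    have k3 := ae_restrict_of_ae_restrict_of_subset hsub
      (Lp.coeFn_neg ((0 : ℝ) • one L + integ L v))
    filter_upwards [hu, hc, k1, k2, k3] with x h1 h2 h3 h4 h5
    rw [h4, Pi.add_apply, h5, Pi.neg_apply, h3, h1] at h2
    linarith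
  have e' := eqOn_Icc_of_ae_eq h0 hg
    (continuousOn_const.add ((continuousOn_prm hL v).mono hab)) e
  intro x hx
  rw [e' hx, e' (left_mem_Icc.2 h0.le), Pi.add_apply, Pi.add_apply]
  ring

/-- The continuous representative vanishes at `0`, which gives `c`; uniqueness of the weak
derivative gives `v`. This makes the parametrisation by data injective. -/
theorem const_add_integ_eq_zero (hL : 0 < L) {c : ℝ} {v : L2 L} (h : c • one L + integ L v = 0) :
    c = 0 ∧ v = 0 := by
  constructor
  · have e : ∀ᵐ x ∂(volume.restrict (Ioo 0 L)), c + prm v x = 0 := by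
      have := coeFn_const_add_integ c v
      rw [h] at this
      filter_upwards [this, Lp.coeFn_zero ℝ 2 (volume.restrict (Ioo (0 : ℝ) L))] with x h1 h2
      rw [← h1, h2, Pi.zero_apply]
    have := eqOn_Icc_of_ae_eq hL (continuousOn_const.add (continuousOn_prm hL.le v))
      (continuousOn_const (c := (0 : ℝ))) e (left_mem_Icc.2 hL.le)
    simpa [prm_zero] using this
  · have h1 := isWeakDeriv_const_add_integ hL.le subset_rfl c v
    rw [h] at h1
    apply Lp.ext
    exact h1.unique subset_rfl (isWeakDeriv_zero (Ioo 0 L))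

end KdV

/-! ### Piecewise Sobolev functions and the parametrisation of the domain -/

namespace KdV
set_option linter.unusedSectionVars false

variable {L : ℝ} (D : Coeff L)

theorem Coeff.eq_of_mem_piece {k l : Fin D.N} {x : ℝ} (hk : x ∈ D.piece k) (hl : x ∈ D.piece l) :
    k = l := by
  have key : ∀ {k l : Fin D.N}, x ∈ D.piece k → x ∈ D.piece l → ¬ k < l := by
    intro k l hk hl hkl
    have : D.a k.succ ≤ D.a l.castSucc := D.strictMono_a.monotone (Fin.succ_le_castSucc_iff.2 hkl)
    exact absurd (hk.2.trans_le this) hl.1.not_gt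
  rcases lt_trichotomy k l with h | h | h
  · exact absurd h (key hk hl)
  · exact h
  · exact absurd h (key hl hk)

theorem Coeff.a_mem_Icc (i : Fin (D.N + 1)) : D.a i ∈ Icc 0 L := by
  constructor
  · rw [← D.a_zero]
    exact D.strictMono_a.monotone (Fin.zero_le _)
  · conv_rhs => rw [← D.a_last]
    exact D.strictMono_a.monotone (Fin.le_last _)

theorem Coeff.a_succ_eq_last (k : Fin D.N) (hk : (k : ℕ) + 1 = D.N) : D.a k.succ = L := by
  refine Eq.trans (congrArg D.a ?_) D.a_last
  ext
  simp [hk]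

theorem Coeff.lt_succ (k : Fin D.N) : D.a k.castSucc < D.a k.succ :=
  D.strictMono_a Fin.castSucc_lt_succ

theorem Coeff.Icc_subset (k : Fin D.N) : Icc (D.a k.castSucc) (D.a k.succ) ⊆ Icc 0 L :=
  Icc_subset_Icc (D.a_mem_Icc _).1 (D.a_mem_Icc _).2

theorem Coeff.N_pos (hL : 0 < L) : 0 < D.N := by
  by_contra h
  have h0 : D.N = 0 := by omega
  have h1 := D.a_last
  have : Fin.last D.N = 0 := by
    ext
    simp [h0]
  rw [this, D.a_zero] at h1
  exact hL.ne h1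

theorem Coeff.exists_mem_piece {x : ℝ} (hx : x ∈ Ioo 0 L) (hxa : x ∉ range D.a) :
    ∃ k, x ∈ D.piece k := by
  have key : ∀ n (hn : n < D.N + 1), x < D.a ⟨n, hn⟩ → ∃ k, x ∈ D.piece k := by
    intro n
    induction n with
    | zero =>
      intro hn h
      have : D.a ⟨0, hn⟩ = 0 := D.a_zero
      rw [this] at h
      exact absurd hx.1 h.not_gt
    | succ n ih =>
      intro hn h
      have hn' : n < D.N := by omega
      rcases lt_trichotomy x (D.a ⟨n, by omega⟩) with h' | h' | h'
      · exact ih _ h'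
      · exact absurd ⟨_, h'.symm⟩ hxa
      · exact ⟨⟨n, hn'⟩, h', h⟩
  refine key D.N (by omega) ?_
  have : D.a ⟨D.N, by omega⟩ = L := D.a_last
  rw [this]
  exact hx.2

theorem Coeff.ae_of_pieces {P : ℝ → Prop} (h : ∀ k, ∀ᵐ x ∂(volume.restrict (D.piece k)), P x) :
    ∀ᵐ x ∂(volume.restrict (Ioo 0 L)), P x := by
  have h' : ∀ k, ∀ᵐ x, x ∈ D.piece k → P x := fun k =>
    (ae_restrict_iff' measurableSet_Ioo).1 (h k)
  have hr : ∀ᵐ x, x ∉ range D.a := (finite_range D.a).countable.ae_notMem volume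
  rw [ae_restrict_iff' measurableSet_Ioo]
  filter_upwards [ae_all_iff.2 h', hr] with x h1 h2 h3
  obtain ⟨k, hk⟩ := D.exists_mem_piece h3 h2
  exact h1 k hk

/-- The function equal to `c k` on the `k`-th piece. -/
def pc (c : Fin D.N → ℝ) (x : ℝ) : ℝ := ∑ k, (D.piece k).indicator (fun _ => c k) x

theorem pc_eq {D : Coeff L} (c : Fin D.N → ℝ) {k : Fin D.N} {x : ℝ} (hx : x ∈ D.piece k) :
    pc D c x = c k := by
  rw [pc, Finset.sum_eq_single k, indicator_of_mem hx]
  · intro l _ hl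
    exact indicator_of_notMem (fun h => hl (D.eq_of_mem_piece h hx)) _
  · simp

theorem norm_pc_le (c : Fin D.N → ℝ) (x : ℝ) : ‖pc D c x‖ ≤ ∑ k, |c k| := by
  refine (norm_sum_le _ _).trans (Finset.sum_le_sum fun k _ => ?_)
  exact norm_indicator_le_norm_self (fun _ => c k) x

theorem measurable_pc (c : Fin D.N → ℝ) : Measurable (pc D c) :=
  Finset.measurable_fun_sum _ fun _ _ => measurable_const.indicator measurableSet_Ioo

/-- Multiplication by the piecewise constant function with values `c`. -/
def mulPC (c : Fin D.N → ℝ) : L2 L →L[ℝ] L2 L :=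
  mulOp (pc D c) (∑ k, |c k|) (measurable_pc D c).aestronglyMeasurable
    (ae_of_all _ (norm_pc_le D c))

theorem coeFn_mulPC (c : Fin D.N → ℝ) (u : L2 L) :
    mulPC D c u =ᵐ[volume.restrict (Ioo 0 L)] fun x => pc D c x * u x := coeFn_mulOp _ _ u

theorem mulPC_piece (c : Fin D.N → ℝ) (u : L2 L) (k : Fin D.N) :
    ∀ᵐ x ∂(volume.restrict (D.piece k)), mulPC D c u x = c k * u x := by
  filter_upwards [ae_piece D k (coeFn_mulPC D c u), ae_restrict_mem measurableSet_Ioo] with x h1 h2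
  rw [h1, pc_eq c h2]

theorem mulPC_mulPC_cancel {c d : Fin D.N → ℝ} (h : ∀ k, c k * d k = 1) (u : L2 L) :
    mulPC D c (mulPC D d u) = u := by
  apply Lp.ext
  refine D.ae_of_pieces fun k => ?_
  filter_upwards [mulPC_piece D c (mulPC D d u) k, mulPC_piece D d u k] with x h1 h2
  rw [h1, h2, ← mul_assoc, h, one_mul]

/-- Multiplication by `p^(-1/2)`. -/
def mulR : L2 L →L[ℝ] L2 L := mulPC D fun k => (√(D.p k))⁻¹

/-- Multiplication by `p^(1/2)`. -/
def mulS : L2 L →L[ℝ] L2 L := mulPC D fun k => √(D.p k)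

theorem Coeff.sqrt_pos (k : Fin D.N) : 0 < √(D.p k) := Real.sqrt_pos.2 (D.p_pos k)

theorem mulR_mulS (u : L2 L) : mulR D (mulS D u) = u :=
  mulPC_mulPC_cancel D (fun k => inv_mul_cancel₀ (D.sqrt_pos k).ne') u

theorem mulS_mulR (u : L2 L) : mulS D (mulR D u) = u :=
  mulPC_mulPC_cancel D (fun k => mul_inv_cancel₀ (D.sqrt_pos k).ne') u

theorem mulR_apply (u : L2 L) (k : Fin D.N) :
    ∀ᵐ x ∂(volume.restrict (D.piece k)), mulR D u x = (√(D.p k))⁻¹ * u x := mulPC_piece D _ u k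

theorem mulS_apply (u : L2 L) (k : Fin D.N) :
    ∀ᵐ x ∂(volume.restrict (D.piece k)), mulS D u x = √(D.p k) * u x := mulPC_piece D _ u k

theorem mulR_piece (u : L2 L) (k : Fin D.N) :
    mulR D u =ᵐ[volume.restrict (D.piece k)] ((√(D.p k))⁻¹ • u : L2 L) := by
  filter_upwards [mulR_apply D u k, ae_piece D k (Lp.coeFn_smul (√(D.p k))⁻¹ u)] with x h1 h2
  rw [h1, h2, Pi.smul_apply, smul_eq_mul]

theorem mulS_piece (u : L2 L) (k : Fin D.N) :
    mulS D u =ᵐ[volume.restrict (D.piece k)] (√(D.p k) • u : L2 L) := by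
  filter_upwards [mulS_apply D u k, ae_piece D k (Lp.coeFn_smul (√(D.p k)) u)] with x h1 h2
  rw [h1, h2, Pi.smul_apply, smul_eq_mul]

theorem isWeakDeriv_mulR {k : Fin D.N} {u v : L2 L} (h : IsWeakDeriv (D.piece k) u v) :
    IsWeakDeriv (D.piece k) (mulR D u) (mulR D v) :=
  (h.smul (√(D.p k))⁻¹).congr (piece_subset D k) (mulR_piece D u k).symm (mulR_piece D v k).symm

theorem isWeakDeriv_mulS {k : Fin D.N} {u v : L2 L} (h : IsWeakDeriv (D.piece k) u v) :
    IsWeakDeriv (D.piece k) (mulS D u) (mulS D v) :=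
  (h.smul √(D.p k)).congr (piece_subset D k) (mulS_piece D u k).symm (mulS_piece D v k).symm

/-- Continuous representatives that match at the interface points are a primitive of the
piecewise weak derivative. -/
theorem eq_const_add_prm_of_pieces (hL : 0 < L) {u v : L2 L} {g : Fin D.N → ℝ → ℝ}
    (hg : ∀ k, ContinuousOn (g k) (Icc (D.a k.castSucc) (D.a k.succ)))
    (hu : ∀ k, ∀ᵐ x ∂(volume.restrict (D.piece k)), u x = g k x)
    (hw : ∀ k, IsWeakDeriv (D.piece k) u v)
    (hj : ∀ k l : Fin D.N, (k : ℕ) + 1 = l → g k (D.a k.succ) = g l (D.a l.castSucc)) :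
    ∃ c : ℝ, u = c • one L + integ L v ∧
      ∀ k, ∀ x ∈ Icc (D.a k.castSucc) (D.a k.succ), g k x = c + prm v x := by
  have hloc : ∀ k, ∀ x ∈ Icc (D.a k.castSucc) (D.a k.succ),
      g k x = g k (D.a k.castSucc) + (prm v x - prm v (D.a k.castSucc)) := fun k =>
    (hw k).eq_add_prm (D.lt_succ k) (D.Icc_subset k) (hg k) (hu k)
  -- Matching at the interfaces carries the constant from piece to piece, starting from the value at
  -- `0`.
  have hind : ∀ n (hn : n < D.N), g ⟨n, hn⟩ (D.a (Fin.castSucc ⟨n, hn⟩))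
      = g ⟨0, D.N_pos hL⟩ 0 + prm v (D.a (Fin.castSucc ⟨n, hn⟩)) := by
    intro n
    induction n with
    | zero =>
      intro hn
      have : D.a (Fin.castSucc ⟨0, hn⟩) = 0 := D.a_zero
      rw [this, prm_zero, add_zero]
    | succ n ih =>
      intro hn
      have hn' : n < D.N := by omega
      rw [← hj ⟨n, hn'⟩ ⟨n + 1, hn⟩ rfl, hloc ⟨n, hn'⟩ _ (right_mem_Icc.2 (D.lt_succ _).le), ih]
      have : Fin.succ ⟨n, hn'⟩ = Fin.castSucc ⟨n + 1, hn⟩ := rfl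
      rw [this]
      ring
  have hall : ∀ k, ∀ x ∈ Icc (D.a k.castSucc) (D.a k.succ),
      g k x = g ⟨0, D.N_pos hL⟩ 0 + prm v x := by
    intro k x hx
    rw [hloc k x hx, hind k k.2]
    ring
  refine ⟨g ⟨0, D.N_pos hL⟩ 0, ?_, hall⟩
  apply Lp.ext
  refine D.ae_of_pieces fun k => ?_
  filter_upwards [hu k, ae_piece D k (coeFn_const_add_integ (g ⟨0, D.N_pos hL⟩ 0) v),
    ae_restrict_mem measurableSet_Ioo] with x h1 h2 h3
  rw [h1, h2, hall k x (Ioo_subset_Icc_self h3)]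

variable (L) in
/-- The data `(b, c, h)`, which encode `w₂ = c + ∫ h`, `w₁ = b + ∫ p^(-1/2) w₂` and
`w₀ = ∫ p^(-1/2) w₁`. -/
abbrev Dat : Type := ℝ × ℝ × L2 L

/-- The third component of the data. -/
def Dat.third : Dat L →L[ℝ] L2 L :=
  (ContinuousLinearMap.snd ℝ ℝ (L2 L)).comp (ContinuousLinearMap.snd ℝ ℝ (ℝ × L2 L))

/-- `w₂ = p u''`. -/
def w2 : Dat L →L[ℝ] L2 L :=
  ((ContinuousLinearMap.fst ℝ ℝ (L2 L)).comp (ContinuousLinearMap.snd ℝ ℝ (ℝ × L2 L))).smulRight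
    (one L) + (integ L).comp Dat.third

/-- `w₁ = p^(1/2) u'`. -/
def w1 : Dat L →L[ℝ] L2 L :=
  (ContinuousLinearMap.fst ℝ ℝ (ℝ × L2 L)).smulRight (one L)
    + (integ L).comp ((mulR D).comp w2)

/-- `w₀ = u`. -/
def w0 : Dat L →L[ℝ] L2 L := (integ L).comp ((mulR D).comp (w1 D))

theorem w2_apply (d : Dat L) : w2 d = d.2.1 • one L + integ L d.2.2 := rfl

theorem w1_apply (d : Dat L) : w1 D d = d.1 • one L + integ L (mulR D (w2 d)) := rfl

theorem w0_apply (d : Dat L) : w0 D d = integ L (mulR D (w1 D d)) := rfl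

/-- The values `w₁(L)` and `w₀(L)`. -/
def endValues : Dat L →L[ℝ] ℝ × ℝ :=
  (ContinuousLinearMap.fst ℝ ℝ (ℝ × L2 L) + (total L).comp ((mulR D).comp w2)).prod
    ((total L).comp ((mulR D).comp (w1 D)))

/-- The data of the functions in `𝓗³_Γ(0, L)`. -/
def dataSpace : Submodule ℝ (Dat L) := (endValues D).ker

theorem mem_dataSpace (hL : 0 ≤ L) {d : Dat L} :
    d ∈ dataSpace D ↔ d.1 + prm (mulR D (w2 d)) L = 0 ∧ prm (mulR D (w1 D d)) L = 0 := by
  rw [dataSpace, LinearMap.mem_ker, ← total_apply hL, ← total_apply hL]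
  exact Prod.mk_eq_zero

/-- The value `-p u''' - u'`. -/
def opValue : Dat L →L[ℝ] L2 L := -Dat.third - (mulR D).comp (w1 D)

theorem opValue_apply (d : Dat L) : opValue D d = -d.2.2 - mulR D (w1 D d) := rfl

/-- The graph of the operator `-p ∂ₓ³ - ∂ₓ` with domain `𝓗³_Γ(0, L)`. -/
def graph : Submodule ℝ (L2 L × L2 L) := (dataSpace D).map ((w0 D).prod (opValue D)).toLinearMap

theorem mem_graph {u v : L2 L} :
    (u, v) ∈ graph D ↔ ∃ d ∈ dataSpace D, w0 D d = u ∧ opValue D d = v := by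
  simp only [graph, Submodule.mem_map]
  exact exists_congr fun d => and_congr_right fun _ => Prod.mk_inj

/-- The weights turn the jump conditions into continuity of `p u''`, `p^(1/2) u'` and `u`, so
`eq_const_add_prm_of_pieces` makes each of them a global primitive. The condition at `0` removes the
constant of `u`, and the conditions at `L` are those of `dataSpace`. -/
theorem exists_data (hL : 0 < L) {n : ℕ} (U : HCal D n) :
    ∃ d ∈ dataSpace D, w0 D d = U.1 0 ∧ mulR D (w1 D d) = U.1 1 ∧ mulR D (mulR D (w2 d)) = U.1 2 ∧
      mulR D (mulR D d.2.2) = U.1 3 := by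
  obtain ⟨U, hU, g, hg, bg⟩ := U
  have hw0 : ∀ k, IsWeakDeriv (D.piece k) (U 0) (U 1) := hU 0
  have hw1 : ∀ k, IsWeakDeriv (D.piece k) (U 1) (U 2) := hU 1
  have hw2 : ∀ k, IsWeakDeriv (D.piece k) (U 2) (U 3) := hU 2
  obtain ⟨c, hc, hc'⟩ := eq_const_add_prm_of_pieces D hL (g := fun k x => D.p k * g k 2 x)
    (u := mulS D (mulS D (U 2))) (v := mulS D (mulS D (U 3)))
    (fun k => continuousOn_const.mul (hg k 2).1)
    (fun k => by
      filter_upwards [mulS_apply D (mulS D (U 2)) k, mulS_apply D (U 2) k, (hg k 2).2]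
        with x h1 h2 h3
      have h3' : U 2 x = g k 2 x := h3
      have := Real.mul_self_sqrt (D.p_pos k).le
      rw [h1, h2, h3', ← mul_assoc, this])
    (fun k => isWeakDeriv_mulS D (isWeakDeriv_mulS D (hw2 k)))
    bg.jump2
  obtain ⟨b, hb, hb'⟩ := eq_const_add_prm_of_pieces D hL (g := fun k x => √(D.p k) * g k 1 x)
    (u := mulS D (U 1)) (v := mulS D (U 2))
    (fun k => continuousOn_const.mul (hg k 1).1)
    (fun k => by
      filter_upwards [mulS_apply D (U 1) k, (hg k 1).2] with x h2 h3
      have h3' : U 1 x = g k 1 x := h3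
      rw [h2, h3'])
    (fun k => isWeakDeriv_mulS D (hw1 k)) bg.jump1
  obtain ⟨a, ha, ha'⟩ := eq_const_add_prm_of_pieces D hL (g := fun k x => g k 0 x)
    (u := U 0) (v := U 1) (fun k => (hg k 0).1) (fun k => (hg k 0).2) hw0 bg.jump0
  let d : Dat L := (b, c, mulS D (mulS D (U 3)))
  have e2 : w2 d = mulS D (mulS D (U 2)) := by rw [w2_apply, hc]
  have e2' : mulR D (w2 d) = mulS D (U 2) := by rw [e2, mulR_mulS]
  have e1 : w1 D d = mulS D (U 1) := by rw [w1_apply, e2', hb]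
  have e1' : mulR D (w1 D d) = U 1 := by rw [e1, mulR_mulS]
  have hN := D.N_pos hL
  let kl : Fin D.N := ⟨D.N - 1, by omega⟩
  have hkl : (kl : ℕ) + 1 = D.N := by simp only [kl]; omega
  have ha0 : a = 0 := by
    have h1 := ha' ⟨0, hN⟩ _ (left_mem_Icc.2 (D.lt_succ _).le)
    rw [bg.left ⟨0, hN⟩ rfl] at h1
    have : D.a (Fin.castSucc ⟨0, hN⟩) = 0 := D.a_zero
    rw [this, prm_zero, add_zero] at h1
    exact h1.symm
  refine ⟨d, (mem_dataSpace D hL.le).2 ⟨?_, ?_⟩, ?_, e1', ?_, ?_⟩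
  · have h1 := hb' kl _ (right_mem_Icc.2 (D.lt_succ _).le)
    rw [bg.right' kl hkl, D.a_succ_eq_last kl hkl, mul_zero] at h1
    rw [e2']
    exact h1.symm
  · have h1 := ha' kl _ (right_mem_Icc.2 (D.lt_succ _).le)
    rw [bg.right kl hkl, D.a_succ_eq_last kl hkl, ha0, zero_add] at h1
    rw [e1', h1]
  · rw [w0_apply, e1', ha, ha0, zero_smul, zero_add]
  · rw [e2', mulR_mulS]
  · exact (congrArg (mulR D) (mulR_mulS D _)).trans (mulR_mulS D _)

theorem isWeakDeriv_w0 (hL : 0 ≤ L) {J : Set ℝ} (hJ : J ⊆ Ioo 0 L) (d : Dat L) :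
    IsWeakDeriv J (w0 D d) (mulR D (w1 D d)) := by
  simpa [w0_apply] using isWeakDeriv_const_add_integ hL hJ 0 (mulR D (w1 D d))

theorem isWeakDeriv_mulR_w1 (hL : 0 ≤ L) (d : Dat L) (k : Fin D.N) :
    IsWeakDeriv (D.piece k) (mulR D (w1 D d)) (mulR D (mulR D (w2 d))) :=
  isWeakDeriv_mulR D (isWeakDeriv_const_add_integ hL (piece_subset D k) _ _)

theorem isWeakDeriv_mulR_w2 (hL : 0 ≤ L) (d : Dat L) (k : Fin D.N) :
    IsWeakDeriv (D.piece k) (mulR D (mulR D (w2 d))) (mulR D (mulR D d.2.2)) :=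
  isWeakDeriv_mulR D (isWeakDeriv_mulR D (isWeakDeriv_const_add_integ hL (piece_subset D k) _ _))

/-- The primitives themselves are the continuous representatives. They have no jump, and the weights
in the transmission conditions cancel the powers of `p`. The order `n` is free so that `H³_Γ` and
`H⁴_Γ` are both covered. -/
theorem mem_HCal_of_data (hL : 0 ≤ L) {n : ℕ} {U : PiLp 2 (fun _ : Fin (n + 3 + 1) => L2 L)}
    (hU : U ∈ HGamma D (n + 3)) {d : Dat L} (hd : d ∈ dataSpace D) (h0 : U 0 = w0 D d)
    (h1 : U 1 = mulR D (w1 D d)) (h2 : U 2 = mulR D (mulR D (w2 d))) : U ∈ HCal D n := by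
  obtain ⟨hd1, hd0⟩ := (mem_dataSpace D hL).1 hd
  have hr : ∀ k, √(D.p k) * (√(D.p k))⁻¹ = 1 := fun k => mul_inv_cancel₀ (D.sqrt_pos k).ne'
  have hp : ∀ k, D.p k * ((√(D.p k))⁻¹ * (√(D.p k))⁻¹) = 1 := fun k => by
    rw [← mul_inv, Real.mul_self_sqrt (D.p_pos k).le, mul_inv_cancel₀ (D.p_pos k).ne']
  have hc : ∀ v : L2 L, ∀ k : Fin D.N,
      ContinuousOn (prm v) (Icc (D.a k.castSucc) (D.a k.succ)) := fun v k =>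
    (continuousOn_prm hL v).mono (D.Icc_subset k)
  have hkl : ∀ k l : Fin D.N, (k : ℕ) + 1 = l → D.a k.succ = D.a l.castSucc := fun k l h => by
    congr 1
    ext
    simpa using h
  refine ⟨hU, fun k => ![prm (mulR D (w1 D d)),
    fun x => (√(D.p k))⁻¹ * (d.1 + prm (mulR D (w2 d)) x),
    fun x => (√(D.p k))⁻¹ * (√(D.p k))⁻¹ * (d.2.1 + prm d.2.2 x)], fun k j => ?_, ?_⟩
  · match j with
    | 0 =>
      refine ⟨hc _ k, ?_⟩
      filter_upwards [ae_piece D k (coeFn_integ (mulR D (w1 D d)))] with x hx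
      exact (congrArg (fun v : L2 L => v x) h0).trans hx
    | 1 =>
      refine ⟨continuousOn_const.mul (continuousOn_const.add (hc _ k)), ?_⟩
      filter_upwards [mulR_apply D (w1 D d) k,
        ae_piece D k (coeFn_const_add_integ d.1 (mulR D (w2 d)))] with x hx hx'
      refine (congrArg (fun v : L2 L => v x) h1).trans (hx.trans ?_)
      rw [w1_apply, hx']
      rfl
    | 2 =>
      refine ⟨continuousOn_const.mul (continuousOn_const.add (hc _ k)), ?_⟩
      filter_upwards [mulR_apply D (mulR D (w2 d)) k, mulR_apply D (w2 d) k,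
        ae_piece D k (coeFn_const_add_integ d.2.1 d.2.2)] with x hx hx' hx''
      refine (congrArg (fun v : L2 L => v x) h2).trans (hx.trans ?_)
      rw [hx', w2_apply, hx'', ← mul_assoc]
      rfl
  · constructor
    · intro k hk
      have : D.a k.castSucc = 0 := by
        rw [← D.a_zero]
        congr 1
        ext
        simpa using hk
      simp [this, prm_zero]
    · intro k hk
      simp [D.a_succ_eq_last k hk, hd0]
    · intro k hk
      simp [D.a_succ_eq_last k hk, hd1]
    · intro k l h
      simp [hkl k l h]
    · intro k l h
      simp only [Matrix.cons_val_one, Matrix.cons_val_zero, ← mul_assoc, hr, hkl k l h]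
    · intro k l h
      simp only [Matrix.cons_val, ← mul_assoc, hkl k l h]
      simp only [mul_assoc _ (√(D.p _))⁻¹ (√(D.p _))⁻¹, hp]

/-- The tuple `(u, u', u'', u''')` of given data. -/
def tuple3 : Dat L →L[ℝ] PiLp 2 (fun _ : Fin (0 + 3 + 1) => L2 L) :=
  (PiLp.continuousLinearEquiv 2 ℝ (fun _ : Fin (0 + 3 + 1) => L2 L)).symm.toContinuousLinearMap.comp
    (ContinuousLinearMap.pi ![w0 D, (mulR D).comp (w1 D), (mulR D).comp ((mulR D).comp w2),
      (mulR D).comp ((mulR D).comp Dat.third)])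

theorem tuple3_mem (hL : 0 ≤ L) {d : Dat L} (hd : d ∈ dataSpace D) : tuple3 D d ∈ HCal D 0 := by
  refine mem_HCal_of_data D hL (fun j k => ?_) hd rfl rfl rfl
  match j with
  | 0 => exact isWeakDeriv_w0 D hL (piece_subset D k) d
  | 1 => exact isWeakDeriv_mulR_w1 D hL d k
  | 2 => exact isWeakDeriv_mulR_w2 D hL d k

theorem isOperatorValue_iff (hL : 0 < L) {u v : L2 L} :
    IsOperatorValue D u v ↔ (u, v) ∈ graph D := by
  rw [mem_graph]
  have key : ∀ {d : Dat L} {U1 U3 : L2 L}, mulR D (w1 D d) = U1 → mulR D (mulR D d.2.2) = U3 →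
      ((∀ k, ∀ᵐ x ∂(volume.restrict (D.piece k)), v x = -(D.p k * U3 x) - U1 x) ↔
        opValue D d = v) := by
    rintro d _ _ rfl rfl
    have e : ∀ k, ∀ᵐ x ∂(volume.restrict (D.piece k)), opValue D d x
        = -(D.p k * mulR D (mulR D d.2.2) x) - mulR D (w1 D d) x := by
      intro k
      filter_upwards [mulR_apply D (mulR D d.2.2) k, mulR_apply D d.2.2 k,
        ae_piece D k (Lp.coeFn_sub (-d.2.2) (mulR D (w1 D d))),
        ae_piece D k (Lp.coeFn_neg d.2.2)] with x h1 h2 h3 h4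
      rw [opValue_apply, h3, Pi.sub_apply, h4, Pi.neg_apply, h1, h2, ← mul_assoc,
        ← mul_assoc, mul_assoc (D.p k), ← mul_inv, Real.mul_self_sqrt (D.p_pos k).le,
        mul_inv_cancel₀ (D.p_pos k).ne', one_mul]
    constructor
    · intro h
      apply Lp.ext
      refine D.ae_of_pieces fun k => ?_
      filter_upwards [h k, e k] with x h1 h2
      rw [h1, h2]
    · rintro rfl
      exact e
  constructor
  · rintro ⟨U, hU, hv⟩
    obtain ⟨d, hd, h0, h1, h2, h3⟩ := exists_data D hL U
    exact ⟨d, hd, h0.trans hU, (key h1 h3).1 hv⟩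
  · rintro ⟨d, hd, h0, hv⟩
    exact ⟨⟨tuple3 D d, tuple3_mem D hL.le hd⟩, h0, (key (d := d) rfl rfl).2 hv⟩

end KdV

/-! ### Maximal dissipativity of `-p ∂ₓ³ - ∂ₓ` -/

namespace KdV
set_option linter.unusedSectionVars false

/-- On `[0, L]` the function `u` is a primitive of the integrable function `f`. -/
structure IsPrim (L : ℝ) (u f : ℝ → ℝ) : Prop where
  int : IntervalIntegrable f volume 0 L
  eq : ∀ t ∈ Icc 0 L, u t = u 0 + ∫ s in (0 : ℝ)..t, f s

namespace IsPrim

variable {L : ℝ} {u f w g : ℝ → ℝ}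

theorem add (h : IsPrim L u f) (h' : IsPrim L w g) :
    IsPrim L (fun x => u x + w x) (fun x => f x + g x) := by
  refine ⟨h.int.add h'.int, fun t ht => ?_⟩
  rw [intervalIntegral.integral_add (h.int.mono_Icc ht) (h'.int.mono_Icc ht), h.eq t ht, h'.eq t ht]
  ring

theorem const_mul (h : IsPrim L u f) (c : ℝ) :
    IsPrim L (fun x => c * u x) (fun x => c * f x) := by
  refine ⟨h.int.const_mul c, fun t ht => ?_⟩
  rw [intervalIntegral.integral_const_mul, h.eq t ht]
  ring

theorem continuousOn (hL : 0 ≤ L) (h : IsPrim L u f) : ContinuousOn u (Icc 0 L) :=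
  (continuousOn_const.add (continuousOn_integral hL h.int)).congr h.eq

theorem mul (hL : 0 ≤ L) (h : IsPrim L u f) (h' : IsPrim L w g) :
    IsPrim L (fun x => u x * w x) (fun x => f x * w x + u x * g x) := by
  have hu := h.continuousOn hL
  have hw := h'.continuousOn hL
  rw [← uIcc_of_le hL] at hu hw
  refine ⟨(h.int.mul_continuousOn hw).add (h'.int.continuousOn_mul hu), fun t ht => ?_⟩
  exact mul_primitive ht.1 (h.int.mono_Icc ht) (h'.int.mono_Icc ht)
    (fun s hs => h.eq s ⟨hs.1, hs.2.trans ht.2⟩) (fun s hs => h'.eq s ⟨hs.1, hs.2.trans ht.2⟩)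

theorem integral_eq (hL : 0 ≤ L) (h : IsPrim L u f) {g : ℝ → ℝ}
    (hg : ∀ᵐ x ∂(volume.restrict (Ioo 0 L)), g x = f x) : ∫ x in Ioo 0 L, g x = u L - u 0 := by
  rw [integral_congr_ae hg, integral_L2 hL, h.eq L (right_mem_Icc.2 hL)]
  ring

theorem const_add_prm (hL : 0 ≤ L) (c : ℝ) (v : L2 L) : IsPrim L (fun x => c + prm v x) v :=
  ⟨intervalIntegrable_L2 hL v, fun t _ => by rw [prm_zero, add_zero, prm]⟩

theorem prm (hL : 0 ≤ L) (v : L2 L) : IsPrim L (prm v) v :=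
  ⟨intervalIntegrable_L2 hL v, fun t _ => by rw [prm_zero, zero_add, KdV.prm]⟩

theorem of_hasDerivAt (h : ∀ x, HasDerivAt u (f x) x) (hf : Continuous f) : IsPrim L u f :=
  ⟨hf.intervalIntegrable _ _, fun t _ => by
    rw [intervalIntegral.integral_eq_sub_of_hasDerivAt (fun x _ => h x) (hf.intervalIntegrable _ _)]
    ring⟩

theorem integrable (hL : 0 ≤ L) (h : IsPrim L u f) : Integrable f (volume.restrict (Ioo 0 L)) :=
  (intervalIntegrable_iff_integrableOn_Ioo_of_le hL).1 h.int

end IsPrim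

variable {L : ℝ}

/-- Multiplication by `exp (m x)`. -/
def expOp (m : ℝ) : L2 L →L[ℝ] L2 L :=
  mulOp (fun x => Real.exp (m * x)) (Real.exp (|m| * |L|))
    (by fun_prop : Measurable fun x => Real.exp (m * x)).aestronglyMeasurable (by
      filter_upwards [ae_mem_Icc] with x hx
      rw [Real.norm_eq_abs, Real.abs_exp, Real.exp_le_exp]
      refine (le_abs_self _).trans ?_
      rw [abs_mul]
      gcongr
      exacts [hx.1, hx.2])

theorem coeFn_expOp (m : ℝ) (u : L2 L) :
    expOp m u =ᵐ[volume.restrict (Ioo 0 L)] fun x => Real.exp (m * x) * u x := coeFn_mulOp _ _ u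

theorem expOp_cancel {m n : ℝ} (h : m + n = 0) (u : L2 L) : expOp m (expOp n u) = u := by
  apply Lp.ext
  filter_upwards [coeFn_expOp m (expOp n u), coeFn_expOp n u] with x h1 h2
  rw [h1, h2, ← mul_assoc, ← Real.exp_add, ← add_mul, h, zero_mul, Real.exp_zero, one_mul]

theorem mulR_expOp (D : Coeff L) (m : ℝ) (u : L2 L) : mulR D (expOp m u) = expOp m (mulR D u) := by
  apply Lp.ext
  filter_upwards [coeFn_expOp m (mulR D u), coeFn_expOp m u, coeFn_mulPC D _ u,
    coeFn_mulPC D _ (expOp m u)] with x h1 h2 h3 h4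
  rw [h1, mulR, h4, h2, h3, mul_left_comm]

/-- Integration from the origin, conjugated by an exponential weight. -/
def weightedInteg (m : ℝ) : L2 L →L[ℝ] L2 L := (expOp (-m)).comp ((integ L).comp (expOp m))

/-- The image `a` of `v` solves `a' + m a = v`, `a(0) = 0`. Integrating `(a²)' = 2 a v - 2 m a²`
gives `m ‖a‖² ≤ ⟪a, v⟫`. So a strong exponential weight makes integration a small operator. -/
theorem norm_weightedInteg_le (hL : 0 ≤ L) {m : ℝ} (hm : 0 < m) :
    ‖(weightedInteg m : L2 L →L[ℝ] L2 L)‖ ≤ m⁻¹ := by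
  refine ContinuousLinearMap.opNorm_le_bound _ (by positivity) fun v => ?_
  set a : L2 L := weightedInteg m v with ha
  set e : ℝ → ℝ := fun x => Real.exp (-m * x)
  have he : IsPrim L e (fun x => Real.exp (-m * x) * -m) :=
    IsPrim.of_hasDerivAt (fun x => by
      have := ((hasDerivAt_id x).const_mul (-m)).exp
      rwa [mul_one] at this) (by fun_prop)
  have h1 := he.mul hL (IsPrim.prm hL (expOp m v))
  have h2 := h1.mul hL h1
  have hae : a =ᵐ[volume.restrict (Ioo 0 L)] fun x => e x * prm (expOp m v) x := by
    filter_upwards [coeFn_expOp (-m) (integ L (expOp m v)), coeFn_integ (expOp m v)] with x k1 k2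
    rw [← k2]
    exact k1
  have h3 := h2.integral_eq hL (g := fun x => 2 * (a x * v x) - 2 * m * (a x * a x)) (by
    filter_upwards [hae, coeFn_expOp m v] with x k1 k2
    rw [k1, k2]
    have : e x * Real.exp (m * x) = 1 := by
      rw [← Real.exp_add]
      simp
    linear_combination (-2 * e x * prm (expOp m v) x * v x) * this)
  have i1 : Integrable (fun x => a x * v x) (volume.restrict (Ioo 0 L)) :=
    (Lp.memLp a).integrable_mul (Lp.memLp v)
  have i2 : Integrable (fun x => a x * a x) (volume.restrict (Ioo 0 L)) :=
    (Lp.memLp a).integrable_mul (Lp.memLp a)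
  rw [integral_sub (i1.const_mul _) (i2.const_mul _), integral_const_mul, integral_const_mul,
    ← inner_eq_integral, ← inner_eq_integral, real_inner_self_eq_norm_sq, prm_zero] at h3
  have h4 := real_inner_le_norm a v
  have h5 : m * ‖a‖ ^ 2 ≤ ‖a‖ * ‖v‖ := by
    nlinarith [mul_self_nonneg (e L * prm (expOp m v) L)]
  rw [inv_mul_eq_div, le_div_iff₀ hm]
  rcases (norm_nonneg a).eq_or_lt with h0 | h0
  · rw [← h0, zero_mul]
    positivity
  · nlinarith

variable (D : Coeff L)

/-- The operator `λ - A` in terms of data. -/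
def resOp (l : ℝ) : Dat L →L[ℝ] L2 L := l • w0 D - opValue D

theorem resOp_third (l : ℝ) (h : L2 L) :
    resOp D l (0, 0, h) = l • integ L (mulR D (integ L (mulR D (integ L h))))
      + h + mulR D (integ L (mulR D (integ L h))) := by
  have e2 : w2 ((0, 0, h) : Dat L) = integ L h := by simp [w2_apply]
  have e1 : w1 D (0, 0, h) = integ L (mulR D (integ L h)) := by simp [w1_apply, e2]
  have : resOp D l (0, 0, h) = l • w0 D (0, 0, h) - opValue D (0, 0, h) := rfl
  rw [this, opValue_apply, w0_apply, e1]
  abel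

/-- With `w1(0) = w2(0) = 0` the resolvent equation is a Volterra equation `h + (iterated integrals
of h) = f`. An exponential weight, which commutes with multiplication by `p^(-1/2)`, makes the
Volterra part a contraction, and the Neumann series inverts it. -/
theorem exists_resOp_third_inverse (hL : 0 ≤ L) {l : ℝ} (hl : 0 < l) :
    ∃ S : L2 L →L[ℝ] L2 L, ∀ f, resOp D l (0, 0, S f) = f := by
  -- The Volterra part has weighted norm at most `(l + 1) ‖mulR D‖² / m = (m - 1) / m < 1`.
  set m := (l + 1) * ‖mulR D‖ ^ 2 + 1 with hm
  have hm1 : 1 ≤ m := by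
    have := norm_nonneg (mulR D)
    rw [hm]
    have : 0 ≤ (l + 1) * ‖mulR D‖ ^ 2 := by positivity
    linarith
  have hm0 : 0 < m := by linarith
  set W : L2 L →L[ℝ] L2 L := weightedInteg m
  set K : L2 L →L[ℝ] L2 L := (l • W.comp (mulR D) + mulR D).comp (W.comp ((mulR D).comp W)) with hK
  have hW : ‖W‖ ≤ m⁻¹ := norm_weightedInteg_le hL hm0
  have hW1 : ‖W‖ ≤ 1 := hW.trans (inv_le_one_of_one_le₀ hm1)
  have hKn : ‖K‖ < 1 := by
    have k1 : ‖l • W.comp (mulR D) + mulR D‖ ≤ (l + 1) * ‖mulR D‖ := by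
      refine (norm_add_le _ _).trans ?_
      rw [norm_smul, Real.norm_eq_abs, abs_of_pos hl]
      have : ‖W.comp (mulR D)‖ ≤ 1 * ‖mulR D‖ :=
        (ContinuousLinearMap.opNorm_comp_le _ _).trans (by gcongr)
      nlinarith
    have k2 : ‖W.comp ((mulR D).comp W)‖ ≤ m⁻¹ * (‖mulR D‖ * 1) := by
      refine (ContinuousLinearMap.opNorm_comp_le _ _).trans ?_
      gcongr
      exact (ContinuousLinearMap.opNorm_comp_le _ _).trans (by gcongr)
    calc ‖K‖ ≤ ((l + 1) * ‖mulR D‖) * (m⁻¹ * (‖mulR D‖ * 1)) := by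
          refine (ContinuousLinearMap.opNorm_comp_le _ _).trans ?_
          gcongr
      _ = (m - 1) / m := by
          rw [hm]
          field_simp
          ring
      _ < 1 := by
          rw [div_lt_one hm0]
          linarith
  obtain ⟨N, hN⟩ := isUnit_one_sub_of_norm_lt_one (x := -K) (by rwa [norm_neg])
  have hN' : ∀ f, (N⁻¹ : (L2 L →L[ℝ] L2 L)ˣ).1 f + K ((N⁻¹ : (L2 L →L[ℝ] L2 L)ˣ).1 f) = f := by
    intro f
    have := congrArg (fun A : L2 L →L[ℝ] L2 L => A f) (Units.mul_inv N)
    rw [hN] at this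
    simpa using this
  refine ⟨(expOp m).comp ((N⁻¹ : (L2 L →L[ℝ] L2 L)ˣ).1.comp (expOp (-m))), fun f => ?_⟩
  have hc : ∀ g : L2 L, integ L (expOp m g) = expOp m (W g) := fun g =>
    (expOp_cancel (by ring) _).symm
  rw [resOp_third]
  simp only [ContinuousLinearMap.comp_apply, hc, mulR_expOp]
  rw [← map_smul, ← map_add, ← map_add]
  have key := hN' (expOp (-m) f)
  set g := (N⁻¹ : (L2 L →L[ℝ] L2 L)ˣ).1 (expOp (-m) f)
  have hKg : K g = l • W (mulR D (W (mulR D (W g)))) + mulR D (W (mulR D (W g))) := rfl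
  have : l • W (mulR D (W (mulR D (W g)))) + g + mulR D (W (mulR D (W g))) = g + K g := by
    rw [hKg]
    abel
  rw [this, key, expOp_cancel (by ring)]

theorem coeFn_mulR (u : L2 L) :
    mulR D u =ᵐ[volume.restrict (Ioo 0 L)] fun x => mulR D (one L) x * u x := by
  filter_upwards [coeFn_mulPC D (fun k => (√(D.p k))⁻¹) u,
    coeFn_mulPC D (fun k => (√(D.p k))⁻¹) (one L), coeFn_one (L := L)] with x h1 h2 h3
  rw [mulR, h1, h2, h3, mul_one]

theorem ae_mulR_w1 (d : Dat L) : ∀ᵐ x ∂(volume.restrict (Ioo 0 L)),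
    mulR D (w1 D d) x = mulR D (one L) x * (d.1 + prm (mulR D (w2 d)) x) := by
  filter_upwards [coeFn_mulR D (w1 D d), coeFn_const_add_integ d.1 (mulR D (w2 d))] with x h1 h2
  rw [h1, w1_apply, h2]

theorem ae_mulR_w2 (d : Dat L) : ∀ᵐ x ∂(volume.restrict (Ioo 0 L)),
    mulR D (w2 d) x = mulR D (one L) x * (d.2.1 + prm d.2.2 x) := by
  filter_upwards [coeFn_mulR D (w2 d), coeFn_const_add_integ d.2.1 d.2.2] with x h1 h2
  rw [h1, w2_apply, h2]

theorem coeFn_opValue (d : Dat L) :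
    opValue D d =ᵐ[volume.restrict (Ioo 0 L)] fun x => -d.2.2 x - mulR D (w1 D d) x := by
  filter_upwards [Lp.coeFn_sub (-d.2.2) (mulR D (w1 D d)), Lp.coeFn_neg d.2.2] with x h1 h2
  rw [opValue_apply, h1, Pi.sub_apply, h2, Pi.neg_apply]

/-- The integrand is the derivative of `-w0 w2 + w1² / 2 - w0² / 2`. At `L` the end conditions make
this vanish; at `0` only `w1(0)² / 2` remains. -/
theorem inner_w0_opValue (hL : 0 ≤ L) {d : Dat L} (hd : d ∈ dataSpace D) :
    inner ℝ (w0 D d) (opValue D d) = -d.1 ^ 2 / 2 := by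
  obtain ⟨hd1, hd0⟩ := (mem_dataSpace D hL).1 hd
  have p0 := IsPrim.prm hL (mulR D (w1 D d))
  have p1 := IsPrim.const_add_prm hL d.1 (mulR D (w2 d))
  have p2 := IsPrim.const_add_prm hL d.2.1 d.2.2
  rw [inner_eq_integral, ((((p0.mul hL p2).const_mul (-1)).add ((p1.mul hL p1).const_mul (1 / 2))).add
    ((p0.mul hL p0).const_mul (-1 / 2))).integral_eq hL, hd1, hd0]
  · simp only [prm_zero]
    ring
  · filter_upwards [ae_mulR_w1 D d, ae_mulR_w2 D d, coeFn_opValue D d,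
      coeFn_integ (mulR D (w1 D d))] with x h1 h2 h3 h4
    rw [w0_apply, h4, h3]
    linear_combination (d.2.1 + prm d.2.2 x) * h1 - (d.1 + prm (mulR D (w2 d)) x) * h2

theorem eq_zero_of_w0_eq_zero (hL : 0 < L) {d : Dat L} (h : w0 D d = 0) : d = 0 := by
  have hR : ∀ u : L2 L, mulR D u = 0 → u = 0 := fun u hu => by
    rw [← mulS_mulR D u, hu, map_zero]
  have e1 : w1 D d = 0 := hR _ (const_add_integ_eq_zero hL (c := 0) (by
    rw [zero_smul, zero_add]; exact h)).2
  obtain ⟨hb, h2⟩ := const_add_integ_eq_zero hL e1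
  obtain ⟨hc, hh⟩ := const_add_integ_eq_zero hL (hR _ h2)
  exact Prod.ext hb (Prod.ext hc hh)

/-- Shooting. The solutions of the homogeneous equation form a family `Φ` parametrised by `(w1(0),
w2(0))`. If the end values of such a solution vanish, then `A u = l u` and dissipativity gives `u =
0`. So the map from parameters to end values is injective, hence surjective on `ℝ × ℝ`, and corrects
the end values of a particular solution. -/
theorem exists_resOp_eq (hL : 0 < L) {l : ℝ} (hl : 0 < l) (f : L2 L) :
    ∃ d ∈ dataSpace D, resOp D l d = f := by
  obtain ⟨S, hS⟩ := exists_resOp_third_inverse D hL.le hl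
  let ι : ℝ × ℝ →ₗ[ℝ] Dat L := LinearMap.prod (LinearMap.fst ℝ ℝ ℝ)
    (LinearMap.prod (LinearMap.snd ℝ ℝ ℝ) 0)
  let κ : L2 L →ₗ[ℝ] Dat L := LinearMap.prod 0 (LinearMap.prod 0 LinearMap.id)
  let Φ : ℝ × ℝ →ₗ[ℝ] Dat L :=
    ι - κ.comp (S.toLinearMap.comp ((resOp D l).toLinearMap.comp ι))
  have hΦ : ∀ x, resOp D l (Φ x) = 0 := by
    intro x
    have : Φ x = ι x - ((0, 0, S (resOp D l (ι x))) : Dat L) := rfl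
    rw [this, map_sub, hS, sub_self]
  let Λ : ℝ × ℝ →ₗ[ℝ] ℝ × ℝ := (endValues D).toLinearMap.comp Φ
  have hΛ : Function.Injective Λ := by
    rw [← LinearMap.ker_eq_bot, LinearMap.ker_eq_bot']
    intro x hx
    have hd : Φ x ∈ dataSpace D := hx
    have h1 := inner_w0_opValue D hL.le hd
    have h2 : opValue D (Φ x) = l • w0 D (Φ x) := (sub_eq_zero.1 (hΦ x)).symm
    rw [h2, real_inner_smul_right, real_inner_self_eq_norm_sq] at h1
    have h3 : ‖w0 D (Φ x)‖ ^ 2 ≤ 0 := by nlinarith [sq_nonneg (Φ x).1]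
    have h4 := eq_zero_of_w0_eq_zero D hL (norm_eq_zero.1 (pow_eq_zero_iff two_ne_zero |>.1
      (le_antisymm h3 (sq_nonneg _))))
    have h5 : Φ x = (x.1 - 0, x.2 - 0, 0 - S (resOp D l (ι x))) := rfl
    rw [h5] at h4
    have h6 := congrArg Prod.fst h4
    have h7 := congrArg (fun d : Dat L => d.2.1) h4
    simp only [sub_zero] at h6 h7
    exact Prod.ext h6 h7
  obtain ⟨x, hx⟩ := LinearMap.injective_iff_surjective.1 hΛ (-(endValues D (0, 0, S f)))
  have hx' : endValues D (Φ x) = -(endValues D (0, 0, S f)) := hx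
  refine ⟨Φ x + (0, 0, S f), ?_, ?_⟩
  · rw [dataSpace, LinearMap.mem_ker]
    refine (map_add (endValues D) _ _).trans ?_
    rw [hx', neg_add_cancel]
  · rw [map_add, hΦ, hS, zero_add]

theorem maxDissipative_graph (hL : 0 < L) : MaxDissipative (graph D) where
  dissip u v h := by
    obtain ⟨d, hd, rfl, rfl⟩ := (mem_graph D).1 h
    rw [inner_w0_opValue D hL.le hd]
    nlinarith [sq_nonneg d.1]
  eq_zero v h := by
    obtain ⟨d, hd, h0, rfl⟩ := (mem_graph D).1 h
    rw [eq_zero_of_w0_eq_zero D hL h0, map_zero]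
  range l hl f := by
    obtain ⟨d, hd, h⟩ := exists_resOp_eq D hL hl f
    exact ⟨w0 D d, opValue D d, (mem_graph D).2 ⟨d, hd, rfl, rfl⟩, h⟩

end KdV

/-! ### Kato smoothing and the convection term -/

namespace KdV
set_option linter.unusedSectionVars false

variable {L : ℝ}

variable (L) in
/-- The derivatives of the functions in `H¹₀(0, L)`. -/
abbrev H10 : Submodule ℝ (L2 L) := (total L).ker

theorem mem_H10 (hL : 0 ≤ L) {v : L2 L} : v ∈ H10 L ↔ prm v L = 0 := by
  rw [LinearMap.mem_ker, ← total_apply hL]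
  rfl

variable (L) in
/-- The embedding of `H¹₀(0, L)` in `L²(0, L)`. -/
def embed : H10 L →L[ℝ] L2 L := (integ L).comp (H10 L).subtypeL

theorem coeFn_embed (U : H10 L) : embed L U =ᵐ[volume.restrict (Ioo 0 L)] prm U.1 := coeFn_integ U.1

variable (L) in
/-- The symmetric bilinear form of the convection term `u uₓ`. -/
def conv : H10 L →L[ℝ] H10 L →L[ℝ] L2 L :=
  (1 / 2 : ℝ) • (volMul.bilinearComp (H10 L).subtypeL (H10 L).subtypeL
    + (volMul.bilinearComp (H10 L).subtypeL (H10 L).subtypeL).flip)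

theorem conv_apply (U W : H10 L) :
    conv L U W = (1 / 2 : ℝ) • (volMul U.1 W.1 + volMul W.1 U.1) := rfl

theorem conv_self (U : H10 L) : conv L U U = volMul U.1 U.1 := by
  rw [conv_apply, ← two_smul ℝ, smul_smul]
  norm_num

variable (D : Coeff L)

/-- An upper bound for `p^(-1/2)`. -/
def rBound : ℝ := ∑ k, |(√(D.p k))⁻¹|

theorem rBound_nonneg : 0 ≤ rBound D := Finset.sum_nonneg fun _ _ => abs_nonneg _

theorem ae_mulR_one_mem : ∀ᵐ x ∂(volume.restrict (Ioo 0 L)),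
    0 ≤ mulR D (one L) x ∧ mulR D (one L) x ≤ rBound D := by
  refine D.ae_of_pieces fun k => ?_
  filter_upwards [mulR_apply D (one L) k, ae_piece D k coeFn_one] with x h1 h2
  rw [h1, h2, mul_one]
  refine ⟨inv_nonneg.2 (D.sqrt_pos k).le, (le_abs_self _).trans ?_⟩
  exact Finset.single_le_sum (f := fun k => |(√(D.p k))⁻¹|) (fun _ _ => abs_nonneg _)
    (Finset.mem_univ k)

theorem prm_mulR_one_nonneg {x : ℝ} (hx : x ∈ Icc 0 L) : 0 ≤ prm (mulR D (one L)) x := by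
  rw [prm, intervalIntegral_eq_Ioo hx.1]
  refine integral_nonneg_of_ae ?_
  filter_upwards [ae_restrict_of_ae_restrict_of_subset (Ioo_subset_Ioo_right hx.2)
    (ae_mulR_one_mem D)] with x h using h.1

/-- The Kato multiplier. -/
def kato : L2 L →L[ℝ] L2 L := (2 / 3 * rBound D) • volMul (mulR D (one L))

theorem coeFn_kato (u : L2 L) : kato D u =ᵐ[volume.restrict (Ioo 0 L)]
    fun x => 2 / 3 * rBound D * (prm (mulR D (one L)) x * u x) := by
  filter_upwards [coeFn_volMul (mulR D (one L)) u,
    Lp.coeFn_smul (2 / 3 * rBound D) (volMul (mulR D (one L)) u)] with x h1 h2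
  have : kato D u = (2 / 3 * rBound D) • volMul (mulR D (one L)) u := rfl
  rw [this, h2, Pi.smul_apply, h1, smul_eq_mul]

/-- The constant in the multiplier estimates. -/
def katoBound : ℝ := rBound D ^ 2 / 3 + 2 / 9 * rBound D ^ 2 * √L

theorem norm_sq_eq_integral (u : L2 L) : ‖u‖ ^ 2 = ∫ x in Ioo 0 L, u x * u x := by
  rw [← inner_eq_integral, real_inner_self_eq_norm_sq]

theorem integrable_mul_L2 (u v : L2 L) :
    Integrable (fun x => u x * v x) (volume.restrict (Ioo 0 L)) :=
  (Lp.memLp u).integrable_mul (Lp.memLp v)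

/-- Let `ρ = p^(-1/2)`, `q = ∫₀ˣ ρ`. The function `-q w0 w2 + w0 w1 + q w1² / 2 - q w0² / 2`
vanishes at both ends and has derivative `q u A u + (3/2) ρ w1² - ρ w0² / 2`; the weight `ρ = q'` is
what lets the terms in `w2` cancel. Multiply by `2/3` times the upper bound of `ρ` and use `u'² = ρ²
w1²`. -/
theorem kato_smoothing (hL : 0 ≤ L) {d : Dat L} (hd : d ∈ dataSpace D) :
    ‖mulR D (w1 D d)‖ ^ 2 + inner ℝ (kato D (w0 D d)) (opValue D d)
      ≤ rBound D ^ 2 / 3 * ‖w0 D d‖ ^ 2 := by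
  obtain ⟨hd1, hd0⟩ := (mem_dataSpace D hL).1 hd
  have p0 := IsPrim.prm hL (mulR D (w1 D d))
  have p1 := IsPrim.const_add_prm hL d.1 (mulR D (w2 d))
  have p2 := IsPrim.const_add_prm hL d.2.1 d.2.2
  have pq := IsPrim.prm hL (mulR D (one L))
  have hp := (((((pq.mul hL p0).mul hL p2).const_mul (-1)).add (p0.mul hL p1)).add
    (((pq.mul hL p1).mul hL p1).const_mul (1 / 2))).add
    (((pq.mul hL p0).mul hL p0).const_mul (-1 / 2))
  have e := hp.integral_eq hL (Eventually.of_forall fun x => rfl)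
  rw [hd1, hd0] at e
  simp only [prm_zero, mul_zero, zero_mul, add_zero, sub_zero] at e
  rw [norm_sq_eq_integral, inner_eq_integral, norm_sq_eq_integral,
    ← integral_add (integrable_mul_L2 _ _) (integrable_mul_L2 _ _)]
  have hi := (hp.integrable hL).const_mul (2 / 3 * rBound D)
  have e' := integral_const_mul (μ := volume.restrict (Ioo 0 L)) (2 / 3 * rBound D) (fun x => _)
    |>.trans (congrArg (2 / 3 * rBound D * ·) e)
  have e2 := integral_add hi ((integrable_mul_L2 (w0 D d) (w0 D d)).const_mul (rBound D ^ 2 / 3))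
  rw [e', integral_const_mul, mul_zero, zero_add] at e2
  rw [← e2]
  refine integral_mono_ae ((integrable_mul_L2 _ _).add (integrable_mul_L2 _ _)) (hi.add
    ((integrable_mul_L2 _ _).const_mul _)) ?_
  filter_upwards [ae_mulR_w1 D d, ae_mulR_w2 D d, coeFn_opValue D d, ae_mulR_one_mem D,
      coeFn_integ (mulR D (w1 D d)), coeFn_kato D (w0 D d)] with x h1 h2 h3 h4 h5 h6
  rw [h6, h3, w0_apply, h5, h2]
  generalize prm (mulR D (one L)) x = q
  generalize prm (mulR D (w1 D d)) x = y0
  generalize d.2.2 x = h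
  generalize d.2.1 + prm d.2.2 x = y2
  generalize d.1 + prm (mulR D (w2 d)) x = y1 at *
  rw [h1]
  generalize mulR D (one L) x = ρ at *
  obtain ⟨k1, k2⟩ := h4
  have k3 : 0 ≤ ρ * (rBound D - ρ) * y1 ^ 2 := by
    have := sub_nonneg.2 k2
    positivity
  have k4 : 0 ≤ rBound D * (rBound D - ρ) * y0 ^ 2 := by
    have := sub_nonneg.2 k2
    have := rBound_nonneg D
    positivity
  linarith

theorem frame (hL : 0 < L) : Frame (graph D) (embed L) (kato D) (katoBound D) where
  max := maxDissipative_graph D hL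
  inj := by
    rw [injective_iff_map_eq_zero]
    intro U hU
    exact Subtype.ext (const_add_integ_eq_zero hL (c := 0) (by
      rw [zero_smul, zero_add]; exact hU)).2
  symm x y := by
    rw [inner_eq_integral, inner_eq_integral]
    refine integral_congr_ae ?_
    filter_upwards [coeFn_kato D x, coeFn_kato D y] with s h1 h2
    rw [h1, h2]
    ring
  nonneg x := by
    rw [inner_eq_integral]
    refine integral_nonneg_of_ae ?_
    filter_upwards [coeFn_kato D x, ae_mem_Icc] with s h1 h2
    rw [h1]
    have := prm_mulR_one_nonneg D h2
    have := rBound_nonneg D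
    have e : 2 / 3 * rBound D * (prm (mulR D (one L)) s * x s) * x s
      = 2 / 3 * rBound D * prm (mulR D (one L)) s * (x s) ^ 2 := by ring
    rw [Pi.zero_apply, e]
    positivity
  K_nonneg := by
    rw [katoBound]
    positivity
  lift u v h := by
    obtain ⟨d, hd, rfl, rfl⟩ := (mem_graph D).1 h
    -- The lift is `u' = p^(-1/2) w1`, of integral zero because `u(L) = u(0) = 0`.
    refine ⟨⟨mulR D (w1 D d), (mem_H10 hL.le).2 ((mem_dataSpace D hL.le).1 hd).2⟩, rfl, ?_⟩
    refine (kato_smoothing D hL.le hd).trans ?_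
    have : rBound D ^ 2 / 3 ≤ katoBound D := by
      rw [katoBound]
      linarith [show 0 ≤ 2 / 9 * rBound D ^ 2 * √L by positivity]
    gcongr

theorem convection (hL : 0 ≤ L) : Convection (embed L) (kato D) (katoBound D) (conv L) where
  symm U W := by rw [conv_apply, conv_apply, add_comm]
  skew U := by
    have hU := (mem_H10 hL).1 U.2
    have p0 := IsPrim.prm hL U.1
    rw [inner_eq_integral, (((p0.mul hL p0).mul hL p0).const_mul (1 / 3)).integral_eq hL, hU]
    · simp only [prm_zero]
      ring
    · rw [conv_self]
      filter_upwards [coeFn_embed U, coeFn_volMul U.1 U.1] with x h1 h2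
      rw [h1, h2]
      ring
  bound U := by
    have hU := (mem_H10 hL).1 U.2
    have p0 := IsPrim.prm hL U.1
    have pq := IsPrim.prm hL (mulR D (one L))
    have hb := rBound_nonneg D
    have hp := ((((pq.mul hL p0).mul hL p0).mul hL p0).const_mul (1 / 3)).const_mul
      (2 / 3 * rBound D)
    have e := hp.integral_eq hL (Eventually.of_forall fun x => rfl)
    rw [hU] at e
    simp only [prm_zero, mul_zero, sub_zero] at e
    -- Integration by parts: `∫ q u² u' = -(1/3) ∫ p^(-1/2) u³`, carried out by subtracting the
    -- vanishing integral of a derivative.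
    have key : inner ℝ (kato D (embed L U)) (conv L U U)
        = ∫ x in Ioo 0 L, -(2 / 9 * rBound D * (mulR D (one L) x * prm U.1 x ^ 3)) := by
      rw [inner_eq_integral]
      refine (sub_zero _).symm.trans ((congrArg (_ - ·) e.symm).trans ?_)
      rw [← integral_sub (integrable_mul_L2 _ _) (hp.integrable hL)]
      refine integral_congr_ae ?_
      rw [conv_self]
      filter_upwards [coeFn_kato D (embed L U), coeFn_embed U, coeFn_volMul U.1 U.1] with x h1 h2 h3
      rw [h1, h2, h3]
      ring
    rw [key, ← Real.norm_eq_abs]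
    calc _ ≤ ∫ x in Ioo 0 L, 2 / 9 * rBound D ^ 2 * (√L * ‖U‖) * (embed L U x * embed L U x) := by
          refine norm_integral_le_of_norm_le ((integrable_mul_L2 _ _).const_mul _) ?_
          filter_upwards [coeFn_embed U, ae_mulR_one_mem D, ae_abs_prm_le U.1] with x h1 h2 h3
          rw [h1, norm_neg, Real.norm_eq_abs, abs_mul _ (_ * _),
            abs_of_nonneg (by positivity : 0 ≤ 2 / 9 * rBound D), abs_mul, abs_pow,
            abs_of_nonneg h2.1, pow_succ, sq_abs]
          calc 2 / 9 * rBound D * (mulR D (one L) x * (prm U.1 x ^ 2 * |prm U.1 x|))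
              ≤ 2 / 9 * rBound D * (rBound D * (prm U.1 x ^ 2 * (√L * ‖U‖))) := by
                gcongr
                · exact h2.2
                · exact h3
            _ = _ := by ring
      _ = 2 / 9 * rBound D ^ 2 * √L * ‖U‖ * ‖embed L U‖ ^ 2 := by
          rw [integral_const_mul, ← norm_sq_eq_integral]
          ring
      _ ≤ _ := by
          have : 2 / 9 * rBound D ^ 2 * √L ≤ katoBound D := by
            rw [katoBound]
            linarith [show 0 ≤ rBound D ^ 2 / 3 by positivity]
          gcongr

end KdV

/-! ### Elliptic estimate and the fourth derivative -/

namespace KdV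
set_option linter.unusedSectionVars false

variable {L : ℝ} (D : Coeff L)

/-- The map that sends the data of `u` to `(u, A u)`. -/
def dataToGraph : dataSpace D →L[ℝ] L2 L × L2 L :=
  ((w0 D).prod (opValue D)).comp (dataSpace D).subtypeL

theorem dataToGraph_apply (d : dataSpace D) : dataToGraph D d = (w0 D d, opValue D d) := rfl

theorem range_dataToGraph : range (dataToGraph D) = graph D := by
  ext ⟨u, v⟩
  rw [SetLike.mem_coe, mem_graph]
  constructor
  · rintro ⟨d, hd⟩
    exact ⟨d, d.2, congrArg Prod.fst hd, congrArg Prod.snd hd⟩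
  · rintro ⟨d, hd, rfl, rfl⟩
    exact ⟨⟨d, hd⟩, rfl⟩

/-- The map is bounded and injective, and its range, the graph, is closed. The closed range theorem
thus yields the elliptic estimate without computation. -/
theorem exists_antilipschitz_dataToGraph (hL : 0 < L) :
    ∃ K, AntilipschitzWith K (dataToGraph D) := by
  have : CompleteSpace (dataSpace D) := by
    unfold dataSpace
    infer_instance
  refine (dataToGraph D).antilipschitz_of_injective_of_isClosed_range ?_ ?_
  · rw [injective_iff_map_eq_zero]
    intro d hd
    exact Subtype.ext (eq_zero_of_w0_eq_zero D hL (congrArg Prod.fst hd))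
  · rw [range_dataToGraph]
    exact (maxDissipative_graph D hL).isClosed

theorem exists_norm_data_le (hL : 0 < L) :
    ∃ C : ℝ, 0 ≤ C ∧ ∀ d : dataSpace D, ‖d‖ ≤ C * (‖w0 D d‖ + ‖opValue D d‖) := by
  obtain ⟨K, hK⟩ := exists_antilipschitz_dataToGraph D hL
  refine ⟨K, K.2, fun d => ?_⟩
  have h := hK.le_mul_dist d 0
  rw [map_zero, dist_zero_right, dist_zero_right] at h
  refine h.trans ?_
  gcongr
  rw [dataToGraph_apply, Prod.norm_def]
  exact max_le_add_of_nonneg (norm_nonneg _) (norm_nonneg _)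

theorem continuousOn_data (hL : 0 < L) {s : Set ℝ} {d : ℝ → dataSpace D}
    (h0 : ContinuousOn (fun t => w0 D (d t)) s) (h1 : ContinuousOn (fun t => opValue D (d t)) s) :
    ContinuousOn d s := by
  obtain ⟨K, hK⟩ := exists_antilipschitz_dataToGraph D hL
  exact ((hK.isUniformInducing (dataToGraph D).uniformContinuous).isInducing.continuousOn_iff).2
    (h0.prodMk h1)

variable (L) in
/-- The embedding of `H¹₀(0, L)` in `H¹(0, L)`. -/
def tuple1 : H10 L →L[ℝ] PiLp 2 (fun _ : Fin (1 + 1) => L2 L) :=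
  (PiLp.continuousLinearEquiv 2 ℝ (fun _ : Fin (1 + 1) => L2 L)).symm.toContinuousLinearMap.comp
    (ContinuousLinearMap.pi ![embed L, (H10 L).subtypeL])

theorem tuple1_mem (hL : 0 ≤ L) (U : H10 L) : tuple1 L U ∈ H1 L := by
  intro j _
  match j with
  | 0 =>
    have h := isWeakDeriv_const_add_integ hL subset_rfl 0 U.1
    rw [zero_smul, zero_add] at h
    exact h

/-- The embedding of `H¹₀(0, L)` in `H¹(0, L)`. -/
def toH1 (hL : 0 ≤ L) : H10 L →L[ℝ] H1 L := (tuple1 L).codRestrict (H1 L) (tuple1_mem hL)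

theorem toH1_zero (hL : 0 ≤ L) (U : H10 L) : (toH1 hL U).1 0 = embed L U := rfl

/-- Weak derivatives are unique, so the underlying function determines the tuple. -/
theorem H1_ext {U W : H1 L} (h : U.1 0 = W.1 0) : U = W := by
  apply Subtype.ext
  apply PiLp.ext
  intro i
  match i with
  | 0 => exact h
  | 1 =>
    have hU : IsWeakDeriv (Ioo 0 L) (U.1 0) (U.1 1) := U.2 0 ()
    have hW : IsWeakDeriv (Ioo 0 L) (W.1 0) (W.1 1) := W.2 0 ()
    rw [← h] at hW
    exact Lp.ext (hU.unique subset_rfl hW)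

/-- The product rule for primitives in `L²(0, L)`. -/
theorem volMul_const_add_integ (hL : 0 ≤ L) (b : ℝ) (f Y : L2 L) :
    volMul Y (b • one L + integ L f) = integ L (b • Y + volMul f Y + volMul Y f) := by
  apply Lp.ext
  have hp := (IsPrim.prm hL Y).mul hL (IsPrim.const_add_prm hL b f)
  have he : (b • Y + volMul f Y + volMul Y f : L2 L) =ᵐ[volume.restrict (Ioo 0 L)]
      fun x => Y x * (b + prm f x) + prm Y x * f x := by
    filter_upwards [Lp.coeFn_add (b • Y + volMul f Y) (volMul Y f),
      Lp.coeFn_add (b • Y) (volMul f Y), Lp.coeFn_smul b Y, coeFn_volMul f Y,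
      coeFn_volMul Y f] with x h1 h2 h3 h4 h5
    rw [h1, Pi.add_apply, h2, Pi.add_apply, h3, h4, h5, Pi.smul_apply, smul_eq_mul]
    ring
  filter_upwards [coeFn_volMul Y (b • one L + integ L f), coeFn_const_add_integ b f,
    coeFn_integ (b • Y + volMul f Y + volMul Y f), ae_mem_Icc] with x h1 h2 h3 hx
  rw [h1, h2, h3, prm_congr he hx, hp.eq x hx, prm_zero, zero_mul, zero_add]

theorem mulR_volMul (u v : L2 L) : mulR D (volMul u v) = volMul u (mulR D v) := by
  apply Lp.ext
  filter_upwards [coeFn_volMul u v, coeFn_volMul u (mulR D v), coeFn_mulR D v,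
    coeFn_mulR D (volMul u v)] with x h1 h2 h3 h4
  rw [h4, h1, h2, h3, mul_left_comm]

/-- The piecewise derivative of `u u'`, as a bilinear function of the data of `u` and of `u'`. -/
def convDeriv : Dat L →L[ℝ] L2 L →L[ℝ] L2 L :=
  (ContinuousLinearMap.compL ℝ (L2 L) (L2 L) (L2 L) (mulR D)).comp
      ((ContinuousLinearMap.fst ℝ ℝ (ℝ × L2 L)).smulRight (ContinuousLinearMap.id ℝ (L2 L))
        + volMul.comp ((mulR D).comp w2))
    + volMul.flip.comp ((mulR D).comp ((mulR D).comp w2))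

theorem convDeriv_apply (d : Dat L) (Y : L2 L) : convDeriv D d Y
    = mulR D (d.1 • Y + volMul (mulR D (w2 d)) Y) + volMul Y (mulR D (mulR D (w2 d))) := rfl

theorem isWeakDeriv_conv (hL : 0 ≤ L) (d : Dat L) (Y : L2 L) (k : Fin D.N) :
    IsWeakDeriv (D.piece k) (volMul Y (mulR D (w1 D d))) (convDeriv D d Y) := by
  have h := isWeakDeriv_mulR D (k := k) (isWeakDeriv_const_add_integ hL (piece_subset D k) 0
    (d.1 • Y + volMul (mulR D (w2 d)) Y + volMul Y (mulR D (w2 d))))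
  rw [zero_smul, zero_add, ← volMul_const_add_integ hL, ← w1_apply, mulR_volMul, map_add (mulR D),
    mulR_volMul D Y] at h
  rw [convDeriv_apply]
  exact h

/-- The fourth derivative of a function `u` with the given data such that
`A u = z + u u'` with `z' = Z`, where `Y = u'`. -/
def fourth (d : Dat L) (Y Z : L2 L) : L2 L :=
  -mulR D (mulR D (Z + convDeriv D d Y + mulR D (mulR D (w2 d))))

/-- From `A u = -p u''' - u' = z + u u'` one reads off `p u''' = -(z + u u' + u')`, whose right side
has a weak derivative on each piece. -/
theorem isWeakDeriv_third (hL : 0 ≤ L) {d : Dat L} {Z : L2 L}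
    (h : opValue D d = integ L Z + volMul (mulR D (w1 D d)) (mulR D (w1 D d))) (k : Fin D.N) :
    IsWeakDeriv (D.piece k) (mulR D (mulR D d.2.2)) (fourth D d (mulR D (w1 D d)) Z) := by
  have h1 := isWeakDeriv_const_add_integ hL (piece_subset D k) 0 Z
  rw [zero_smul, zero_add] at h1
  have h2 := isWeakDeriv_mulR D (isWeakDeriv_mulR D
    (((h1.add (isWeakDeriv_conv D hL d (mulR D (w1 D d)) k)).add
      (isWeakDeriv_mulR_w1 D hL d k)).smul (-1)))
  have e : d.2.2 = (-1 : ℝ) • (integ L Z + volMul (mulR D (w1 D d)) (mulR D (w1 D d))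
      + mulR D (w1 D d)) := by
    rw [← h, opValue_apply]
    module
  rw [← e, neg_one_smul, map_neg, map_neg] at h2
  exact h2

/-- The tuple `(u, u', u'', u''', u'''')`. -/
def tuple4 : Dat L × L2 L →L[ℝ] PiLp 2 (fun _ : Fin (1 + 3 + 1) => L2 L) :=
  (PiLp.continuousLinearEquiv 2 ℝ (fun _ : Fin (1 + 3 + 1) => L2 L)).symm.toContinuousLinearMap.comp
    (ContinuousLinearMap.pi
      ![(w0 D).comp (ContinuousLinearMap.fst ℝ (Dat L) (L2 L)),
        ((mulR D).comp (w1 D)).comp (ContinuousLinearMap.fst ℝ (Dat L) (L2 L)),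
        ((mulR D).comp ((mulR D).comp w2)).comp (ContinuousLinearMap.fst ℝ (Dat L) (L2 L)),
        ((mulR D).comp ((mulR D).comp Dat.third)).comp (ContinuousLinearMap.fst ℝ (Dat L) (L2 L)),
        ContinuousLinearMap.snd ℝ (Dat L) (L2 L)])

theorem tuple4_mem (hL : 0 ≤ L) {d : Dat L} (hd : d ∈ dataSpace D) {Z : L2 L}
    (h : opValue D d = integ L Z + volMul (mulR D (w1 D d)) (mulR D (w1 D d))) :
    tuple4 D (d, fourth D d (mulR D (w1 D d)) Z) ∈ HCal D 1 := by
  refine mem_HCal_of_data D hL (fun j k => ?_) hd rfl rfl rfl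
  match j with
  | 0 => exact isWeakDeriv_w0 D hL (piece_subset D k) d
  | 1 => exact isWeakDeriv_mulR_w1 D hL d k
  | 2 => exact isWeakDeriv_mulR_w2 D hL d k
  | 3 => exact isWeakDeriv_third D hL h k

/-- The only nonlinear contribution is `(u u')'`, bounded by `‖d‖ ‖Y‖`. After integration in time,
`‖Y‖` is controlled by the `L²` norm of the initial datum, so the bound remains linear in the `H³_Γ`
norm. -/
theorem exists_norm_tuple4_le : ∃ C : ℝ, 0 ≤ C ∧ ∀ (d : Dat L) (Y Z : L2 L),
    ‖tuple4 D (d, fourth D d Y Z)‖ ≤ C * (‖Z‖ + ‖d‖ * ‖Y‖ + ‖d‖) := by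
  set R := ‖mulR D‖
  set A := R * (R * (1 + ‖convDeriv D‖ + R * (R * ‖(w2 : Dat L →L[ℝ] L2 L)‖)))
  refine ⟨‖tuple4 D‖ * (1 + A), by positivity, fun d Y Z => ?_⟩
  have hR : ∀ v, ‖mulR D v‖ ≤ R * ‖v‖ := fun v => (mulR D).le_opNorm v
  have h1 : ‖fourth D d Y Z‖ ≤ R * (R * (‖Z‖ + ‖convDeriv D‖ * ‖d‖ * ‖Y‖
      + R * (R * (‖(w2 : Dat L →L[ℝ] L2 L)‖ * ‖d‖)))) := by
    rw [fourth, norm_neg]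
    refine (hR _).trans ?_
    gcongr
    refine (hR _).trans ?_
    gcongr
    refine (norm_add₃_le).trans ?_
    gcongr
    · exact (convDeriv D).le_opNorm₂ d Y
    · refine (hR _).trans ?_
      gcongr
      refine (hR _).trans ?_
      gcongr
      exact w2.le_opNorm d
  have hs : 0 ≤ ‖Z‖ + ‖d‖ * ‖Y‖ + ‖d‖ := by positivity
  have h2 : ‖fourth D d Y Z‖ ≤ A * (‖Z‖ + ‖d‖ * ‖Y‖ + ‖d‖) := by
    have k1 : ‖Z‖ ≤ 1 * (‖Z‖ + ‖d‖ * ‖Y‖ + ‖d‖) := by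
      have : 0 ≤ ‖d‖ * ‖Y‖ + ‖d‖ := by positivity
      linarith
    have k2 : ‖convDeriv D‖ * ‖d‖ * ‖Y‖ ≤ ‖convDeriv D‖ * (‖Z‖ + ‖d‖ * ‖Y‖ + ‖d‖) := by
      rw [mul_assoc]
      gcongr
      have : 0 ≤ ‖Z‖ + ‖d‖ := by positivity
      linarith
    have k3 : R * (R * (‖(w2 : Dat L →L[ℝ] L2 L)‖ * ‖d‖))
        ≤ R * (R * ‖(w2 : Dat L →L[ℝ] L2 L)‖) * (‖Z‖ + ‖d‖ * ‖Y‖ + ‖d‖) := by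
      rw [mul_assoc, mul_assoc]
      gcongr
      have : 0 ≤ ‖Z‖ + ‖d‖ * ‖Y‖ := by positivity
      linarith
    have k4 : A * (‖Z‖ + ‖d‖ * ‖Y‖ + ‖d‖) = R * (R * (1 * (‖Z‖ + ‖d‖ * ‖Y‖ + ‖d‖)
        + ‖convDeriv D‖ * (‖Z‖ + ‖d‖ * ‖Y‖ + ‖d‖)
        + R * (R * ‖(w2 : Dat L →L[ℝ] L2 L)‖) * (‖Z‖ + ‖d‖ * ‖Y‖ + ‖d‖))) := by
      simp only [A]
      ring
    rw [k4]
    exact h1.trans (by gcongr)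
  refine ((tuple4 D).le_opNorm _).trans ?_
  rw [mul_assoc]
  gcongr
  rw [Prod.norm_def]
  refine (max_le_add_of_nonneg (norm_nonneg _) (norm_nonneg _)).trans ?_
  have : 0 ≤ ‖Z‖ + ‖d‖ * ‖Y‖ := by positivity
  have h3 : ‖d‖ ≤ ‖Z‖ + ‖d‖ * ‖Y‖ + ‖d‖ := by linarith
  rw [add_mul, one_mul]
  exact add_le_add h3 h2

end KdV

/-! ### Transfer to the KdV problem -/

namespace KdV
set_option linter.unusedSectionVars false

variable {L : ℝ} (D : Coeff L) {T : ℝ}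

theorem InterSpace.ext' {E F G : Type} [NormedAddCommGroup E] [NormedAddCommGroup F]
    {κ : E → G} {ι : F → G} {y z : InterSpace T κ ι} (h1 : y.cont = z.cont) (h2 : y.sq = z.sq) :
    y = z := by
  cases y
  cases z
  simp only at h1 h2
  subst h1 h2
  rfl

theorem isKdVSemigroup (hL : 0 < L) :
    IsKdVSemigroup D (maxDissipative_graph D hL).semigroup :=
  ⟨(maxDissipative_graph D hL).isContractionSemigroup, fun u v =>
    ((maxDissipative_graph D hL).semigroup_generator u v).trans (isOperatorValue_iff D hL).symm⟩

/-- Any solution is a solution in the abstract sense. -/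
theorem IsSolution.exists_isNLSol (hT : 0 ≤ T) (hL : 0 < L) {y₀ : L2 L} {z : X0 L T}
    (hz : IsSolution D T y₀ z) : ∃ u Y, IsNLSol (graph D) (embed L) (conv L) T y₀ u Y ∧
      (∀ t : Icc (0 : ℝ) T, z.cont t = u t) ∧
      ∀ᵐ t ∂(volume.restrict (Ioo 0 T)), z.sq t = toH1 hL.le (Y t) := by
  obtain ⟨S, ⟨hS, hgen⟩, F, hF, hFz, hd⟩ := hz
  have hfr := frame D hL
  set u : ℝ → L2 L := IccExtend hT z.cont
  have hu : ∀ t : Icc (0 : ℝ) T, z.cont t = u t := fun t => (IccExtend_val hT _ t).symm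
  have hFi := intervalIntegrable_of_Ioo hT hF
  have hsol : IntSol (graph D) T y₀ F u :=
    intSol_of_duhamel hfr.max hS (fun u v => (hgen u v).trans (isOperatorValue_iff D hL)) hT hFi
      fun t ht => by rw [← hu ⟨t, ht⟩, hd]
  -- An element of `X0` need not vanish at the end points. The linear theory with the integrable
  -- source `F` supplies a lift with values in `H10 L`, and `H1_ext` identifies it with `z.sq` at
  -- almost every time.
  obtain ⟨Y, hY, hYu⟩ := hfr.exists_lift hT hsol hFi
  have hsq : ∀ᵐ t ∂(volume.restrict (Ioo 0 T)), z.sq t = toH1 hL.le (Y t) := by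
    filter_upwards [hYu, z.agree, ae_restrict_mem measurableSet_Ioo] with t h1 h2 h3
    refine H1_ext ?_
    rw [toH1_zero, h1, ← hu ⟨t, Ioo_subset_Icc_self h3⟩]
    exact h2 (Ioo_subset_Icc_self h3)
  refine ⟨u, Y, ⟨hsol.congr_source ?_, hY, hYu⟩, hu, hsq⟩
  filter_upwards [hFz, hsq] with t h1 h2
  rw [h2] at h1
  apply Lp.ext
  rw [conv_self]
  filter_upwards [h1, Lp.coeFn_neg (volMul (Y t).1 (Y t).1), coeFn_volMul (Y t).1 (Y t).1,
    coeFn_embed (Y t)] with x k1 k2 k3 k4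
  rw [k1, k2, Pi.neg_apply, k3, ← k4]
  rfl

theorem exists_X0 (hT : 0 ≤ T) (hL : 0 < L) {y₀ : L2 L} {u : ℝ → L2 L} {Y : ℝ → H10 L}
    (h : IsNLSol (graph D) (embed L) (conv L) T y₀ u Y) :
    ∃ y : X0 L T, (∀ t : Icc (0 : ℝ) T, y.cont t = u t) ∧ IsSolution D T y₀ y ∧
      (∀ z : X0 L T, IsSolution D T y₀ z → z = y) ∧
      y.norm ≤ (1 + ‖toH1 hL.le‖ * √(‖kato D‖ + 2 * katoBound D * T
        + katoBound D ^ 2 * T * ‖y₀‖ ^ 2)) * ‖y₀‖ := by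
  have hfr := frame D hL
  have hB := convection D hL.le
  have hsq : MemLp (fun t => toH1 hL.le (Y t)) 2 (volume.restrict (Ioo 0 T)) :=
    (toH1 hL.le).comp_memLp' h.memLp
  let y : X0 L T := ⟨⟨(Icc 0 T).domRestrict u, h.sol.cont.domRestrict⟩, hsq.toLp _, by
    filter_upwards [hsq.coeFn_toLp, h.lift] with t h1 h2 ht
    rw [h1]
    exact h2⟩
  have hy : y.sq =ᵐ[volume.restrict (Ioo 0 T)] fun t => toH1 hL.le (Y t) := hsq.coeFn_toLp
  have hgen := isKdVSemigroup D hL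
  have hi := h.intervalIntegrable hT
  refine ⟨y, fun t => rfl, ⟨_, hgen, fun t => -conv L (Y t) (Y t),
    (integrable_bilin (conv L) h.memLp h.memLp).neg, ?_, fun t => ?_⟩, fun z hz => ?_, ?_⟩
  · filter_upwards [hy] with t ht
    rw [ht, conv_self]
    filter_upwards [Lp.coeFn_neg (volMul (Y t).1 (Y t).1), coeFn_volMul (Y t).1 (Y t).1,
      coeFn_embed (Y t)] with x k2 k3 k4
    rw [k2, Pi.neg_apply, k3, ← k4]
    rfl
  -- Duhamel's expression is an integrated solution with the same source, so linear uniqueness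
  -- identifies it with `u`.
  · exact hfr.intSol_unique hT h.sol (intSol_of_duhamel hfr.max hgen.1
      hfr.max.semigroup_generator hT hi fun t _ => rfl) hi t.2
  · obtain ⟨w, W, hw, hzw, hzW⟩ := hz.exists_isNLSol D hT hL
    have e : ∀ t ∈ Icc 0 T, u t = w t := fun t ht => h.unique hw hfr hB hT ht
    refine InterSpace.ext' ?_ ?_
    · ext1 t
      rw [hzw t, ← e t t.2]
      rfl
    · apply Lp.ext
      filter_upwards [hy, hzW, h.lift, hw.lift, ae_restrict_mem measurableSet_Ioo]
        with t h1 h2 h3 h4 h5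
      rw [h1, h2]
      have := hfr.inj (h4.trans ((e t (Ioo_subset_Icc_self h5)).symm.trans h3.symm))
      rw [this]
  · rw [InterSpace.norm, add_mul, one_mul]
    refine add_le_add ((ContinuousMap.norm_le _ (norm_nonneg _)).2 fun t =>
      h.norm_le hfr hB hT t.2) ?_
    have hK := hfr.K_nonneg
    rw [mul_assoc]
    refine abs_le_of_sq_le_sq' ?_ (by positivity) |>.2
    have h1 : ‖y.sq‖ ^ 2 = ∫ t in Ioo 0 T, ‖toH1 hL.le (Y t)‖ ^ 2 := norm_toLp_sq hsq
    rw [h1, mul_pow, mul_pow, Real.sq_sqrt (by positivity)]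
    have h2 := h.integral_le hfr hB hT
    rw [intervalIntegral_eq_Ioo hT] at h2
    calc _ ≤ ∫ t in Ioo 0 T, ‖toH1 hL.le‖ ^ 2 * ‖Y t‖ ^ 2 := by
          refine integral_mono (integrable_norm_sq hsq) ((integrable_norm_sq h.memLp).const_mul _)
            fun t => ?_
          beta_reduce
          rw [← mul_pow]
          gcongr
          exact (toH1 hL.le).le_opNorm _
      _ = ‖toH1 hL.le‖ ^ 2 * ∫ t in Ioo 0 T, ‖Y t‖ ^ 2 := integral_const_mul _ _
      _ ≤ _ := by gcongr

/-- The data of `u ∈ 𝓗³_Γ(0, L)` and a bound for `A u`. -/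
theorem exists_data_norm_le (hL : 0 < L) (U : HCal D 0) :
    ∃ d ∈ dataSpace D, w0 D d = U.1 0 ∧
      ‖w0 D d‖ + ‖opValue D d‖ ≤ (2 + ‖mulS D‖ ^ 2) * ‖U‖ := by
  obtain ⟨d, hd, h0, h1, h2, h3⟩ := exists_data D hL U
  refine ⟨d, hd, h0, ?_⟩
  have hn : ∀ i, ‖U.1 i‖ ≤ ‖U‖ := fun i => PiLp.norm_apply_le U.1 i
  have h4 : d.2.2 = mulS D (mulS D (U.1 3)) := by rw [← h3, mulS_mulR, mulS_mulR]
  have h5 : ‖d.2.2‖ ≤ ‖mulS D‖ * (‖mulS D‖ * ‖U‖) := by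
    rw [h4]
    refine ((mulS D).le_opNorm _).trans ?_
    gcongr
    refine ((mulS D).le_opNorm _).trans ?_
    gcongr
    exact hn 3
  have h6 : ‖opValue D d‖ ≤ ‖d.2.2‖ + ‖U.1 1‖ := by
    rw [opValue_apply, h1]
    refine (norm_sub_le _ _).trans ?_
    rw [norm_neg]
  rw [h0]
  nlinarith [hn 0, hn 1]

/-- Functions of time with the given data belong to `C([0, T]; 𝓗³_Γ) ∩ L²(0, T; H⁴_Γ)`. -/
theorem exists_X3_of_data (hT : 0 ≤ T) (hL : 0 ≤ L) {d : ℝ → dataSpace D} {Y Z : ℝ → H10 L}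
    (hd : ContinuousOn d (Icc 0 T)) (hY : ContinuousOn Y (Icc 0 T))
    (hZ : MemLp Z 2 (volume.restrict (Ioo 0 T)))
    (hw1 : ∀ t ∈ Icc 0 T, mulR D (w1 D (d t)) = (Y t).1)
    (hop : ∀ᵐ t ∂(volume.restrict (Ioo 0 T)),
      opValue D (d t) = integ L (Z t).1 + volMul (Y t).1 (Y t).1)
    {m M e Ct : ℝ} (hCt : 0 ≤ Ct) (htup : ∀ (d : Dat L) (Y Z : L2 L),
      ‖tuple4 D (d, fourth D d Y Z)‖ ≤ Ct * (‖Z‖ + ‖d‖ * ‖Y‖ + ‖d‖))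
    (hm0 : 0 ≤ m) (hm : ∀ t ∈ Icc 0 T, ‖d t‖ ≤ m) (hM : ∫ s in (0 : ℝ)..T, ‖Z s‖ ^ 2 ≤ M)
    (he : ∫ s in (0 : ℝ)..T, ‖Y s‖ ^ 2 ≤ e) :
    ∃ W : X3 D T, (∀ t : Icc (0 : ℝ) T, toL2 (HCal D 0) (W.cont t) = w0 D (d t)) ∧
      W.norm ≤ ‖tuple3 D‖ * m + √(3 * Ct ^ 2 * (M + m ^ 2 * (e + T))) := by
  have hY' : MemLp Y 2 (volume.restrict (Ioo 0 T)) := memLp_of_continuousOn hY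
  let f : ℝ → PiLp 2 (fun _ : Fin (1 + 3 + 1) => L2 L) := fun t =>
    tuple4 D (d t, fourth D (d t) (Y t).1 (Z t).1)
  have hfmem : ∀ᵐ t ∂(volume.restrict (Ioo 0 T)), f t ∈ HCal D 1 := by
    filter_upwards [hop, ae_restrict_mem measurableSet_Ioo] with t h1 h2
    have ht := Ioo_subset_Icc_self h2
    have h3 := tuple4_mem D hL (d t).2 (Z := (Z t).1) (by rw [h1, hw1 t ht])
    rw [hw1 t ht] at h3
    exact h3
  -- The factor `3` comes from `(a + b + c)² ≤ 3 (a² + b² + c²)`.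
  have hbound : ∀ᵐ t ∂(volume.restrict (Ioo 0 T)), ‖f t‖ ^ 2
      ≤ 3 * Ct ^ 2 * (‖Z t‖ ^ 2 + m ^ 2 * (‖Y t‖ ^ 2 + 1)) := by
    filter_upwards [ae_restrict_mem measurableSet_Ioo] with t h2
    have k1 := htup (d t) (Y t).1 (Z t).1
    have k2 := hm t (Ioo_subset_Icc_self h2)
    have k3 : ‖f t‖ ≤ Ct * (‖Z t‖ + m * ‖Y t‖ + m) := by
      refine k1.trans ?_
      gcongr
      exacts [le_rfl, k2, le_rfl, k2]
    calc ‖f t‖ ^ 2 ≤ (Ct * (‖Z t‖ + m * ‖Y t‖ + m)) ^ 2 := by gcongr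
      _ = Ct ^ 2 * (‖Z t‖ + m * ‖Y t‖ + m) ^ 2 := by ring
      _ ≤ Ct ^ 2 * (3 * (‖Z t‖ ^ 2 + m ^ 2 * (‖Y t‖ ^ 2 + 1))) := by
          gcongr
          nlinarith [sq_nonneg (‖Z t‖ - m * ‖Y t‖), sq_nonneg (‖Z t‖ - m),
            sq_nonneg (m * ‖Y t‖ - m)]
      _ = _ := by ring
  have hfm : AEStronglyMeasurable f (volume.restrict (Ioo 0 T)) := by
    have m1 : AEStronglyMeasurable (fun t => ((d t : dataSpace D) : Dat L))
        (volume.restrict (Ioo 0 T)) :=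
      ((continuous_subtype_val.comp_continuousOn hd).mono
        Ioo_subset_Icc_self).aestronglyMeasurable measurableSet_Ioo
    have m2 : AEStronglyMeasurable (fun t => (Y t).1) (volume.restrict (Ioo 0 T)) :=
      ((continuous_subtype_val.comp_continuousOn hY).mono
        Ioo_subset_Icc_self).aestronglyMeasurable measurableSet_Ioo
    have m3 : AEStronglyMeasurable (fun t => (Z t).1) (volume.restrict (Ioo 0 T)) :=
      continuous_subtype_val.comp_aestronglyMeasurable hZ.aestronglyMeasurable
    have m4 := (convDeriv D).aestronglyMeasurable_comp₂ m1 m2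
    have m5 := (((mulR D).comp ((mulR D).comp w2)).continuous).comp_aestronglyMeasurable m1
    have m6 := (((mulR D).comp (mulR D)).continuous).comp_aestronglyMeasurable ((m3.add m4).add m5)
    exact (tuple4 D).continuous.comp_aestronglyMeasurable (m1.prodMk m6.neg)
  have hint : Integrable (fun t => 3 * Ct ^ 2 * (‖Z t‖ ^ 2 + m ^ 2 *
      (‖Y t‖ ^ 2 + 1))) (volume.restrict (Ioo 0 T)) :=
    ((integrable_norm_sq hZ).add (((integrable_norm_sq hY').add
      (integrable_const 1)).const_mul _)).const_mul _
  have hfL : MemLp f 2 (volume.restrict (Ioo 0 T)) := by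
    rw [memLp_two_iff_integrable_sq_norm hfm]
    refine hint.mono' (hfm.norm.pow 2) ?_
    filter_upwards [hbound] with t ht
    rw [norm_pow, norm_norm]
    exact ht
  classical
  -- The tuple lies in `HCal D 1` for almost every time only; the value `0` fills the null set.
  let F : ℝ → HCal D 1 := fun t => if ht : f t ∈ HCal D 1 then ⟨f t, ht⟩ else 0
  have hFf : ∀ᵐ t ∂(volume.restrict (Ioo 0 T)), (F t).1 = f t := by
    filter_upwards [hfmem] with t ht
    simp only [F, dif_pos ht]
  have hFm : AEStronglyMeasurable F (volume.restrict (Ioo 0 T)) := by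
    rw [← Topology.IsEmbedding.subtypeVal.aestronglyMeasurable_comp_iff]
    exact hfm.congr (hFf.mono fun t ht => ht.symm)
  have hFL : MemLp F 2 (volume.restrict (Ioo 0 T)) :=
    hfL.congr_norm hFm (hFf.mono fun t ht => by rw [← ht]; rfl)
  let W : X3 D T := ⟨⟨fun t => ⟨tuple3 D (d t), tuple3_mem D hL (d t).2⟩, by
      refine Continuous.subtype_mk ((tuple3 D).continuous.comp
        (continuous_subtype_val.comp ?_)) _
      exact hd.domRestrict⟩, hFL.toLp F, by
    filter_upwards [hFL.coeFn_toLp, hFf] with t h1 h2 ht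
    rw [h1, toL2, h2]
    rfl⟩
  refine ⟨W, fun t => rfl, ?_⟩
  rw [InterSpace.norm]
  refine add_le_add ((ContinuousMap.norm_le _ (by positivity)).2 fun t => ?_) ?_
  · refine ((tuple3 D).le_opNorm _).trans ?_
    gcongr
    exact hm t t.2
  · refine Real.le_sqrt_of_sq_le ?_
    have h1 : ‖W.sq‖ ^ 2 = ∫ t in Ioo 0 T, ‖F t‖ ^ 2 := norm_toLp_sq hFL
    rw [intervalIntegral_eq_Ioo hT] at hM he
    rw [h1]
    calc _ ≤ ∫ t in Ioo 0 T, 3 * Ct ^ 2 * (‖Z t‖ ^ 2 + m ^ 2 * (‖Y t‖ ^ 2 + 1)) := by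
          refine integral_mono_ae (integrable_norm_sq hFL) hint ?_
          filter_upwards [hbound, hFf] with t k1 k2
          rw [← k2] at k1
          exact k1
      _ = 3 * Ct ^ 2 * ((∫ t in Ioo 0 T, ‖Z t‖ ^ 2)
          + m ^ 2 * ((∫ t in Ioo 0 T, ‖Y t‖ ^ 2) + T)) := by
          have hi : Integrable (fun t => ‖Y t‖ ^ 2 + 1) (volume.restrict (Ioo 0 T)) :=
            (integrable_norm_sq hY').add (integrable_const 1)
          rw [integral_const_mul, integral_add (integrable_norm_sq hZ) (hi.const_mul _),
            integral_const_mul, integral_add (integrable_norm_sq hY') (integrable_const 1)]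
          simp [hT]
      _ ≤ _ := by gcongr

/-- By uniqueness `u` is the regular solution with this datum. Then `u` and `A u = z + u u'` are
continuous in time, so the data are continuous by the elliptic estimate, and the lift `Z` of `z`
gives the fourth derivative. -/
theorem exists_X3 (hT : 0 ≤ T) (hL : 0 < L) :
    ∃ C : ℝ → ℝ, (∀ R, 0 ≤ C R) ∧ ∀ (U₀ : HCal D 0) (u : ℝ → L2 L) (Y : ℝ → H10 L),
      IsNLSol (graph D) (embed L) (conv L) T (toL2 (HCal D 0) U₀) u Y →
      ∃ W : X3 D T, (∀ t : Icc (0 : ℝ) T, toL2 (HCal D 0) (W.cont t) = u t) ∧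
        W.norm ≤ C ‖toL2 (HCal D 0) U₀‖ * ‖U₀‖ := by
  have hfr := frame D hL
  have hB := convection D hL.le
  have hK := hfr.K_nonneg
  obtain ⟨C, hC, hreg⟩ := hfr.exists_regular_bound hB hT
  obtain ⟨Cd, hCd, hdat⟩ := exists_norm_data_le D hL
  obtain ⟨Ct, hCt, htup⟩ := exists_norm_tuple4_le D
  let c : ℝ → ℝ := fun R => C R * (2 + ‖mulS D‖ ^ 2)
  let e : ℝ → ℝ := fun R => (‖kato D‖ + 2 * katoBound D * T + katoBound D ^ 2 * T * R ^ 2) * R ^ 2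
  have hc : ∀ R, 0 ≤ c R := fun R => mul_nonneg (hC R).le (by positivity)
  have he : ∀ R, 0 ≤ e R := fun R => by positivity
  refine ⟨fun R => ‖tuple3 D‖ * (Cd * c R)
    + √(3 * Ct ^ 2 * (1 + Cd ^ 2 * (e R + T))) * c R, fun R => by
      have := hc R
      positivity, fun U₀ u Y h => ?_⟩
  obtain ⟨d₀, hd₀, h0, hn₀⟩ := exists_data_norm_le D hL U₀
  have h0' : toL2 (HCal D 0) U₀ = w0 D d₀ := h0.symm
  let Y₀ : H10 L := ⟨mulR D (w1 D d₀), (mem_H10 hL.le).2 ((mem_dataSpace D hL.le).1 hd₀).2⟩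
  have hY₀ : embed L Y₀ = w0 D d₀ := rfl
  obtain ⟨z, Z, hz, hb, hbZ⟩ := hreg Y₀ (opValue D d₀) ((mem_graph D).2 ⟨d₀, hd₀, rfl, rfl⟩)
  have hm : (embed L Y₀, (opValue D d₀ - conv L Y₀ Y₀) + conv L Y₀ Y₀) ∈ graph D := by
    rw [sub_add_cancel]
    exact (mem_graph D).2 ⟨d₀, hd₀, rfl, rfl⟩
  have hNL := hz.isNLSol hfr.max hB hT hm
  rw [hY₀] at hNL hb hbZ
  rw [h0'] at h ⊢
  set R := ‖w0 D d₀‖ with hR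
  set M := c R * ‖U₀‖ with hM
  have hM0 : 0 ≤ M := mul_nonneg (hc R) (norm_nonneg _)
  have hCM : C R * (R + ‖opValue D d₀‖) ≤ M := by
    have := (hC R).le
    rw [hM, mul_assoc]
    gcongr
  have hu : ∀ t ∈ Icc 0 T, embed L (prim Y₀ Z t) = u t := fun t ht => hNL.unique h hfr hB hT ht
  have hex : ∀ t, ∃ d : dataSpace D, t ∈ Icc 0 T → w0 D d = embed L (prim Y₀ Z t) ∧
      opValue D d = z t + conv L (prim Y₀ Z t) (prim Y₀ Z t) := by
    intro t
    by_cases ht : t ∈ Icc 0 T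
    · obtain ⟨d, hd, h1, h2⟩ := (mem_graph D).1 (hz.mem hB hm ht)
      exact ⟨⟨d, hd⟩, fun _ => ⟨h1, h2⟩⟩
    · exact ⟨0, fun h => absurd h ht⟩
  choose d hd using hex
  have hcp := continuousOn_prim hT hz.memLp Y₀
  have hcz := hz.sol.cont
  have hcc : ContinuousOn (fun t => z t + conv L (prim Y₀ Z t) (prim Y₀ Z t)) (Icc 0 T) :=
    hcz.add (((conv L).continuous.comp_continuousOn hcp).clm_apply hcp)
  have hdc : ContinuousOn d (Icc 0 T) := continuousOn_data D hL
    (hNL.sol.cont.congr fun t ht => (hd t ht).1) (hcc.congr fun t ht => (hd t ht).2)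
  have hdn : ∀ t ∈ Icc 0 T, ‖d t‖ ≤ Cd * M := fun t ht => by
    refine (hdat (d t)).trans ?_
    rw [(hd t ht).1, (hd t ht).2]
    gcongr
    exact (hb t ht).trans hCM
  have hw1 : ∀ t ∈ Icc 0 T, mulR D (w1 D (d t)) = (prim Y₀ Z t).1 := fun t ht => by
    have h1 : mulR D (w1 D (d t)) ∈ H10 L :=
      (mem_H10 hL.le).2 ((mem_dataSpace D hL.le).1 (d t).2).2
    have h2 : embed L ⟨_, h1⟩ = embed L (prim Y₀ Z t) := (hd t ht).1
    exact congrArg Subtype.val (hfr.inj h2)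
  have hop : ∀ᵐ t ∂(volume.restrict (Ioo 0 T)),
      opValue D (d t) = integ L (Z t).1 + volMul (prim Y₀ Z t).1 (prim Y₀ Z t).1 := by
    filter_upwards [hz.lift, ae_restrict_mem measurableSet_Ioo] with t h1 h2
    rw [(hd t (Ioo_subset_Icc_self h2)).2, ← h1, conv_self]
    rfl
  obtain ⟨W, hW, hWn⟩ := exists_X3_of_data D hT hL.le hdc hcp hz.memLp hw1 hop hCt htup
    (by positivity) hdn (M := M ^ 2) (hbZ.trans (by
      have := (hC R).le
      gcongr)) (e := e R) (hNL.integral_le hfr hB hT)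
  refine ⟨W, fun t => (hW t).trans ((hd t t.2).1.trans (hu t t.2)), hWn.trans (le_of_eq ?_)⟩
  -- `M²` factors out, so the square root is linear in `‖U₀‖`.
  have e1 : 3 * Ct ^ 2 * (M ^ 2 + (Cd * M) ^ 2 * (e R + T))
      = 3 * Ct ^ 2 * (1 + Cd ^ 2 * (e R + T)) * M ^ 2 := by ring
  rw [e1, Real.sqrt_mul' _ (sq_nonneg M), Real.sqrt_sq hM0, hM]
  ring

end KdV

end

theorem proposition2 (T L : ℝ) (hT : 0 < T) (hL : 0 < L) (D : KdV.Coeff L) :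
    ∃ C : ℝ → ℝ, (∀ r, 0 < C r) ∧
      ∀ y₀ : KdV.L2 L, ∃ y : KdV.X0 L T,
        KdV.IsSolution D T y₀ y ∧
        (∀ z : KdV.X0 L T, KdV.IsSolution D T y₀ z → z = y) ∧
        y.norm ≤ C ‖y₀‖ * ‖y₀‖ ∧
        ∀ U₀ : KdV.HCal D 0, KdV.toL2 (KdV.HCal D 0) U₀ = y₀ →
          ∃ Y : KdV.X3 D T,
            (∀ t, KdV.toL2 (KdV.HCal D 0) (Y.cont t) = y.cont t) ∧
            Y.norm ≤ C ‖y₀‖ * ‖U₀‖ := by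
  have hC₀ := (KdV.frame D hL).K_nonneg
  obtain ⟨C, hC, hX3⟩ := KdV.exists_X3 D hT.le hL
  -- The constant is the sum of those in the two estimates, so that one function serves both.
  refine ⟨fun R => (1 + ‖KdV.toH1 hL.le‖ * √(‖KdV.kato D‖ + 2 * KdV.katoBound D * T
    + KdV.katoBound D ^ 2 * T * R ^ 2)) + C R, fun R => ?_, fun y₀ => ?_⟩
  · have := hC R
    positivity
  obtain ⟨u, Y, h⟩ := (KdV.frame D hL).exists_nlSol (KdV.convection D hL.le) hT.le y₀
  obtain ⟨y, hyu, hy, hun, hn⟩ := KdV.exists_X0 D hT.le hL h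
  refine ⟨y, hy, hun, hn.trans ?_, ?_⟩
  · have := hC ‖y₀‖
    gcongr
    exact le_add_of_nonneg_right this
  · rintro U₀ rfl
    obtain ⟨W, hW, hWn⟩ := hX3 U₀ u Y h
    refine ⟨W, fun t => (hW t).trans (hyu t).symm, hWn.trans ?_⟩
    gcongr
    exact le_add_of_nonneg_left (by positivity)
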